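/- For every $r\ge 0$ and every non-trivial word $w$ in the free group $F_r$ on $r$ generators there exist constants $C,\alpha,\epsilon>0$, depending only on $w$, such that the following holds for every $n$. Let $\mathrm{U}_n$ be the group of unitary $n\times n$ complex matrices, let $\mathsf{G}_1,\dots,\mathsf{G}_r$ be independent random elements of $\mathrm{U}_n$, each distributed according to the Haar probability measure, and let $w(\mathsf{G}_1,\dots,\mathsf{G}_r)\in\mathrm{U}_n$ be obtained by substituting $\mathsf{G}_i$ for the $i$-th generator in $w$. Let $\rho\in\mathrm{Irr}(\mathrm{U}_n)$, i.e. let $\rho:\mathrm{U}_n\to\mathbb{C}$ be the character of a continuous irreducible finite-dimensional complex representation of $\mathrm{U}_n$, and let $\rho(1)$ denote its degree, the dimension of that representation. If $\rho(1)\le 2^{Cn^{\alpha}}$, then \[ \left|\mathbb{E}\bigl(\rho(w(\mathsf{G}_1,\dots,\mathsf{G}_r))\bigr)\right|\le \rho(1)^{1-\epsilon}. \] -/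

import Mathlib

open MeasureTheory

/-- The group `U_n` of unitary `n × n` complex matrices, with the topology induced from the
space of matrices. -/
abbrev UnitaryGrp (n : ℕ) : Type := Matrix.unitaryGroup (Fin n) ℂ

noncomputable instance UnitaryGrp.measurableSpace (n : ℕ) : MeasurableSpace (UnitaryGrp n) :=
  borel (UnitaryGrp n)

instance UnitaryGrp.borelSpace (n : ℕ) : BorelSpace (UnitaryGrp n) := ⟨rfl⟩

instance UnitaryGrp.compactSpace (n : ℕ) : CompactSpace (UnitaryGrp n) := by
  have hK : IsCompact (Set.univ.pi fun _ : Fin n => Set.univ.pi fun _ : Fin n =>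
      Metric.closedBall (0 : ℂ) 1) :=
    isCompact_univ_pi fun _ => isCompact_univ_pi fun _ => isCompact_closedBall _ _
  have hc : IsClosed (Matrix.unitaryGroup (Fin n) ℂ : Set (Matrix (Fin n) (Fin n) ℂ)) :=
    isClosed_unitary
  refine isCompact_iff_compactSpace.mp (hK.of_isClosed_subset hc ?_)
  intro A hA i _ j _
  simpa using entry_norm_bound_of_unitary hA i j

/-- The Haar probability measure of `U_n`. -/
noncomputable def unitaryHaar (n : ℕ) : Measure (UnitaryGrp n) := Measure.haarMeasure ⊤

instance unitaryHaar.isHaarMeasure (n : ℕ) : (unitaryHaar n).IsHaarMeasure := by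
  unfold unitaryHaar; infer_instance

instance unitaryHaar.isProbabilityMeasure (n : ℕ) : IsProbabilityMeasure (unitaryHaar n) :=
  ⟨by simpa [unitaryHaar] using
    Measure.haarMeasure_self (K₀ := (⊤ : TopologicalSpace.PositiveCompacts (UnitaryGrp n)))⟩

/-- `Irr(G)`: the characters of the continuous irreducible finite-dimensional complex
representations of a topological group `G`. After a choice of basis, the representation space
is `ℂ^d`. -/
def Irr (G : Type*) [Group G] [TopologicalSpace G] : Set (G → ℂ) :=
  {χ | ∃ (d : ℕ) (π : Representation ℂ G (Fin d → ℂ)),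
    (∀ v : Fin d → ℂ, Continuous fun g => π g v) ∧ π.IsIrreducible ∧ π.character = χ}

/-- `w_G(g_1, …, g_r)`: the element of `G` obtained from the word `w` by substituting `g_i`
for the `i`-th free generator. -/
def wordMap {r : ℕ} (w : FreeGroup (Fin r)) {G : Type*} [Group G] (g : Fin r → G) : G :=
  FreeGroup.lift g w

/-- `E(f(w(G_1, …, G_r)))`, for independent Haar-distributed random elements `G_1, …, G_r`
of `U_n`, whose joint law is the product measure. -/
noncomputable def wordExpectation {r : ℕ} (w : FreeGroup (Fin r)) (n : ℕ)
    (f : UnitaryGrp n → ℂ) : ℂ :=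
  ∫ g : Fin r → UnitaryGrp n, f (wordMap w g) ∂(Measure.pi fun _ => unitaryHaar n)

/-! ### The unitary group: measure, torus, rotations -/

/-! Let `d` be the degree of the character. A representation of small degree is, up to a power of
the determinant, a piece of a mixed tensor power of low order at most `K`, where `d` is at least
`n.choose K`, hence at least `(n / 2K) ^ K`. The mean of the absolute value of its character at the
word turns out to be at most `√n ^ K` times a factor `N ^ O(K)` with `N` linear in `K`. Since `K` is
at most a small power of `n`, this is below `d ^ (3/4)`.

Weights. The weight set is stable under permutations and under root steps `ω - (e_i - e_j)` when `ω
j < ω i` (`weightProj_string`), and has at most `d` elements. Smallness forces each weight to be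
constant off few coordinates; spreading the deviation over many coordinates by root steps and
permuting yields `n.choose K` weights (`exists_const_near_weight`). Irreducibility makes the
constant common to all weights, and a determinant twist removes it. The twisted character is then a
polynomial of degree at most `K` in the entries and their conjugates (`exists_detTwist_mem_polyDeg`,
through `classFun_mem_polyDeg`).

Characters. Such a character is not orthogonal to all monomials of degree at most `K`, so the
representation maps to some mixed tensor power of order `k ≤ K` (`exists_intertwiner`), and its
character is the trace of the tensor power against a commuting projection `R`. Commuting with sign
matrices kills every entry of `R` whose two multi-indices contain a value taken only once. About `n
^ k` of the `n ^ (2k)` entries survive (`exists_entry_bound`), each contributing a product of `k`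
entries of the matrix.

Words. The `2k`-th absolute moment of an entry of a reduced word in Haar unitaries is about `n ^
(-k)` (`word_moment_le`): expand it over families of paths, discard by sign symmetry those with an
inner label used once, count the others, and bound each by moments of single entries. So each
product of `k` entries has mean about `n ^ (-k/2)`, and `n ^ k` of them give `√n ^ k`. -/

instance UnitaryGrp.secondCountableTopology (n : ℕ) : SecondCountableTopology (UnitaryGrp n) := by
  have : SecondCountableTopology (Matrix (Fin n) (Fin n) ℂ) :=
    inferInstanceAs (SecondCountableTopology (Fin n → Fin n → ℂ))
  exact TopologicalSpace.Subtype.secondCountableTopology _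

theorem continuous_unitary_entry {n : ℕ} (i j : Fin n) :
    Continuous fun u : UnitaryGrp n => u i j :=
  (continuous_subtype_val.matrix_elem i j)

theorem unitary_entry_norm_le {n : ℕ} (u : UnitaryGrp n) (i j : Fin n) : ‖u i j‖ ≤ 1 :=
  entry_norm_bound_of_unitary u.2 i j

theorem unitary_integrable {n : ℕ} {E : Type*} [NormedAddCommGroup E] {f : UnitaryGrp n → E}
    (hf : Continuous f) : Integrable f (unitaryHaar n) :=
  hf.integrable_of_hasCompactSupport (HasCompactSupport.of_compactSpace f)

/-- The diagonal torus. -/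
noncomputable def diagU (n : ℕ) : (Fin n → Circle) →* UnitaryGrp n where
  toFun t := ⟨Matrix.diagonal fun i => (t i : ℂ), by
    rw [Matrix.mem_unitaryGroup_iff, Matrix.star_eq_conjTranspose, Matrix.diagonal_conjTranspose,
      Matrix.diagonal_mul_diagonal, ← Matrix.diagonal_one]
    congr 1
    ext i
    simp [Complex.mul_conj]⟩
  map_one' := by
    apply Subtype.ext
    simp
  map_mul' s t := by
    apply Subtype.ext
    simp

theorem diagU_apply {n : ℕ} (t : Fin n → Circle) (i j : Fin n) :
    diagU n t i j = if i = j then (t i : ℂ) else 0 := by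
  change Matrix.diagonal (fun i => (t i : ℂ)) i j = _
  rw [Matrix.diagonal_apply]

theorem diagU_mul_apply {n : ℕ} (t : Fin n → Circle) (u : UnitaryGrp n) (i j : Fin n) :
    (diagU n t * u) i j = t i * u i j := by
  change (Matrix.diagonal (fun i => (t i : ℂ)) * u.1) i j = _
  rw [Matrix.diagonal_mul]

theorem mul_diagU_apply {n : ℕ} (t : Fin n → Circle) (u : UnitaryGrp n) (i j : Fin n) :
    (u * diagU n t) i j = u i j * t j := by
  change (u.1 * Matrix.diagonal (fun i => (t i : ℂ))) i j = _
  rw [Matrix.mul_diagonal]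

section Rotation

variable {n : ℕ} {i j : Fin n}

/-- The projection on the coordinate plane of `i` and `j`. -/
def planeProj (i j : Fin n) : Matrix (Fin n) (Fin n) ℂ :=
  Matrix.single i i 1 + Matrix.single j j 1

/-- The infinitesimal rotation in the coordinate plane of `i` and `j`. -/
def planeGen (i j : Fin n) : Matrix (Fin n) (Fin n) ℂ :=
  Matrix.single i j 1 - Matrix.single j i 1

theorem planeProj_mul_self (h : i ≠ j) : planeProj i j * planeProj i j = planeProj i j := by
  simp [planeProj, add_mul, mul_add, h, h.symm]

theorem planeProj_mul_gen (h : i ≠ j) : planeProj i j * planeGen i j = planeGen i j := by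
  rw [planeProj, planeGen, add_mul, mul_sub, mul_sub]
  simp [h, h.symm, sub_eq_add_neg]

theorem planeGen_mul_proj (h : i ≠ j) : planeGen i j * planeProj i j = planeGen i j := by
  rw [planeProj, planeGen, mul_add, sub_mul, sub_mul]
  simp [h, h.symm, sub_eq_add_neg, add_comm]

theorem planeGen_mul_self (h : i ≠ j) : planeGen i j * planeGen i j = -planeProj i j := by
  simp [planeProj, planeGen, sub_mul, mul_sub, h, h.symm]
  abel

/-- The matrix of the rotation by the angle `s` in the coordinate plane of `i` and `j`. -/
noncomputable def rotMatrix (i j : Fin n) (s : ℝ) : Matrix (Fin n) (Fin n) ℂ :=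
  1 + ((Real.cos s : ℂ) - 1) • planeProj i j + (Real.sin s : ℂ) • planeGen i j

theorem rotMatrix_add (h : i ≠ j) (s t : ℝ) :
    rotMatrix i j (s + t) = rotMatrix i j s * rotMatrix i j t := by
  simp only [rotMatrix, add_mul, mul_add, one_mul, mul_one, smul_mul_assoc, mul_smul_comm,
    planeProj_mul_self h, planeProj_mul_gen h, planeGen_mul_proj h, planeGen_mul_self h,
    Real.cos_add, Real.sin_add]
  push_cast
  module

theorem rotMatrix_zero : rotMatrix i j 0 = 1 := by simp [rotMatrix]

theorem star_rotMatrix (s : ℝ) : star (rotMatrix i j s) = rotMatrix i j (-s) := by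
  rw [Matrix.star_eq_conjTranspose]
  simp only [rotMatrix, planeProj, planeGen, Matrix.conjTranspose_add, Matrix.conjTranspose_sub,
    Matrix.conjTranspose_smul, Matrix.conjTranspose_one, Matrix.conjTranspose_single, star_one,
    star_sub, Real.cos_neg, Real.sin_neg, RCLike.star_def, Complex.conj_ofReal]
  push_cast
  module

/-- The rotation by the angle `s` in the coordinate plane of `i` and `j`. -/
noncomputable def rotU (h : i ≠ j) (s : ℝ) : UnitaryGrp n :=
  ⟨rotMatrix i j s, by
    rw [Matrix.mem_unitaryGroup_iff, star_rotMatrix, ← rotMatrix_add h, add_neg_cancel,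
      rotMatrix_zero]⟩

theorem rotU_add (h : i ≠ j) (s t : ℝ) : rotU h (s + t) = rotU h s * rotU h t :=
  Subtype.ext (rotMatrix_add h s t)

theorem rotU_zero (h : i ≠ j) : rotU h 0 = 1 := Subtype.ext rotMatrix_zero

theorem rotU_mul_apply_fst (h : i ≠ j) (s : ℝ) (u : UnitaryGrp n) (l : Fin n) :
    (rotU h s * u) i l = Real.cos s * u i l + Real.sin s * u j l := by
  change (rotMatrix i j s * u.1) i l = _
  simp [rotMatrix, planeProj, planeGen, add_mul, sub_mul, Matrix.single_mul_apply_of_ne, h]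

theorem rotU_mul_apply_snd (h : i ≠ j) (s : ℝ) (u : UnitaryGrp n) (l : Fin n) :
    (rotU h s * u) j l = -Real.sin s * u i l + Real.cos s * u j l := by
  change (rotMatrix i j s * u.1) j l = _
  simp [rotMatrix, planeProj, planeGen, add_mul, sub_mul, Matrix.single_mul_apply_of_ne, h.symm]
  ring

end Rotation

/-! ### Moments of the entries of a Haar unitary -/

section Moments

open ComplexConjugate

variable {n : ℕ}

/-- Multiplying row `j` by the imaginary unit preserves Haar measure and changes the sign of the
integrand, through the factor `conj (u j l) ^ 2`. -/
theorem moment_mixed_zero (k : ℕ) {i j : Fin n} (h : i ≠ j) (l : Fin n) :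
    ∫ u : UnitaryGrp n, (u i l) ^ (k + 1) * conj (u i l) ^ (k - 1) * conj (u j l) ^ 2
      ∂unitaryHaar n = 0 := by
  set t : Fin n → Circle := Pi.mulSingle j (Circle.exp (Real.pi / 2)) with ht
  have hj : ((t j : Circle) : ℂ) = Complex.I := by
    simp [ht, Circle.coe_exp]
  have hi : ((t i : Circle) : ℂ) = 1 := by simp [ht, Pi.mulSingle_eq_of_ne h]
  have := integral_mul_left_eq_self (μ := unitaryHaar n) (fun u : UnitaryGrp n =>
    (u i l) ^ (k + 1) * conj (u i l) ^ (k - 1) * conj (u j l) ^ 2) (diagU n t)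
  simp only [diagU_mul_apply, hi, hj, one_mul, map_mul, Complex.conj_I, mul_pow, neg_sq,
    Complex.I_sq, neg_mul, mul_neg, integral_neg] at this
  exact self_eq_neg.mp this.symm

/-- Infinitesimal rotation invariance. With `x`, `y` the entries of rows `i`, `j` in column `l`, the
integral of `x ^ (k + 1) * conj x ^ k * conj y` does not change when the two rows are rotated. Its
derivative at angle zero consists of the two moments to be compared and a multiple of
`moment_mixed_zero`. -/
theorem moment_mixed (k : ℕ) {i j : Fin n} (h : i ≠ j) (l : Fin n) :
    (k + 1) * ∫ u : UnitaryGrp n, ‖u i l‖ ^ (2 * k) * ‖u j l‖ ^ 2 ∂unitaryHaar n =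
      ∫ u : UnitaryGrp n, ‖u i l‖ ^ (2 * (k + 1)) ∂unitaryHaar n := by
  let x : ℝ → UnitaryGrp n → ℂ := fun s u => (rotU h s * u) i l
  let y : ℝ → UnitaryGrp n → ℂ := fun s u => (rotU h s * u) j l
  have hx : ∀ s u, HasDerivAt (fun s => x s u) (y s u) s := fun s u => by
    simp only [x, y, rotU_mul_apply_fst, rotU_mul_apply_snd]
    refine (((Real.hasDerivAt_cos s).ofReal_comp.mul_const (u i l)).fun_add
      ((Real.hasDerivAt_sin s).ofReal_comp.mul_const (u j l))).congr_deriv ?_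
    push_cast; rfl
  have hy : ∀ s u, HasDerivAt (fun s => y s u) (-x s u) s := fun s u => by
    simp only [x, y, rotU_mul_apply_fst, rotU_mul_apply_snd]
    refine (((Real.hasDerivAt_sin s).ofReal_comp.fun_neg.mul_const (u i l)).fun_add
      ((Real.hasDerivAt_cos s).ofReal_comp.mul_const (u j l))).congr_deriv ?_
    push_cast; ring
  have hconj : ∀ {f : ℝ → ℂ} {f' : ℂ} {s : ℝ}, HasDerivAt f f' s →
      HasDerivAt (fun s => conj (f s)) (conj f') s := fun hf => hf.star
  let F : ℝ → UnitaryGrp n → ℂ := fun s u => x s u ^ (k + 1) * conj (x s u) ^ k * conj (y s u)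
  let F' : ℝ → UnitaryGrp n → ℂ := fun s u =>
    (k + 1) * (x s u ^ k * conj (x s u) ^ k * (y s u * conj (y s u))) +
      k * (x s u ^ (k + 1) * conj (x s u) ^ (k - 1) * conj (y s u) ^ 2) -
      x s u ^ (k + 1) * conj (x s u) ^ (k + 1)
  have hF : ∀ s u, HasDerivAt (fun s => F s u) (F' s u) s := fun s u => by
    refine ((((hx s u).fun_pow (k + 1)).fun_mul ((hconj (hx s u)).fun_pow k)).fun_mul
      (hconj (hy s u))).congr_deriv ?_
    simp [F']
    ring
  have hxn : ∀ s u, ‖x s u‖ ≤ 1 := fun s u => unitary_entry_norm_le _ _ _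
  have hyn : ∀ s u, ‖y s u‖ ≤ 1 := fun s u => unitary_entry_norm_le _ _ _
  have hxc : ∀ s, Continuous (x s) := fun s =>
    (continuous_unitary_entry i l).comp (continuous_const.mul continuous_id)
  have hyc : ∀ s, Continuous (y s) := fun s =>
    (continuous_unitary_entry j l).comp (continuous_const.mul continuous_id)
  have hFc : ∀ s, Continuous (F s) := fun s => by
    have := hxc s; have := hyc s; simp only [F]; fun_prop
  have hF'c : Continuous (F' 0) := by
    have := hxc 0; have := hyc 0; simp only [F']; fun_prop
  have hbound : ∀ s u, ‖F' s u‖ ≤ (k + 1) + k + 1 := fun s u => by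
    have hp : ∀ (z : ℂ) (m : ℕ), ‖z‖ ≤ 1 → ‖z ^ m‖ ≤ 1 := fun z m hz => by
      rw [norm_pow]; exact pow_le_one₀ (norm_nonneg _) hz
    have hm : ∀ z w : ℂ, ‖z‖ ≤ 1 → ‖w‖ ≤ 1 → ‖z * w‖ ≤ 1 := fun z w hz hw => by
      rw [norm_mul]; exact mul_le_one₀ hz (norm_nonneg _) hw
    have hcx : ‖conj (x s u)‖ ≤ 1 := by rw [RCLike.norm_conj]; exact hxn s u
    have hcy : ‖conj (y s u)‖ ≤ 1 := by rw [RCLike.norm_conj]; exact hyn s u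
    refine (norm_sub_le _ _).trans (add_le_add ((norm_add_le _ _).trans (add_le_add ?_ ?_)) ?_)
    · rw [norm_mul]
      have : ‖((k : ℂ) + 1)‖ = k + 1 := by exact_mod_cast Complex.norm_natCast (k + 1)
      rw [this]
      exact mul_le_of_le_one_right (by positivity)
        (hm _ _ (hm _ _ (hp _ _ (hxn s u)) (hp _ _ hcx)) (hm _ _ (hyn s u) hcy))
    · rw [norm_mul, Complex.norm_natCast]
      exact mul_le_of_le_one_right (by positivity)
        (hm _ _ (hm _ _ (hp _ _ (hxn s u)) (hp _ _ hcx)) (hp _ _ hcy))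
    · exact hm _ _ (hp _ _ (hxn s u)) (hp _ _ hcx)
  have hder := (hasDerivAt_integral_of_dominated_loc_of_deriv_le (μ := unitaryHaar n)
    (F := F) (F' := F') (x₀ := 0) (bound := fun _ => (k + 1) + k + 1) (s := Set.univ)
    Filter.univ_mem (Filter.Eventually.of_forall fun s => (hFc s).aestronglyMeasurable)
    (unitary_integrable (hFc 0)) hF'c.aestronglyMeasurable
    (Filter.Eventually.of_forall fun u s _ => hbound s u) (integrable_const _)
    (Filter.Eventually.of_forall fun u s _ => hF s u)).2
  have hconst : (fun s => ∫ u, F s u ∂unitaryHaar n) = fun _ => ∫ u, F 0 u ∂unitaryHaar n := by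
    have key : ∀ s, ∫ u, F s u ∂unitaryHaar n =
        ∫ u : UnitaryGrp n, u i l ^ (k + 1) * conj (u i l) ^ k * conj (u j l) ∂unitaryHaar n :=
      fun s => integral_mul_left_eq_self (μ := unitaryHaar n) (fun u : UnitaryGrp n =>
        u i l ^ (k + 1) * conj (u i l) ^ k * conj (u j l)) (rotU h s)
    funext s
    rw [key, key]
  rw [hconst] at hder
  have h0 : ∫ u, F' 0 u ∂unitaryHaar n = 0 := hder.unique (hasDerivAt_const _ _)
  have hx0 : ∀ u, x 0 u = u i l := fun u => by simp [x, rotU_zero]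
  have hy0 : ∀ u, y 0 u = u j l := fun u => by simp [y, rotU_zero]
  have := hxc 0
  have := hyc 0
  simp only [F'] at h0
  rw [integral_sub (unitary_integrable (by fun_prop)) (unitary_integrable (by fun_prop)),
    integral_add (unitary_integrable (by fun_prop)) (unitary_integrable (by fun_prop)),
    integral_const_mul, integral_const_mul] at h0
  simp only [hx0, hy0] at h0
  rw [moment_mixed_zero k h l, mul_zero, add_zero] at h0
  have e1 : ∀ (z : ℂ) (m : ℕ), z ^ m * conj z ^ m = ((‖z‖ ^ (2 * m) : ℝ) : ℂ) := fun z m => by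
    rw [← mul_pow, Complex.mul_conj, Complex.normSq_eq_norm_sq, ← Complex.ofReal_pow, ← pow_mul]
  have e2 : ∀ z : ℂ, z * conj z = ((‖z‖ ^ 2 : ℝ) : ℂ) := fun z => by simpa using e1 z 1
  simp only [e1, e2, ← Complex.ofReal_mul] at h0
  rw [integral_complex_ofReal, integral_complex_ofReal] at h0
  exact_mod_cast sub_eq_zero.mp h0

theorem sum_norm_sq_col (u : UnitaryGrp n) (l : Fin n) : ∑ i, ‖u i l‖ ^ 2 = 1 := by
  have h := congrFun (congrFun (Matrix.UnitaryGroup.star_mul_self u) l) l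
  rw [Matrix.mul_apply, Matrix.one_apply_eq] at h
  have : ((∑ i, ‖u i l‖ ^ 2 : ℝ) : ℂ) = 1 := by
    rw [← h]
    push_cast
    refine Finset.sum_congr rfl fun i _ => ?_
    rw [Matrix.star_apply, RCLike.star_def, mul_comm, Complex.mul_conj, Complex.normSq_eq_norm_sq]
    push_cast
    rfl
  exact_mod_cast this

/-- The even absolute moments of the entries of a Haar unitary. -/
theorem moment_entry_le (D : ℕ) (i l : Fin n) :
    ∫ u : UnitaryGrp n, ‖u i l‖ ^ (2 * D) ∂unitaryHaar n ≤ D.factorial / (n : ℝ) ^ D := by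
  have hn : (0 : ℝ) < n := by exact_mod_cast i.pos
  induction D with
  | zero => simp
  | succ k ih =>
    set A := ∫ u : UnitaryGrp n, ‖u i l‖ ^ (2 * (k + 1)) ∂unitaryHaar n with hA
    have hc : ∀ i, Continuous fun u : UnitaryGrp n => u i l := fun i => continuous_unitary_entry i l
    -- The columns are unit vectors, so the previous moment splits into `n` mixed moments, each at
    -- least `A / (k + 1)`; this yields the recursion `A ≤ (k + 1) / n` times the previous moment.
    have hsum : ∫ u : UnitaryGrp n, ‖u i l‖ ^ (2 * k) ∂unitaryHaar n =
        ∑ j, ∫ u : UnitaryGrp n, ‖u i l‖ ^ (2 * k) * ‖u j l‖ ^ 2 ∂unitaryHaar n := by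
      rw [← integral_finsetSum _ fun j _ => unitary_integrable
        (f := fun u => ‖u i l‖ ^ (2 * k) * ‖u j l‖ ^ 2)
        (((hc i).norm.pow _).mul ((hc j).norm.pow _))]
      refine integral_congr_ae (Filter.Eventually.of_forall fun u => ?_)
      simp only [← Finset.mul_sum, sum_norm_sq_col, mul_one]
    have hA0 : 0 ≤ A := integral_nonneg fun u => by positivity
    have hterm : ∀ j, A / (k + 1) ≤
        ∫ u : UnitaryGrp n, ‖u i l‖ ^ (2 * k) * ‖u j l‖ ^ 2 ∂unitaryHaar n := fun j => by
      by_cases hij : i = j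
      · subst hij
        rw [div_le_iff₀ (by positivity)]
        have : ∀ u : UnitaryGrp n, ‖u i l‖ ^ (2 * k) * ‖u i l‖ ^ 2 = ‖u i l‖ ^ (2 * (k + 1)) :=
          fun u => by ring
        simp only [this, ← hA]
        nlinarith [(Nat.cast_nonneg k : (0 : ℝ) ≤ k)]
      · rw [div_le_iff₀ (by positivity), mul_comm, moment_mixed k hij l]
    have h1 : n * (A / (k + 1)) ≤ k.factorial / (n : ℝ) ^ k := by
      refine le_trans ?_ ih
      rw [hsum]
      calc (n : ℝ) * (A / (k + 1)) = ∑ _j : Fin n, A / (k + 1) := by simp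
        _ ≤ _ := Finset.sum_le_sum fun j _ => hterm j
    rw [Nat.factorial_succ, pow_succ]
    push_cast
    have h2 : (n : ℝ) * (A / (k + 1)) * ((k + 1) / n) = A := by field_simp
    calc A = (n : ℝ) * (A / (k + 1)) * ((k + 1) / n) := h2.symm
      _ ≤ (k.factorial / (n : ℝ) ^ k) * ((k + 1) / n) := by gcongr
      _ = _ := by field_simp

end Moments

/-! ### Counting labellings without lonely labels -/

/-- At most `2 * m` places carry a label other than `a`, `b`, and each such label is used at least
twice, so at most `m` of them occur. A labelling is thus encoded by a list of `m` labels and, at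
each place, a choice among `m + 2` symbols. -/
theorem card_labelling_le {β : Type*} [Fintype β] [DecidableEq β] {n : ℕ} (a b : Fin n) (m : ℕ)
    (S : Finset (β → Fin n))
    (hcard : ∀ f ∈ S, (Finset.univ.filter fun p => f p ≠ a ∧ f p ≠ b).card ≤ 2 * m)
    (hshare : ∀ f ∈ S, ∀ p, f p ≠ a → f p ≠ b → ∃ q, q ≠ p ∧ f q = f p) :
    S.card ≤ n ^ m * (m + 2) ^ Fintype.card β := by
  classical
  let Ψ : (Fin m → Fin n) × (β → Fin m ⊕ Bool) → β → Fin n := fun hc p =>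
    Sum.elim hc.1 (fun e => if e then a else b) (hc.2 p)
  have hsub : S ⊆ Finset.univ.image Ψ := by
    intro f hf
    set T : Finset (Fin n) := (Finset.univ.image f).filter fun v => v ≠ a ∧ v ≠ b with hT
    have hT2 : T.card * 2 ≤ 2 * m := by
      refine le_trans ?_ (hcard f hf)
      rw [Finset.card_eq_sum_card_fiberwise (f := f) (t := T)]
      · rw [← smul_eq_mul]
        refine Finset.card_nsmul_le_sum _ _ _ fun v hv => ?_
        obtain ⟨hv1, hva, hvb⟩ := Finset.mem_filter.mp hv
        obtain ⟨p, -, rfl⟩ := Finset.mem_image.mp hv1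
        obtain ⟨q, hqp, hq⟩ := hshare f hf p hva hvb
        refine le_trans (Finset.card_pair hqp).ge (Finset.card_le_card ?_)
        intro x hx
        rcases Finset.mem_insert.mp hx with rfl | hx
        · simp [hq, hva, hvb]
        · rw [Finset.mem_singleton.mp hx]; simp [hva, hvb]
      · intro p hp
        have hp' := (Finset.mem_filter.mp (Finset.mem_coe.mp hp)).2
        exact Finset.mem_coe.mpr (Finset.mem_filter.mpr
          ⟨Finset.mem_image_of_mem _ (Finset.mem_univ _), hp'⟩)
    have hTm : T.card ≤ m := by omega
    have hmem : ∀ p, f p ≠ a → f p ≠ b → f p ∈ T := fun p h1 h2 =>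
      Finset.mem_filter.mpr ⟨Finset.mem_image_of_mem _ (Finset.mem_univ _), h1, h2⟩
    refine Finset.mem_image.mpr ⟨(fun x => if hx : x.1 < T.card then T.equivFin.symm ⟨x, hx⟩ else a,
      fun p => if h1 : f p = a then Sum.inr true else if h2 : f p = b then Sum.inr false else
        Sum.inl ⟨T.equivFin ⟨f p, hmem p h1 h2⟩, (Fin.is_lt _).trans_le hTm⟩),
      Finset.mem_univ _, ?_⟩
    funext p
    by_cases h1 : f p = a
    · simp [Ψ, h1]
    · by_cases h2 : f p = b
      · have hba : b ≠ a := fun h => h1 (h2.trans h)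
        simp [Ψ, h2, hba]
      · simp [Ψ, h1, h2]
  refine (Finset.card_le_card hsub).trans (Finset.card_image_le.trans ?_)
  simp

/-- The inequality of arithmetic and geometric means. It reduces the mean of a product of dependent
entries to high moments of single entries. -/
theorem prod_le_avg_pow {ι : Type*} (s : Finset ι) (hs : s.Nonempty) (x : ι → ℝ)
    (hx : ∀ i ∈ s, 0 ≤ x i) : ∏ i ∈ s, x i ≤ (∑ i ∈ s, x i ^ s.card) / s.card := by
  have hc : (s.card : ℝ) ≠ 0 := by exact_mod_cast hs.card_pos.ne'
  have h := Real.geom_mean_le_arith_mean_weighted s (fun _ => (s.card : ℝ)⁻¹)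
    (fun i => x i ^ s.card) (fun _ _ => by positivity)
    (by rw [Finset.sum_const, nsmul_eq_mul, mul_inv_cancel₀ hc])
    (fun i hi => pow_nonneg (hx i hi) _)
  rw [← Finset.mul_sum, inv_mul_eq_div] at h
  refine le_trans (le_of_eq (Finset.prod_congr rfl fun i hi => ?_)) h
  rw [Real.pow_rpow_inv_natCast (hx i hi) hs.card_pos.ne']

/-! ### Moments of the entries of a word in Haar unitaries -/

theorem unitary_prod_apply {n : ℕ} {L : ℕ} (A : Fin L → UnitaryGrp n) (a b : Fin n) :
    (List.ofFn A).prod a b = ∑ f : Fin (L + 1) → Fin n,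
      if f 0 = a ∧ f (Fin.last L) = b then ∏ k, A k (f k.castSucc) (f k.succ) else 0 := by
  induction L generalizing a with
  | zero =>
    rw [← (Equiv.funUnique (Fin 1) (Fin n)).symm.sum_comp]
    simp [Matrix.one_apply, Finset.filter_and]
    by_cases h : a = b
    · simp [h, Finset.filter_eq']
    · simp [h, Finset.filter_eq']
  | succ L ih =>
    rw [List.ofFn_succ, List.prod_cons]
    change ((A 0).1 * ((List.ofFn fun i => A i.succ).prod).1) a b = _
    rw [Matrix.mul_apply]
    symm
    rw [← (Fin.consEquiv fun _ => Fin n).sum_comp, Fintype.sum_prod_type, Finset.sum_eq_single a]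
    · simp only [Fin.consEquiv_apply, Fin.cons_zero, true_and]
      simp_rw [ih, Finset.mul_sum]
      rw [Finset.sum_comm]
      refine Finset.sum_congr rfl fun f _ => ?_
      symm
      rw [Finset.sum_eq_single (f 0)]
      · rw [← Fin.succ_last, Fin.cons_succ]
        simp [Fin.prod_univ_succ]
      · intro c _ hc
        simp [hc.symm]
      · simp
    · intro x _ hx
      simp [hx]
    · simp

section WordMoments

variable {r n : ℕ}

/-- The value of a letter. -/
def letterVal {G : Type*} [Group G] (g : Fin r → G) (l : Fin r × Bool) : G :=
  bif l.2 then g l.1 else (g l.1)⁻¹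

/-- The joint law of independent Haar unitaries. -/
noncomputable abbrev haarPi (r n : ℕ) : Measure (Fin r → UnitaryGrp n) :=
  Measure.pi fun _ => unitaryHaar n

theorem haarPi_integrable {E : Type*} [NormedAddCommGroup E] {f : (Fin r → UnitaryGrp n) → E}
    (hf : Continuous f) : Integrable f (haarPi r n) :=
  hf.integrable_of_hasCompactSupport (HasCompactSupport.of_compactSpace f)

/-- A right translate of the measure is again a left-invariant probability measure, so uniqueness of
Haar measure applies. -/
instance haarPi.isMulRightInvariant : (haarPi r n).IsMulRightInvariant := by
  refine ⟨fun g => ?_⟩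
  have : IsProbabilityMeasure (Measure.map (· * g) (haarPi r n)) :=
    Measure.isProbabilityMeasure_map (by fun_prop)
  have : (haarPi r n).IsHaarMeasure := { }
  exact Measure.isHaarMeasure_eq_of_isProbabilityMeasure _ _

theorem continuous_letterVal (l : Fin r × Bool) :
    Continuous fun g : Fin r → UnitaryGrp n => letterVal g l := by
  unfold letterVal
  cases l.2
  · exact (continuous_apply l.1).inv
  · exact continuous_apply l.1

theorem unitary_inv_apply (u : UnitaryGrp n) (i j : Fin n) : (u⁻¹) i j = star (u j i) := by
  rw [Matrix.UnitaryGroup.inv_apply]; rfl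

theorem letterVal_moment_le (D : ℕ) (l : Fin r × Bool) (i j : Fin n) :
    ∫ g, ‖letterVal g l i j‖ ^ (2 * D) ∂haarPi r n ≤ D.factorial / (n : ℝ) ^ D := by
  have key : ∀ i j : Fin n, ∫ g, ‖g l.1 i j‖ ^ (2 * D) ∂haarPi r n ≤
      D.factorial / (n : ℝ) ^ D := fun i j => by
    refine le_trans (le_of_eq ?_) (moment_entry_le D i j)
    have hm := measurePreserving_eval (fun _ : Fin r => unitaryHaar n) l.1
    rw [← hm.map_eq, integral_map hm.aemeasurable]
    · exact (((continuous_unitary_entry i j).norm.pow _)).aestronglyMeasurable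
  obtain ⟨x, e⟩ := l
  cases e
  · simp only [letterVal, cond_false, unitary_inv_apply, norm_star]
    exact key j i
  · exact key i j

/-- The sign matrix which is `-1` at the place `v`. -/
noncomputable def signU (v : Fin n) : UnitaryGrp n := diagU n (Pi.mulSingle v (-1))

theorem mulSingle_neg_one_coe (v w : Fin n) :
    (((Pi.mulSingle v (-1) : Fin n → Circle) w : Circle) : ℂ) = if w = v then -1 else 1 := by
  by_cases h : w = v
  · subst h; simp
  · simp [h]

theorem signU_mul_apply (v : Fin n) (u : UnitaryGrp n) (i j : Fin n) :
    (signU v * u) i j = (if i = v then -1 else 1) * u i j := by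
  rw [signU, diagU_mul_apply, mulSingle_neg_one_coe]

theorem mul_signU_apply (v : Fin n) (u : UnitaryGrp n) (i j : Fin n) :
    (u * signU v) i j = (if j = v then -1 else 1) * u i j := by
  rw [signU, mul_diagU_apply, mulSingle_neg_one_coe, mul_comm]

theorem signU_inv (v : Fin n) : (signU v)⁻¹ = signU v := by
  rw [signU, ← map_inv, ← Pi.mulSingle_inv]
  congr 2
  apply Subtype.ext
  simp

/-- The conjugation applied to the copies in the right summand. -/
noncomputable def copyConj {K : ℕ} : Fin K ⊕ Fin K → ℂ →+* ℂ :=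
  Sum.elim (fun _ => RingHom.id ℂ) fun _ => starRingEnd ℂ

theorem norm_copyConj {K : ℕ} (c : Fin K ⊕ Fin K) (z : ℂ) : ‖copyConj c z‖ = ‖z‖ := by
  cases c <;> simp [copyConj]

theorem copyConj_sign {K : ℕ} (c : Fin K ⊕ Fin K) (p : Prop) [Decidable p] :
    copyConj c (if p then -1 else 1) = if p then -1 else 1 := by
  split_ifs <;> simp

theorem continuous_copyConj {K : ℕ} (c : Fin K ⊕ Fin K) : Continuous (copyConj c) := by
  cases c
  · exact continuous_id
  · exact Complex.continuous_conj

/-- The contribution of a family of paths. -/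
noncomputable def pathTerm {L K : ℕ} (l : Fin L → Fin r × Bool)
    (F : Fin K ⊕ Fin K → Fin (L + 1) → Fin n) (g : Fin r → UnitaryGrp n) : ℂ :=
  ∏ x : (Fin K ⊕ Fin K) × Fin L,
    copyConj x.1 (letterVal g (l x.2) (F x.1 x.2.castSucc) (F x.1 x.2.succ))

theorem continuous_pathTerm {L K : ℕ} (l : Fin L → Fin r × Bool)
    (F : Fin K ⊕ Fin K → Fin (L + 1) → Fin n) : Continuous (pathTerm l F) :=
  continuous_finsetProd _ fun x _ => (continuous_copyConj x.1).comp
    ((continuous_unitary_entry _ _).comp (continuous_letterVal _))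

/-- A family of paths with a label that occurs only once, at an inner place, does not contribute. -/
theorem integral_pathTerm_eq_zero {L K : ℕ} (l : Fin (L + 1) → Fin r × Bool)
    (hl : ∀ k : Fin L, (l k.castSucc).1 = (l k.succ).1 → (l k.castSucc).2 = (l k.succ).2)
    (F : Fin K ⊕ Fin K → Fin (L + 2) → Fin n) (c : Fin K ⊕ Fin K) (k : Fin L)
    (hF : ∀ c' p', F c' p' = F c k.castSucc.succ → c' = c ∧ p' = k.castSucc.succ) :
    ∫ g, pathTerm l F g ∂haarPi r n = 0 := by
  classical
  set v := F c k.castSucc.succ with hv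
  set x := (l k.castSucc).1 with hx
  -- The label `v` is a column index only in the factor `(c, k.castSucc)`, and can be a row index
  -- only at the next letter `k.succ`.
  have hsucc : ∀ (c' : Fin K ⊕ Fin K) (k' : Fin (L + 1)),
      F c' k'.succ = v ↔ (c', k') = (c, k.castSucc) := fun c' k' => by
    constructor
    · intro h
      obtain ⟨rfl, h2⟩ := hF c' _ h
      rw [Fin.succ_inj.mp h2]
    · rintro ⟨rfl, rfl⟩; rfl
  have hcast : ∀ (c' : Fin K ⊕ Fin K) (k' : Fin (L + 1)),
      F c' k'.castSucc = v → k' = k.succ := fun c' k' h => by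
    have h2 := (hF c' _ h).2
    rw [Fin.succ_castSucc] at h2
    exact Fin.castSucc_injective _ h2
  let s : Fin r → UnitaryGrp n := Pi.mulSingle x (signU v)
  have hsx : s x = signU v := Pi.mulSingle_eq_same _ _
  have hsne : ∀ y, y ≠ x → s y = 1 := fun y hy => Pi.mulSingle_eq_of_ne hy _
  have hfin : ∀ T : (Fin r → UnitaryGrp n) → (Fin r → UnitaryGrp n),
      (∀ g c' k', letterVal (T g) (l k') (F c' k'.castSucc) (F c' k'.succ) =
        (if (c', k') = (c, k.castSucc) then -1 else 1) *
          letterVal g (l k') (F c' k'.castSucc) (F c' k'.succ)) →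
      ∀ g, pathTerm l F (T g) = -pathTerm l F g := fun T hT g => by
    unfold pathTerm
    simp only [hT, map_mul, copyConj_sign]
    rw [Finset.prod_mul_distrib, Finset.prod_ite_eq' Finset.univ (c, k.castSucc)]
    simp
  by_cases he : (l k.castSucc).2 = true
  -- Right translation of the generator `x` by `signU v` negates column `v` of `x` and row `v` of
  -- its inverse. The first affects exactly one factor. The second could only affect the letter
  -- `k.succ`, which by reducedness is not the inverse of `x`. If the letter at `k.castSucc` is an
  -- inverse, left translation plays the same role.
  · have h1 := hfin (fun g => g * s) fun g c' k' => by
      by_cases hy : (l k').1 = x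
      · cases hb : (l k').2
        · have hk : F c' k'.castSucc ≠ v := fun h => by
            obtain rfl := hcast _ _ h
            have := hl k hy.symm
            rw [he, hb] at this
            exact absurd this (by simp)
          have hk2 : ¬ (c', k') = (c, k.castSucc) := fun h => by
            rw [show k' = k.castSucc from (Prod.ext_iff.mp h).2] at hb
            simp [hb] at he
          simp only [letterVal, hb, cond_false, Pi.mul_apply, hy, hsx, mul_inv_rev, signU_inv,
            signU_mul_apply, hk, hk2, if_false]
        · simp only [letterVal, hb, cond_true, Pi.mul_apply, hy, hsx, mul_signU_apply, hsucc]
      · have hk2 : ¬ (c', k') = (c, k.castSucc) := fun h =>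
          hy (by rw [show k' = k.castSucc from (Prod.ext_iff.mp h).2])
        simp only [letterVal, Pi.mul_apply, hsne _ hy, mul_one, hk2, if_false, one_mul]
    have h2 := integral_mul_right_eq_self (μ := haarPi r n) (pathTerm l F) s
    simp only [h1, integral_neg] at h2
    exact self_eq_neg.mp h2.symm
  · have he' : (l k.castSucc).2 = false := by simpa using he
    have h1 := hfin (fun g => s * g) fun g c' k' => by
      by_cases hy : (l k').1 = x
      · cases hb : (l k').2
        · simp only [letterVal, hb, cond_false, Pi.mul_apply, hy, hsx, mul_inv_rev, signU_inv,
            mul_signU_apply, hsucc]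
        · have hk : F c' k'.castSucc ≠ v := fun h => by
            obtain rfl := hcast _ _ h
            have := hl k hy.symm
            rw [he', hb] at this
            exact absurd this (by simp)
          have hk2 : ¬ (c', k') = (c, k.castSucc) := fun h => by
            rw [show k' = k.castSucc from (Prod.ext_iff.mp h).2] at hb
            simp [hb] at he
          simp only [letterVal, hb, cond_true, Pi.mul_apply, hy, hsx, signU_mul_apply, hk, hk2,
            if_false]
      · have hk2 : ¬ (c', k') = (c, k.castSucc) := fun h =>
          hy (by rw [show k' = k.castSucc from (Prod.ext_iff.mp h).2])
        simp only [letterVal, Pi.mul_apply, hsne _ hy, one_mul, hk2, if_false]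
    have h2 := integral_mul_left_eq_self (μ := haarPi r n) (pathTerm l F) s
    simp only [h1, integral_neg] at h2
    exact self_eq_neg.mp h2.symm

theorem norm_integral_pathTerm_le {L K : ℕ} (hK : 0 < K) (l : Fin (L + 1) → Fin r × Bool)
    (F : Fin K ⊕ Fin K → Fin (L + 2) → Fin n) :
    ‖∫ g, pathTerm l F g ∂haarPi r n‖ ≤ (K * (L + 1)).factorial / (n : ℝ) ^ (K * (L + 1)) := by
  have : Nonempty (Fin K ⊕ Fin K) := ⟨Sum.inl ⟨0, hK⟩⟩
  set M := (Finset.univ : Finset ((Fin K ⊕ Fin K) × Fin (L + 1))).card with hM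
  have hM2 : M = 2 * (K * (L + 1)) := by
    simp [hM, Fintype.card_sum]; ring
  have hM0 : (0 : ℝ) < M := by rw [hM2]; positivity
  have hc : ∀ x : (Fin K ⊕ Fin K) × Fin (L + 1), Continuous fun g : Fin r → UnitaryGrp n =>
      ‖letterVal g (l x.2) (F x.1 x.2.castSucc) (F x.1 x.2.succ)‖ ^ M := fun x =>
    ((continuous_unitary_entry _ _).comp (continuous_letterVal _)).norm.pow _
  calc ‖∫ g, pathTerm l F g ∂haarPi r n‖ ≤ ∫ g, ‖pathTerm l F g‖ ∂haarPi r n :=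
        norm_integral_le_integral_norm _
    _ ≤ ∫ g, (∑ x : (Fin K ⊕ Fin K) × Fin (L + 1),
          ‖letterVal g (l x.2) (F x.1 x.2.castSucc) (F x.1 x.2.succ)‖ ^ M) / M ∂haarPi r n := by
        refine integral_mono (haarPi_integrable (continuous_pathTerm l F).norm)
          (haarPi_integrable ((continuous_finsetSum _ fun x _ => hc x).div_const _)) fun g => ?_
        simp only [pathTerm, norm_prod, norm_copyConj]
        exact prod_le_avg_pow _ Finset.univ_nonempty _ fun _ _ => norm_nonneg _
    _ = (∑ x : (Fin K ⊕ Fin K) × Fin (L + 1), ∫ g,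
          ‖letterVal g (l x.2) (F x.1 x.2.castSucc) (F x.1 x.2.succ)‖ ^ M ∂haarPi r n) / M := by
        rw [integral_div, integral_finsetSum _ fun x _ => haarPi_integrable (hc x)]
    _ ≤ (∑ _x : (Fin K ⊕ Fin K) × Fin (L + 1),
          ((K * (L + 1)).factorial / (n : ℝ) ^ (K * (L + 1)))) / M := by
        gcongr with x
        rw [hM2]
        exact letterVal_moment_le _ _ _ _
    _ = _ := by
        rw [Finset.sum_const, ← hM, nsmul_eq_mul, mul_div_assoc, mul_div_cancel₀ _ hM0.ne']

/-- The moment is a sum over `2 * K` paths from `a` to `b`, half of them conjugated. Their `2 * K *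
L` inner places carry at most `K * L` distinct labels other than `a`, `b` in a contributing family,
which explains the first two factors; the last one bounds a single family. The net power of `n` is
`-K`. -/
theorem word_moment_le {L K : ℕ} (hK : 0 < K) (l : Fin (L + 1) → Fin r × Bool)
    (hl : ∀ k : Fin L, (l k.castSucc).1 = (l k.succ).1 → (l k.castSucc).2 = (l k.succ).2)
    (a b : Fin n) :
    ∫ g, ‖(List.ofFn fun k => letterVal g (l k)).prod a b‖ ^ (2 * K) ∂haarPi r n ≤
      (n : ℝ) ^ (K * L) * ((K * L + 2 : ℕ) : ℝ) ^ (2 * K * (L + 2)) *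
        ((K * (L + 1)).factorial / (n : ℝ) ^ (K * (L + 1))) := by
  classical
  let E : Finset (Fin K ⊕ Fin K → Fin (L + 2) → Fin n) :=
    Finset.univ.filter fun F => ∀ c, F c 0 = a ∧ F c (Fin.last (L + 1)) = b
  have hexp : ∀ g : Fin r → UnitaryGrp n,
      ((‖(List.ofFn fun k => letterVal g (l k)).prod a b‖ ^ (2 * K) : ℝ) : ℂ) =
        ∑ F ∈ E, pathTerm l F g := fun g => by
    set z : ℂ := (List.ofFn fun k => letterVal g (l k)).prod a b with hz
    have h1 : ((‖z‖ ^ (2 * K) : ℝ) : ℂ) = ∏ c : Fin K ⊕ Fin K, copyConj c z := by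
      rw [Fintype.prod_sum_type]
      simp only [copyConj, Sum.elim_inl, Sum.elim_inr, Finset.prod_const, Finset.card_univ,
        Fintype.card_fin, RingHom.id_apply]
      rw [← mul_pow, Complex.mul_conj, Complex.normSq_eq_norm_sq, ← Complex.ofReal_pow, ← pow_mul]
    rw [h1, hz, unitary_prod_apply]
    simp only [map_sum]
    rw [Finset.prod_univ_sum, Finset.sum_filter, Fintype.piFinset_univ]
    refine Finset.sum_congr rfl fun F _ => ?_
    split_ifs with hF
    · simp only [pathTerm, Fintype.prod_prod_type, hF, and_self, if_true, map_prod]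
    · push Not at hF
      obtain ⟨c, hc⟩ := hF
      refine Finset.prod_eq_zero (Finset.mem_univ c) ?_
      rw [if_neg (fun h => hc h.1 h.2), map_zero]
  let S : Finset ((Fin K ⊕ Fin K) × Fin (L + 2) → Fin n) :=
    Finset.univ.filter fun f => (∀ c, f (c, 0) = a ∧ f (c, Fin.last (L + 1)) = b) ∧
      ∀ p, f p ≠ a → f p ≠ b → ∃ q, q ≠ p ∧ f q = f p
  have hS : S.card ≤ n ^ (K * L) * (K * L + 2) ^ (2 * K * (L + 2)) := by
    have := card_labelling_le a b (K * L) S ?_ fun f hf => (Finset.mem_filter.mp hf).2.2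
    · convert this using 2
      simp [Fintype.card_sum]; ring
    · intro f hf
      have hf' := (Finset.mem_filter.mp hf).2.1
      calc _ ≤ (Finset.univ.image fun x : (Fin K ⊕ Fin K) × Fin L =>
              (x.1, x.2.succ.castSucc)).card := by
            refine Finset.card_le_card fun p hp => ?_
            obtain ⟨c, p⟩ := p
            have hp' := (Finset.mem_filter.mp hp).2
            have h0 : p ≠ 0 := by rintro rfl; exact hp'.1 (hf' c).1
            have h1 : p ≠ Fin.last _ := by rintro rfl; exact hp'.2 (hf' c).2
            obtain ⟨q, rfl⟩ := Fin.exists_castSucc_eq.mpr h1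
            have hq : q ≠ 0 := by rintro rfl; simp at h0
            obtain ⟨q', rfl⟩ := Fin.exists_succ_eq.mpr hq
            exact Finset.mem_image.mpr ⟨(c, q'), Finset.mem_univ _, rfl⟩
        _ ≤ _ := Finset.card_image_le
        _ = 2 * (K * L) := by simp [Fintype.card_sum]; ring
  have hzero : ∀ F ∈ E, (Function.uncurry F) ∉ S → ∫ g, pathTerm l F g ∂haarPi r n = 0 := by
    intro F hF hFS
    have hE := (Finset.mem_filter.mp hF).2
    simp only [S, Finset.mem_filter, Finset.mem_univ, true_and, not_and] at hFS
    have h2 := hFS hE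
    push Not at h2
    obtain ⟨⟨c, p⟩, hpa, hpb, hq⟩ := h2
    have h0 : p ≠ 0 := by rintro rfl; exact hpa (hE c).1
    have h1 : p ≠ Fin.last _ := by rintro rfl; exact hpb (hE c).2
    obtain ⟨q, rfl⟩ := Fin.exists_castSucc_eq.mpr h1
    have hq0 : q ≠ 0 := by rintro rfl; simp at h0
    obtain ⟨k, rfl⟩ := Fin.exists_succ_eq.mpr hq0
    refine integral_pathTerm_eq_zero l hl F c k fun c' p' h => ?_
    by_contra hne
    refine hq (c', p') (fun h' => hne ?_) ?_
    · simpa using h'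
    · simpa using h
  have hint : ((∫ g, ‖(List.ofFn fun k => letterVal g (l k)).prod a b‖ ^ (2 * K)
      ∂haarPi r n : ℝ) : ℂ) = ∑ F ∈ E, ∫ g, pathTerm l F g ∂haarPi r n := by
    rw [← integral_complex_ofReal, ← integral_finsetSum _ fun F _ =>
      haarPi_integrable (continuous_pathTerm l F)]
    exact integral_congr_ae (Filter.Eventually.of_forall hexp)
  set B : ℝ := (K * (L + 1)).factorial / (n : ℝ) ^ (K * (L + 1)) with hB
  have hB0 : 0 ≤ B := by positivity
  have hcount : (E.filter fun F => Function.uncurry F ∈ S).card ≤ S.card :=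
    Finset.card_le_card_of_injOn Function.uncurry (fun F hF => (Finset.mem_filter.mp hF).2)
      fun F _ G _ h => by
        funext c p
        exact congrFun h (c, p)
  have hnn : 0 ≤ ∫ g, ‖(List.ofFn fun k => letterVal g (l k)).prod a b‖ ^ (2 * K) ∂haarPi r n :=
    integral_nonneg fun g => by positivity
  calc _ = ‖∑ F ∈ E, ∫ g, pathTerm l F g ∂haarPi r n‖ := by
        rw [← hint, Complex.norm_real, Real.norm_of_nonneg hnn]
    _ = ‖∑ F ∈ E.filter (fun F => Function.uncurry F ∈ S), ∫ g, pathTerm l F g ∂haarPi r n‖ := by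
        congr 1
        refine (Finset.sum_filter_of_ne fun F hF hne => ?_).symm
        by_contra h
        exact hne (hzero F hF h)
    _ ≤ ∑ F ∈ E.filter (fun F => Function.uncurry F ∈ S), B :=
        norm_sum_le_of_le _ fun F _ => norm_integral_pathTerm_le hK l F
    _ = (E.filter fun F => Function.uncurry F ∈ S).card * B := by simp
    _ ≤ ((n ^ (K * L) * (K * L + 2) ^ (2 * K * (L + 2)) : ℕ) : ℝ) * B := by
        gcongr
        exact hcount.trans hS
    _ = _ := by push_cast; ring

end WordMoments

/-! ### Polynomial functions on the unitary group -/

section Poly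

variable {n : ℕ}

/-- An entry of a unitary matrix, or its conjugate. -/
noncomputable def entryOrConj (e : Bool × Fin n × Fin n) (u : UnitaryGrp n) : ℂ :=
  if e.1 then u e.2.1 e.2.2 else star (u e.2.1 e.2.2)

/-- A monomial in the entries of a unitary matrix and their conjugates. -/
noncomputable def unitaryMonomial (l : List (Bool × Fin n × Fin n)) (u : UnitaryGrp n) : ℂ :=
  (l.map fun e => entryOrConj e u).prod

variable (n) in
/-- The polynomial functions of degree at most `a`. -/
noncomputable def polyDeg (a : ℕ) : Submodule ℂ (UnitaryGrp n → ℂ) :=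
  Submodule.span ℂ {f | ∃ l : List (Bool × Fin n × Fin n), l.length ≤ a ∧ f = unitaryMonomial l}

variable (n) in
/-- The polynomial functions. -/
noncomputable def polyFun : Submodule ℂ (UnitaryGrp n → ℂ) :=
  Submodule.span ℂ (Set.range unitaryMonomial)

theorem continuous_entryOrConj (e : Bool × Fin n × Fin n) : Continuous (entryOrConj e) := by
  unfold entryOrConj
  split_ifs
  · exact continuous_unitary_entry _ _
  · exact (continuous_unitary_entry _ _).star

theorem continuous_unitaryMonomial (l : List (Bool × Fin n × Fin n)) :
    Continuous (unitaryMonomial l) :=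
  continuous_list_prod _ fun e _ => continuous_entryOrConj e

theorem unitaryMonomial_append (l m : List (Bool × Fin n × Fin n)) :
    unitaryMonomial (l ++ m) = unitaryMonomial l * unitaryMonomial m := by
  funext u; simp [unitaryMonomial]

theorem unitaryMonomial_mem_polyFun (l : List (Bool × Fin n × Fin n)) :
    unitaryMonomial l ∈ polyFun n := Submodule.subset_span ⟨l, rfl⟩

theorem entryOrConj_mem_polyFun (e : Bool × Fin n × Fin n) : entryOrConj e ∈ polyFun n := by
  convert unitaryMonomial_mem_polyFun [e] using 1
  funext u; simp [unitaryMonomial]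

theorem continuous_of_mem_polyFun {f : UnitaryGrp n → ℂ} (hf : f ∈ polyFun n) : Continuous f := by
  induction hf using Submodule.span_induction with
  | mem f hf => obtain ⟨l, rfl⟩ := hf; exact continuous_unitaryMonomial l
  | zero => exact continuous_const
  | add f g _ _ h1 h2 => exact h1.add h2
  | smul c f _ h => exact h.const_smul c

theorem polyFun_mul_mem {f g : UnitaryGrp n → ℂ} (hf : f ∈ polyFun n) (hg : g ∈ polyFun n) :
    f * g ∈ polyFun n := by
  have h := Submodule.mul_mem_mul hf hg
  rw [polyFun, Submodule.span_mul_span] at h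
  refine Submodule.span_mono ?_ h
  rintro _ ⟨_, ⟨l, rfl⟩, _, ⟨m, rfl⟩, rfl⟩
  exact ⟨l ++ m, unitaryMonomial_append l m⟩

theorem polyFun_const_mem (c : ℂ) : (fun _ => c) ∈ polyFun n := by
  have h : (fun _ : UnitaryGrp n => c) = c • unitaryMonomial [] := by
    funext u; simp [unitaryMonomial]
  rw [h]
  exact Submodule.smul_mem _ _ (unitaryMonomial_mem_polyFun _)

theorem polyFun_star_mem {f : UnitaryGrp n → ℂ} (hf : f ∈ polyFun n) :
    (fun u => star (f u)) ∈ polyFun n := by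
  induction hf using Submodule.span_induction with
  | mem f hf =>
    obtain ⟨l, rfl⟩ := hf
    convert unitaryMonomial_mem_polyFun (l.map fun e => (!e.1, e.2)) using 1
    funext u
    induction l with
    | nil => simp [unitaryMonomial]
    | cons e l ih =>
      simp only [unitaryMonomial, List.map_cons, List.prod_cons, star_mul'] at ih ⊢
      rw [ih]
      congr 1
      cases h : e.1 <;> simp [entryOrConj, h]
  | zero => simpa using polyFun_const_mem (n := n) 0
  | add f g _ _ h1 h2 => simpa [Pi.add_def] using Submodule.add_mem _ h1 h2
  | smul c f _ h =>
    have := Submodule.smul_mem _ (star c) h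
    convert this using 1
    funext u
    simp

theorem polyDeg_le_polyFun (a : ℕ) : polyDeg n a ≤ polyFun n := by
  refine Submodule.span_mono ?_
  rintro _ ⟨l, -, rfl⟩
  exact ⟨l, rfl⟩

theorem polyDeg_mono {a b : ℕ} (h : a ≤ b) : polyDeg n a ≤ polyDeg n b := by
  refine Submodule.span_mono ?_
  rintro _ ⟨l, hl, rfl⟩
  exact ⟨l, hl.trans h, rfl⟩

theorem polyDeg_mul_mem {a b : ℕ} {f g : UnitaryGrp n → ℂ} (hf : f ∈ polyDeg n a)
    (hg : g ∈ polyDeg n b) : f * g ∈ polyDeg n (a + b) := by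
  have h := Submodule.mul_mem_mul hf hg
  rw [polyDeg, polyDeg, Submodule.span_mul_span] at h
  refine Submodule.span_mono ?_ h
  rintro _ ⟨_, ⟨l, hl, rfl⟩, _, ⟨m, hm, rfl⟩, rfl⟩
  exact ⟨l ++ m, by simpa using Nat.add_le_add hl hm, (unitaryMonomial_append l m).symm⟩

theorem polyDeg_const_mem (a : ℕ) (c : ℂ) : (fun _ => c) ∈ polyDeg n a := by
  have h : (fun _ : UnitaryGrp n => c) = c • unitaryMonomial [] := by
    funext u; simp [unitaryMonomial]
  rw [h]
  exact Submodule.smul_mem _ _ (Submodule.subset_span ⟨[], by simp, rfl⟩)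

theorem entryOrConj_mem_polyDeg (e : Bool × Fin n × Fin n) : entryOrConj e ∈ polyDeg n 1 := by
  refine Submodule.subset_span ⟨[e], by simp, ?_⟩
  funext u; simp [unitaryMonomial]

theorem entryOrConj_mul (e : Bool) (i j : Fin n) (u h : UnitaryGrp n) :
    entryOrConj (e, i, j) (u * h) = ∑ c, entryOrConj (e, i, c) u * entryOrConj (e, c, j) h := by
  have : (u * h) i j = ∑ c, u i c * h c j := Matrix.mul_apply
  cases e
  · simp only [entryOrConj, Bool.false_eq_true, if_false, this, star_sum, star_mul']
  · simp only [entryOrConj, if_true, this]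

/-- Matrix multiplication separates variables in entries, hence in monomials. This keeps a
convolution with a polynomial function polynomial. -/
theorem polyFun_split {f : UnitaryGrp n → ℂ} (hf : f ∈ polyFun n) :
    ∃ (ι : Type) (_ : Fintype ι) (p q : ι → UnitaryGrp n → ℂ), (∀ c, p c ∈ polyFun n) ∧
      (∀ c, Continuous (q c)) ∧ ∀ u h, f (u * h) = ∑ c, p c u * q c h := by
  induction hf using Submodule.span_induction with
  | mem f hf =>
    obtain ⟨l, rfl⟩ := hf
    induction l with
    | nil =>
      exact ⟨Unit, inferInstance, fun _ _ => 1, fun _ _ => 1, fun _ => polyFun_const_mem 1,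
        fun _ => continuous_const, fun u h => by simp [unitaryMonomial]⟩
    | cons e l ih =>
      obtain ⟨ι, _, p, q, hp, hq, h⟩ := ih
      refine ⟨Fin n × ι, inferInstance, fun c => entryOrConj (e.1, e.2.1, c.1) * p c.2,
        fun c => entryOrConj (e.1, c.1, e.2.2) * q c.2,
        fun c => polyFun_mul_mem (entryOrConj_mem_polyFun _) (hp _),
        fun c => (continuous_entryOrConj _).mul (hq _), fun u v => ?_⟩
      have h1 : unitaryMonomial (e :: l) (u * v) =
          entryOrConj (e.1, e.2.1, e.2.2) (u * v) * unitaryMonomial l (u * v) := by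
        simp [unitaryMonomial]
      rw [h1, h, entryOrConj_mul, Finset.sum_mul_sum, Fintype.sum_prod_type]
      refine Finset.sum_congr rfl fun c _ => Finset.sum_congr rfl fun c' _ => ?_
      simp only [Pi.mul_apply]
      ring
  | zero => exact ⟨Empty, inferInstance, fun _ _ => 0, fun _ _ => 0, fun c => c.elim,
      fun c => c.elim, fun u h => by simp⟩
  | add f g _ _ h1 h2 =>
    obtain ⟨ι, _, p, q, hp, hq, h⟩ := h1
    obtain ⟨ι', _, p', q', hp', hq', h'⟩ := h2
    exact ⟨ι ⊕ ι', inferInstance, Sum.elim p p', Sum.elim q q', fun c => by cases c <;> simp [hp, hp'],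
      fun c => by cases c <;> simp [hq, hq'], fun u v => by simp [h, h']⟩
  | smul c f _ h =>
    obtain ⟨ι, _, p, q, hp, hq, h⟩ := h
    exact ⟨ι, inferInstance, fun x => c • p x, q, fun x => Submodule.smul_mem _ _ (hp x), hq,
      fun u v => by simp [h, Finset.mul_sum, mul_assoc]⟩

variable (n) in
/-- The star algebra of continuous functions which are polynomial. -/
noncomputable def polyStarSubalgebra : StarSubalgebra ℂ C(UnitaryGrp n, ℂ) where
  carrier := {f | ⇑f ∈ polyFun n}
  mul_mem' hf hg := polyFun_mul_mem hf hg
  add_mem' hf hg := Submodule.add_mem (polyFun n) hf hg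
  algebraMap_mem' c := polyFun_const_mem c
  star_mem' hf := polyFun_star_mem hf

/-- Stone–Weierstrass: the matrix entries already separate points. -/
theorem polyStarSubalgebra_topologicalClosure : (polyStarSubalgebra n).topologicalClosure = ⊤ := by
  refine ContinuousMap.starSubalgebra_topologicalClosure_eq_top_of_separatesPoints _ ?_
  intro u v huv
  by_contra hcon
  push Not at hcon
  refine huv (Matrix.UnitaryGroup.ext _ _ fun i j => ?_)
  have h := hcon (fun w => w i j) ⟨⟨fun w => w i j, continuous_unitary_entry i j⟩, ?_, rfl⟩
  · exact h
  · change (fun w : UnitaryGrp n => w i j) ∈ polyFun n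
    simpa [entryOrConj] using! entryOrConj_mem_polyFun (n := n) (true, i, j)

theorem eq_zero_of_integral_norm_sq {φ : UnitaryGrp n → ℂ} (hφ : Continuous φ)
    (h : ∫ u, ‖φ u‖ ^ 2 ∂unitaryHaar n = 0) (u : UnitaryGrp n) : φ u = 0 := by
  have h1 := (integral_eq_zero_iff_of_nonneg (fun u => sq_nonneg ‖φ u‖)
    (unitary_integrable (hφ.norm.pow 2))).mp h
  have h2 := (Continuous.ae_eq_iff_eq (unitaryHaar n) (hφ.norm.pow 2) continuous_const).mp h1
  have h3 : ‖φ u‖ ^ 2 = 0 := congrFun h2 u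
  simpa using h3

/-- Approximating `star φ` uniformly within `ε` by a polynomial function shows that the integral of
`‖φ‖ ^ 2` is at most `ε` times that of `‖φ‖`. -/
theorem eq_zero_of_orthogonal_polyFun {φ : UnitaryGrp n → ℂ} (hφ : Continuous φ)
    (h : ∀ p ∈ polyFun n, ∫ u, p u * φ u ∂unitaryHaar n = 0) (u : UnitaryGrp n) : φ u = 0 := by
  refine eq_zero_of_integral_norm_sq hφ ?_ u
  set A := ∫ u, ‖φ u‖ ∂unitaryHaar n
  have hA : 0 ≤ A := integral_nonneg fun u => norm_nonneg _
  have hle : ∀ ε > 0, ∫ u, ‖φ u‖ ^ 2 ∂unitaryHaar n ≤ ε * A := by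
    intro ε hε
    have hmem : (⟨fun u => star (φ u), hφ.star⟩ : C(UnitaryGrp n, ℂ)) ∈
        (polyStarSubalgebra n).topologicalClosure := by
      rw [polyStarSubalgebra_topologicalClosure]; trivial
    obtain ⟨p, hp, hdist⟩ := Metric.mem_closure_iff.mp hmem ε hε
    have hp' : ⇑p ∈ polyFun n := hp
    have hsub : ∀ u, ‖star (φ u) - p u‖ ≤ ε := fun u => by
      rw [← dist_eq_norm]
      exact (ContinuousMap.dist_apply_le_dist (f := ⟨fun u => star (φ u), hφ.star⟩) (g := p) u).trans
        hdist.le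
    have h1 : ((∫ u, ‖φ u‖ ^ 2 ∂unitaryHaar n : ℝ) : ℂ) =
        ∫ u, (star (φ u) - p u) * φ u ∂unitaryHaar n := by
      simp only [sub_mul]
      rw [integral_sub (unitary_integrable (hφ.star.fun_mul hφ))
        (unitary_integrable (p.continuous.fun_mul hφ)), h _ hp', sub_zero, ← integral_complex_ofReal]
      refine integral_congr_ae (Filter.Eventually.of_forall fun u => ?_)
      simp only [RCLike.star_def]
      rw [mul_comm, Complex.mul_conj, Complex.normSq_eq_norm_sq]
    have h2 : ‖((∫ u, ‖φ u‖ ^ 2 ∂unitaryHaar n : ℝ) : ℂ)‖ ≤ ε * A := by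
      rw [h1, ← integral_const_mul]
      refine (norm_integral_le_integral_norm _).trans (integral_mono
        (unitary_integrable (((hφ.star.sub p.continuous).mul hφ).norm))
        (unitary_integrable (hφ.norm.const_mul ε)) fun u => ?_)
      simp only [norm_mul]
      gcongr
      exact hsub u
    rw [Complex.norm_real] at h2
    exact (le_abs_self _).trans h2
  refine le_antisymm (le_of_forall_pos_le_add fun ε hε => ?_)
    (integral_nonneg fun u => by positivity)
  refine (hle (ε / (A + 1)) (by positivity)).trans ?_
  rw [zero_add, div_mul_eq_mul_div, div_le_iff₀ (by positivity)]
  nlinarith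

/-- The coefficients of a continuous matrix representation are polynomial functions. -/
theorem coeff_mem_polyFun {d : ℕ} (M : UnitaryGrp n →* Matrix (Fin d) (Fin d) ℂ)
    (hM : ∀ a b, Continuous fun u => M u a b) (a b : Fin d) :
    (fun u => M u a b) ∈ polyFun n := by
  have hMi : ∀ a b, Continuous fun u => M u⁻¹ a b := fun a b => (hM a b).comp continuous_inv
  -- `V` is the space of averages of `M h⁻¹` against polynomial functions. Once it contains the
  -- identity, `M` is a convolution of itself with a polynomial function, hence polynomial.
  let V : Submodule ℂ (Matrix (Fin d) (Fin d) ℂ) :=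
    { carrier := {A | ∃ p ∈ polyFun n, ∀ a b, A a b = ∫ h, p h * M h⁻¹ a b ∂unitaryHaar n}
      zero_mem' := ⟨0, Submodule.zero_mem _, fun a b => by simp⟩
      add_mem' := by
        rintro A B ⟨p, hp, hA⟩ ⟨q, hq, hB⟩
        refine ⟨p + q, Submodule.add_mem _ hp hq, fun a b => ?_⟩
        simp only [Matrix.add_apply, hA, hB, Pi.add_apply, add_mul]
        rw [integral_add (unitary_integrable ((continuous_of_mem_polyFun hp).fun_mul (hMi a b)))
          (unitary_integrable ((continuous_of_mem_polyFun hq).fun_mul (hMi a b)))]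
      smul_mem' := by
        rintro c A ⟨p, hp, hA⟩
        refine ⟨c • p, Submodule.smul_mem _ _ hp, fun a b => ?_⟩
        simp only [Matrix.smul_apply, hA, Pi.smul_apply, smul_eq_mul, mul_assoc]
        rw [integral_const_mul] }
  have h1 : (1 : Matrix (Fin d) (Fin d) ℂ) ∈ V := by
    by_contra hcon
    -- A functional that kills `V` but not the identity would make `u ↦ ℓ (M u⁻¹)` orthogonal to all
    -- polynomial functions, hence zero, although its value at `1` is not.
    obtain ⟨ℓ, hℓ1, hℓ⟩ := Submodule.exists_le_ker_of_notMem hcon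
    have hexp : ∀ A, ℓ A = ∑ a, ∑ b, A a b * ℓ (Matrix.single a b 1) := fun A => by
      conv_lhs => rw [Matrix.matrix_eq_sum_single A]
      simp only [map_sum]
      refine Finset.sum_congr rfl fun a _ => Finset.sum_congr rfl fun b _ => ?_
      rw [← smul_eq_mul, ← map_smul, Matrix.smul_single, smul_eq_mul, mul_one]
    have hc : Continuous fun u => ℓ (M u⁻¹) := by
      simp only [hexp (M _)]
      exact continuous_finsetSum _ fun a _ => continuous_finsetSum _ fun b _ =>
        (hMi a b).mul_const _
    have := eq_zero_of_orthogonal_polyFun hc (fun p hp => ?_) 1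
    · rw [inv_one, map_one] at this
      exact hℓ1 this
    · have hA : (Matrix.of fun a b => ∫ h, p h * M h⁻¹ a b ∂unitaryHaar n) ∈ V :=
        ⟨p, hp, fun a b => rfl⟩
      have h0 : ℓ (Matrix.of fun a b => ∫ h, p h * M h⁻¹ a b ∂unitaryHaar n) = 0 := hℓ hA
      rw [hexp] at h0
      rw [← h0]
      simp only [hexp (M _), Finset.mul_sum, Matrix.of_apply]
      have hpc := continuous_of_mem_polyFun hp
      rw [integral_finsetSum _ fun a _ => unitary_integrable (continuous_finsetSum _ fun b _ =>
        hpc.fun_mul ((hMi a b).mul_const _))]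
      refine Finset.sum_congr rfl fun a _ => ?_
      rw [integral_finsetSum _ fun b _ => unitary_integrable (hpc.fun_mul ((hMi a b).mul_const _))]
      refine Finset.sum_congr rfl fun b _ => ?_
      rw [← integral_mul_const]
      simp only [mul_assoc]
  obtain ⟨p, hp, h1⟩ := h1
  have hpc := continuous_of_mem_polyFun hp
  obtain ⟨ι, _, P, Q, hP, hQ, hPQ⟩ := polyFun_split hp
  have key : (fun u => M u a b) = ∑ c, (∫ h, Q c h * M h⁻¹ a b ∂unitaryHaar n) • P c := by
    funext u
    have e1 : M u a b = ∫ h, p h * M (h⁻¹ * u) a b ∂unitaryHaar n := by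
      have : M u a b = ((1 : Matrix (Fin d) (Fin d) ℂ) * M u) a b := by rw [one_mul]
      rw [this, Matrix.mul_apply]
      simp only [h1, map_mul, Matrix.mul_apply, Finset.mul_sum]
      rw [integral_finsetSum _ fun c _ => unitary_integrable
        (hpc.fun_mul ((hMi a c).mul_const _))]
      refine Finset.sum_congr rfl fun c _ => ?_
      rw [← integral_mul_const]
      simp only [mul_assoc]
    have e2 := integral_mul_left_eq_self (μ := unitaryHaar n)
      (fun h => p h * M (h⁻¹ * u) a b) u
    rw [e1, ← e2]
    simp only [mul_inv_rev, inv_mul_cancel_right, hPQ, Finset.sum_mul, Finset.sum_apply,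
      Pi.smul_apply, smul_eq_mul]
    rw [integral_finsetSum _ fun c _ => unitary_integrable
      ((continuous_const.fun_mul (hQ c)).fun_mul (hMi a b))]
    refine Finset.sum_congr rfl fun c _ => ?_
    rw [← integral_mul_const]
    refine integral_congr_ae (Filter.Eventually.of_forall fun h => ?_)
    simp only
    ring
  rw [key]
  exact Submodule.sum_mem _ fun c _ => Submodule.smul_mem _ _ (hP c)

end Poly

/-! ### Characters of the torus -/

section TorusChar

variable {n : ℕ}

/-- The character of the torus with weight `ω`. -/
noncomputable def torusChar (ω : Fin n → ℤ) : (Fin n → Circle) →* ℂ where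
  toFun t := ∏ i, (t i : ℂ) ^ ω i
  map_one' := by simp
  map_mul' s t := by simp [mul_zpow, Finset.prod_mul_distrib]

theorem torusChar_apply (ω : Fin n → ℤ) (t : Fin n → Circle) :
    torusChar ω t = ∏ i, (t i : ℂ) ^ ω i := rfl

theorem torusChar_add (ω ω' : Fin n → ℤ) (t : Fin n → Circle) :
    torusChar (ω + ω') t = torusChar ω t * torusChar ω' t := by
  simp only [torusChar_apply, ← Finset.prod_mul_distrib, Pi.add_apply]
  exact Finset.prod_congr rfl fun i _ => zpow_add₀ (Circle.coe_ne_zero _) _ _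

theorem torusChar_zero (t : Fin n → Circle) : torusChar 0 t = 1 := by simp [torusChar_apply]

theorem torusChar_neg (ω : Fin n → ℤ) (t : Fin n → Circle) :
    torusChar (-ω) t = (torusChar ω t)⁻¹ := by
  refine eq_inv_of_mul_eq_one_left ?_
  rw [← torusChar_add, neg_add_cancel, torusChar_zero]

theorem norm_torusChar (ω : Fin n → ℤ) (t : Fin n → Circle) : ‖torusChar ω t‖ = 1 := by
  simp only [torusChar_apply, norm_prod, norm_zpow, Circle.norm_coe, one_zpow, Finset.prod_const_one]

theorem torusChar_comp (ω : Fin n → ℤ) (σ : Equiv.Perm (Fin n)) (t : Fin n → Circle) :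
    torusChar ω (t ∘ σ.symm) = torusChar (ω ∘ σ) t := by
  simp only [torusChar_apply, Function.comp_apply]
  exact (Fintype.prod_equiv σ _ _ fun i => by simp).symm

/-- Irrationality of `π`: the point at angle `1` has infinite order. A single circle element
therefore detects integer exponents. -/
theorem circle_exp_one_zpow_injective :
    Function.Injective fun m : ℤ => ((Circle.exp 1 : Circle) : ℂ) ^ m := by
  intro m m' h
  simp only at h
  have h1 : (Circle.exp 1) ^ (m - m') = 1 := by
    apply Subtype.ext
    rw [Circle.coe_zpow, Circle.coe_one, zpow_sub₀ (Circle.coe_ne_zero _), h, div_self]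
    exact zpow_ne_zero _ (Circle.coe_ne_zero _)
  rw [← Circle.exp_zsmul, zsmul_eq_mul, mul_one] at h1
  obtain ⟨k, hk⟩ := Circle.exp_eq_one.mp h1
  by_contra hne
  have hk0 : k ≠ 0 := by
    rintro rfl
    simp only [Int.cast_zero, zero_mul, Int.cast_eq_zero] at hk
    omega
  refine irrational_pi.ne_rat (((m - m' : ℤ) : ℚ) / (k * 2)) ?_
  have : (k : ℝ) ≠ 0 := by exact_mod_cast hk0
  push_cast at hk ⊢
  field_simp
  linarith

theorem torusChar_injective : Function.Injective (torusChar (n := n)) := by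
  intro ω ω' h
  funext i
  have h1 := DFunLike.congr_fun h (Pi.mulSingle i (Circle.exp 1))
  have key : ∀ ω : Fin n → ℤ, torusChar ω (Pi.mulSingle i (Circle.exp 1)) =
      ((Circle.exp 1 : Circle) : ℂ) ^ ω i := fun ω => by
    rw [torusChar_apply, Finset.prod_eq_single i]
    · simp
    · intro j _ hj; simp [hj]
    · simp
  rw [key, key] at h1
  exact circle_exp_one_zpow_injective h1

theorem torusChar_linearIndependent :
    LinearIndependent ℂ fun ω : Fin n → ℤ => (torusChar ω : (Fin n → Circle) → ℂ) :=
  (linearIndependent_monoidHom (Fin n → Circle) ℂ).comp torusChar torusChar_injective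

/-- The characters are linearly independent, so the coordinate functional exists on their span; it
is extended arbitrarily to all functions so as to be total. Only its values on `trigPoly` carry
meaning. -/
theorem exists_torusCoeff (ω : Fin n → ℤ) : ∃ c : ((Fin n → Circle) → ℂ) →ₗ[ℂ] ℂ,
    ∀ ω', c (torusChar ω') = if ω' = ω then 1 else 0 := by
  have hv := torusChar_linearIndependent (n := n)
  obtain ⟨g, hg⟩ := LinearMap.exists_extend ((Finsupp.lapply ω) ∘ₗ hv.repr)
  refine ⟨g, fun ω' => ?_⟩
  have hmem : (torusChar ω' : (Fin n → Circle) → ℂ) ∈ Submodule.span ℂ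
      (Set.range fun ω : Fin n → ℤ => (torusChar ω : (Fin n → Circle) → ℂ)) :=
    Submodule.subset_span ⟨ω', rfl⟩
  have := LinearMap.congr_fun hg ⟨_, hmem⟩
  simp only [LinearMap.comp_apply, Submodule.subtype_apply,
    Finsupp.lapply_apply] at this
  rw [this, hv.repr_eq_single ω' ⟨_, hmem⟩ rfl, Finsupp.single_apply]

/-- The coefficient functional of a weight. -/
noncomputable def torusCoeff (ω : Fin n → ℤ) : ((Fin n → Circle) → ℂ) →ₗ[ℂ] ℂ :=
  (exists_torusCoeff ω).choose

theorem torusCoeff_char (ω ω' : Fin n → ℤ) :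
    torusCoeff ω (torusChar ω') = if ω' = ω then 1 else 0 :=
  (exists_torusCoeff ω).choose_spec ω'

variable (n) in
/-- The trigonometric polynomials on the torus. -/
noncomputable def trigPoly : Submodule ℂ ((Fin n → Circle) → ℂ) :=
  Submodule.span ℂ (Set.range fun ω : Fin n → ℤ => (torusChar ω : (Fin n → Circle) → ℂ))

theorem trigPoly_expand {f : (Fin n → Circle) → ℂ} (hf : f ∈ trigPoly n) :
    ∃ S : Finset (Fin n → ℤ), (∀ ω ∉ S, torusCoeff ω f = 0) ∧
      ∀ t, f t = ∑ ω ∈ S, torusCoeff ω f * torusChar ω t := by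
  obtain ⟨c, rfl⟩ := (Finsupp.mem_span_range_iff_exists_finsupp).mp hf
  have hc : ∀ ω, torusCoeff ω (c.sum fun i a => a • (torusChar i : (Fin n → Circle) → ℂ)) = c ω := by
    intro ω
    rw [Finsupp.sum, map_sum]
    simp only [map_smul, torusCoeff_char, smul_eq_mul, mul_ite, mul_one, mul_zero]
    rw [Finset.sum_ite_eq' c.support ω]
    simp +contextual
  refine ⟨c.support, fun ω hω => ?_, fun t => ?_⟩
  · rw [hc]; simpa using hω
  · simp only [hc]
    simp [Finsupp.sum, Finset.sum_apply]

theorem torusCoeff_translate {f : (Fin n → Circle) → ℂ} (hf : f ∈ trigPoly n)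
    (ω : Fin n → ℤ) (s : Fin n → Circle) :
    torusCoeff ω (fun t => f (s * t)) = torusChar ω s * torusCoeff ω f := by
  induction hf using Submodule.span_induction with
  | mem f hf =>
    obtain ⟨ω', rfl⟩ := hf
    have : (fun t => torusChar ω' (s * t)) = torusChar ω' s • (torusChar ω' : _ → ℂ) := by
      funext t; simp
    simp only [this, map_smul, torusCoeff_char]
    split_ifs with h
    · simp [h]
    · simp
  | zero =>
    have : (fun t => (0 : (Fin n → Circle) → ℂ) (s * t)) = 0 := rfl
    rw [this]; simp
  | add f g _ _ h1 h2 =>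
    have : (fun t => (f + g) (s * t)) = (fun t => f (s * t)) + fun t => g (s * t) := rfl
    rw [this, map_add, map_add, h1, h2, mul_add]
  | smul c f _ h =>
    have : (fun t => (c • f) (s * t)) = c • fun t => f (s * t) := rfl
    rw [this, map_smul, map_smul, h, smul_eq_mul, smul_eq_mul]
    ring

theorem torusCoeff_char_mul {f : (Fin n → Circle) → ℂ} (hf : f ∈ trigPoly n)
    (ω α : Fin n → ℤ) :
    torusCoeff ω (fun t => torusChar α t * f t) = torusCoeff (ω - α) f := by
  induction hf using Submodule.span_induction with
  | mem f hf =>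
    obtain ⟨ω', rfl⟩ := hf
    have : (fun t => torusChar α t * torusChar ω' t) = (torusChar (α + ω') : _ → ℂ) := by
      funext t; rw [torusChar_add]
    simp only [this, torusCoeff_char]
    refine if_congr ?_ rfl rfl
    rw [eq_sub_iff_add_eq, add_comm]
  | zero =>
    have : (fun t => torusChar α t * (0 : (Fin n → Circle) → ℂ) t) = 0 := by
      funext t; simp
    rw [this]; simp
  | add f g _ _ h1 h2 =>
    have : (fun t => torusChar α t * (f + g) t) =
        (fun t => torusChar α t * f t) + fun t => torusChar α t * g t := by
      funext t; simp [mul_add]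
    rw [this, map_add, map_add, h1, h2]
  | smul c f _ h =>
    have : (fun t => torusChar α t * (c • f) t) = c • fun t => torusChar α t * f t := by
      funext t; simp; ring
    rw [this, map_smul, map_smul, h]

theorem torusChar_single (i : Fin n) (m : ℤ) (t : Fin n → Circle) :
    torusChar (Pi.single i m) t = (t i : ℂ) ^ m := by
  rw [torusChar_apply, Finset.prod_eq_single i]
  · simp
  · intro j _ hj; simp [hj]
  · simp

theorem entryOrConj_diagU (e : Bool × Fin n × Fin n) (t : Fin n → Circle) :
    entryOrConj e (diagU n t) = if e.2.1 = e.2.2 then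
      torusChar (Pi.single e.2.1 (if e.1 then 1 else -1)) t else 0 := by
  obtain ⟨b, i, j⟩ := e
  simp only [entryOrConj, diagU_apply, torusChar_single]
  by_cases h : i = j
  · cases b
    · simp [h, ← Circle.coe_inv_eq_conj]
    · simp [h]
  · simp [h]

theorem polyFun_restrict {f : UnitaryGrp n → ℂ} (hf : f ∈ polyFun n) :
    (fun t => f (diagU n t)) ∈ trigPoly n := by
  induction hf using Submodule.span_induction with
  | mem f hf =>
    obtain ⟨l, rfl⟩ := hf
    have key : (∀ t, unitaryMonomial l (diagU n t) = 0) ∨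
        ∃ ω, ∀ t, unitaryMonomial l (diagU n t) = torusChar ω t := by
      induction l with
      | nil => exact Or.inr ⟨0, fun t => by simp [unitaryMonomial, torusChar_zero]⟩
      | cons e l ih =>
        have hc : ∀ t, unitaryMonomial (e :: l) (diagU n t) =
            entryOrConj e (diagU n t) * unitaryMonomial l (diagU n t) := fun t => by
          simp [unitaryMonomial]
        simp only [hc, entryOrConj_diagU]
        by_cases he : e.2.1 = e.2.2
        · rcases ih with ih | ⟨ω, ih⟩
          · exact Or.inl fun t => by rw [ih, mul_zero]
          · exact Or.inr ⟨_, fun t => by rw [ih, if_pos he, ← torusChar_add]⟩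
        · exact Or.inl fun t => by rw [if_neg he, zero_mul]
    rcases key with h | ⟨ω, h⟩
    · simp only [h]; exact Submodule.zero_mem _
    · simp only [h]; exact Submodule.subset_span ⟨ω, rfl⟩
  | zero => exact Submodule.zero_mem _
  | add f g _ _ h1 h2 => exact Submodule.add_mem _ h1 h2
  | smul c f _ h => exact Submodule.smul_mem _ c h

end TorusChar

/-! ### Weights of a representation of the unitary group -/

section Weights

variable {n d : ℕ} (M : UnitaryGrp n →* Matrix (Fin d) (Fin d) ℂ)

/-- The projection on the weight space of `ω`. -/
noncomputable def weightProj (ω : Fin n → ℤ) : Matrix (Fin d) (Fin d) ℂ :=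
  Matrix.of fun a b => torusCoeff ω fun t => M (diagU n t) a b

theorem weightProj_mul_of_weight {ω : Fin n → ℤ} {m : ℕ} {N : Matrix (Fin d) (Fin m) ℂ}
    (hN : ∀ t, M (diagU n t) * N = torusChar ω t • N) (ω' : Fin n → ℤ) :
    weightProj M ω' * N = if ω' = ω then N else 0 := by
  ext a c
  have h1 : (weightProj M ω' * N) a c =
      torusCoeff ω' (∑ b, N b c • fun t => M (diagU n t) a b) := by
    simp only [Matrix.mul_apply, weightProj, Matrix.of_apply, map_sum, map_smul, smul_eq_mul]
    exact Finset.sum_congr rfl fun b _ => mul_comm _ _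
  have h2 : (∑ b, N b c • fun t => M (diagU n t) a b) = N a c • (torusChar ω : _ → ℂ) := by
    funext t
    have := congrFun (congrFun (hN t) a) c
    rw [Matrix.mul_apply] at this
    simp only [Finset.sum_apply, Pi.smul_apply, smul_eq_mul]
    rw [Matrix.smul_apply, smul_eq_mul] at this
    rw [mul_comm, ← this]
    exact Finset.sum_congr rfl fun b _ => mul_comm _ _
  rw [h1, h2, map_smul, torusCoeff_char]
  by_cases h : ω = ω'
  · simp [h]
  · simp [h, Ne.symm h]

variable {M} (hM : ∀ a b, Continuous fun u => M u a b)
include hM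

theorem coeff_mem_trigPoly (a b : Fin d) : (fun t => M (diagU n t) a b) ∈ trigPoly n :=
  polyFun_restrict (coeff_mem_polyFun M hM a b)

theorem weightProj_expand : ∃ S : Finset (Fin n → ℤ), (∀ ω ∉ S, weightProj M ω = 0) ∧
    ∀ t, M (diagU n t) = ∑ ω ∈ S, torusChar ω t • weightProj M ω := by
  classical
  choose S hS0 hS using fun a b => trigPoly_expand (coeff_mem_trigPoly hM a b)
  let T := Finset.univ.biUnion fun a => Finset.univ.biUnion fun b => S a b
  have hsub : ∀ a b, S a b ⊆ T := fun a b ω hω =>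
    Finset.mem_biUnion.mpr ⟨a, Finset.mem_univ _, Finset.mem_biUnion.mpr ⟨b, Finset.mem_univ _, hω⟩⟩
  refine ⟨T, fun ω hω => ?_, fun t => ?_⟩
  · ext a b
    exact hS0 a b ω fun h => hω (hsub a b h)
  · ext a b
    rw [Matrix.sum_apply, hS a b t]
    refine (Finset.sum_subset (hsub a b) fun ω _ hω => ?_).trans ?_
    · rw [hS0 a b ω hω, zero_mul]
    · refine Finset.sum_congr rfl fun ω _ => ?_
      rw [Matrix.smul_apply, smul_eq_mul, mul_comm]
      rfl

theorem diagU_mul_weightProj (s : Fin n → Circle) (ω : Fin n → ℤ) :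
    M (diagU n s) * weightProj M ω = torusChar ω s • weightProj M ω := by
  ext a c
  rw [Matrix.smul_apply, smul_eq_mul]
  change _ = torusChar ω s * torusCoeff ω _
  rw [← torusCoeff_translate (coeff_mem_trigPoly hM a c)]
  have : (fun t => M (diagU n (s * t)) a c) =
      ∑ b, M (diagU n s) a b • fun t => M (diagU n t) b c := by
    funext t
    simp [Matrix.mul_apply]
  rw [this, map_sum, Matrix.mul_apply]
  refine Finset.sum_congr rfl fun b _ => ?_
  rw [map_smul]; rfl

theorem weightProj_mul (ω ω' : Fin n → ℤ) :
    weightProj M ω * weightProj M ω' = if ω = ω' then weightProj M ω' else 0 :=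
  weightProj_mul_of_weight M (fun t => diagU_mul_weightProj hM t ω') ω

theorem exists_weights : ∃ P : Finset (Fin n → ℤ), (∀ ω, ω ∈ P ↔ weightProj M ω ≠ 0) ∧
    ∀ t, M (diagU n t) = ∑ ω ∈ P, torusChar ω t • weightProj M ω := by
  classical
  obtain ⟨S, hS, h⟩ := weightProj_expand hM
  refine ⟨S.filter fun ω => weightProj M ω ≠ 0, fun ω => ?_, fun t => ?_⟩
  · rw [Finset.mem_filter]
    exact ⟨fun h => h.2, fun h => ⟨by_contra fun h' => h (hS ω h'), h⟩⟩
  · rw [h t]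
    symm
    refine Finset.sum_filter_of_ne fun ω _ hne h0 => hne ?_
    rw [h0, smul_zero]

/-- The weight projection is idempotent, so its trace is its rank, the multiplicity of the weight.
-/
theorem weightProj_trace (ω : Fin n → ℤ) :
    ∃ m : ℕ, (weightProj M ω).trace = m ∧ (weightProj M ω ≠ 0 → 1 ≤ m) := by
  have hi : IsIdempotentElem (Matrix.toLin' (weightProj M ω)) := by
    rw [IsIdempotentElem, Module.End.mul_eq_comp, ← Matrix.toLin'_mul, weightProj_mul hM,
      if_pos rfl]
  have ht := LinearMap.IsProj.trace (LinearMap.IsIdempotentElem.isProj_range _ hi)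
  rw [Matrix.trace_toLin'_eq] at ht
  refine ⟨_, ht, fun hne => Nat.one_le_iff_ne_zero.mpr fun h0 => hne ?_⟩
  rw [h0, Nat.cast_zero, ← Matrix.trace_toLin'_eq] at ht
  have := LinearMap.IsIdempotentElem.eq_zero_of_trace_eq_zero hi ht
  simpa using this

theorem card_weights_le {P : Finset (Fin n → ℤ)} (hP : ∀ ω, ω ∈ P ↔ weightProj M ω ≠ 0)
    (hexp : ∀ t, M (diagU n t) = ∑ ω ∈ P, torusChar ω t • weightProj M ω) : P.card ≤ d := by
  choose m hm hm1 using weightProj_trace hM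
  have h1 := congrArg Matrix.trace (hexp 1)
  simp only [map_one, Matrix.trace_one, Fintype.card_fin, one_smul, Matrix.trace_sum, hm] at h1
  have h2 : d = ∑ ω ∈ P, m ω := by exact_mod_cast h1
  rw [h2, Finset.card_eq_sum_ones]
  exact Finset.sum_le_sum fun ω hω => hm1 ω ((hP ω).mp hω)

end Weights

/-! ### Symmetry and strings of weights -/

section Permutation

variable {n : ℕ}

/-- The permutation matrices as unitary matrices. -/
noncomputable def permU (σ : Equiv.Perm (Fin n)) : UnitaryGrp n :=
  ⟨σ.permMatrix ℂ, by
    rw [Matrix.mem_unitaryGroup_iff, Matrix.star_eq_conjTranspose, Matrix.conjTranspose_permMatrix,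
      ← Matrix.permMatrix_mul]
    simp⟩

theorem permU_apply (σ : Equiv.Perm (Fin n)) (i j : Fin n) :
    permU σ i j = if σ i = j then 1 else 0 := by
  change σ.permMatrix ℂ i j = _
  simp [Equiv.Perm.permMatrix, PEquiv.toMatrix_apply, Equiv.toPEquiv_apply, eq_comm]

theorem diagU_mul_permU (t : Fin n → Circle) (σ : Equiv.Perm (Fin n)) :
    diagU n t * permU σ = permU σ * diagU n (t ∘ σ.symm) := by
  refine Matrix.UnitaryGroup.ext _ _ fun i j => ?_
  rw [diagU_mul_apply, mul_diagU_apply, permU_apply]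
  by_cases h : σ i = j
  · subst h; simp
  · simp [h]

end Permutation

section Strings

variable {n d : ℕ} {M : UnitaryGrp n →* Matrix (Fin d) (Fin d) ℂ}

theorem isUnit_rep (u : UnitaryGrp n) : IsUnit (M u) := (Group.isUnit u).map M

/-- An element normalizing the torus permutes the weight spaces. The hypothesis leaves `g` free so
that it covers permutation matrices as well as quarter turns, which are such matrices only up to
signs. -/
theorem weightProj_mul_rep_mul (hM : ∀ a b, Continuous fun u => M u a b) {g : UnitaryGrp n}
    {σ : Equiv.Perm (Fin n)} (hg : ∀ t, diagU n t * g = g * diagU n (t ∘ σ.symm))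
    (ω ω' : Fin n → ℤ) :
    weightProj M ω' * (M g * weightProj M ω) =
      if ω' = ω ∘ σ then M g * weightProj M ω else 0 := by
  refine weightProj_mul_of_weight M (fun t => ?_) ω'
  rw [← mul_assoc, ← map_mul, hg, map_mul, mul_assoc, diagU_mul_weightProj hM, torusChar_comp,
    mul_smul_comm]

theorem weightProj_perm_ne_zero (hM : ∀ a b, Continuous fun u => M u a b) {ω : Fin n → ℤ}
    (hω : weightProj M ω ≠ 0) (σ : Equiv.Perm (Fin n)) : weightProj M (ω ∘ σ) ≠ 0 := by
  intro h0
  have h := weightProj_mul_rep_mul hM (fun t => diagU_mul_permU t σ) ω (ω ∘ σ)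
  rw [h0, zero_mul, if_pos rfl] at h
  exact hω ((isUnit_rep (permU σ)).mul_right_eq_zero.mp h.symm)

/-- The root `e_i - e_j`. -/
def rootVec (i j : Fin n) : Fin n → ℤ := Pi.single i 1 - Pi.single j 1

theorem torusChar_rootVec (i j : Fin n) (t : Fin n → Circle) :
    torusChar (rootVec i j) t = t i * (t j : ℂ)⁻¹ := by
  rw [rootVec, sub_eq_add_neg, torusChar_add, torusChar_neg, torusChar_single, torusChar_single]
  simp

theorem conj_rotU_apply {i j : Fin n} (h : i ≠ j) (t : Fin n → Circle) (s : ℝ) (k l : Fin n) :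
    (diagU n t * rotU h s * diagU n t⁻¹) k l =
      t k * (rotMatrix i j s k l) * (t l : ℂ)⁻¹ := by
  rw [mul_diagU_apply, diagU_mul_apply]
  simp [rotU]

theorem hasDerivAt_rotMatrix_zero {i j : Fin n} (k l : Fin n) :
    HasDerivAt (fun s => rotMatrix i j s k l) (planeGen i j k l) 0 := by
  have h1 : ∀ s, rotMatrix i j s k l = (1 : Matrix (Fin n) (Fin n) ℂ) k l +
      ((Real.cos s : ℂ) - 1) * planeProj i j k l + (Real.sin s : ℂ) * planeGen i j k l :=
    fun s => by simp [rotMatrix]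
  simp only [h1]
  refine ((((Real.hasDerivAt_cos 0).ofReal_comp.sub_const 1).mul_const _).const_add _).fun_add
    ((Real.hasDerivAt_sin 0).ofReal_comp.mul_const _) |>.congr_deriv ?_
  simp

/-- The derivative of a polynomial function along a rotation conjugated by a torus element. -/
theorem hasDerivAt_polyFun_rotU {i j : Fin n} (h : i ≠ j) {f : UnitaryGrp n → ℂ}
    (hf : f ∈ polyFun n) : ∃ x y : ℂ, ∀ t : Fin n → Circle,
      HasDerivAt (fun s => f (diagU n t * rotU h s * diagU n t⁻¹))
        (torusChar (rootVec i j) t * x + torusChar (-rootVec i j) t * y) 0 := by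
  have hone : ∀ t, diagU n t * rotU h 0 * diagU n t⁻¹ = 1 := fun t => by
    rw [rotU_zero, mul_one, ← map_mul, mul_inv_cancel, map_one]
  induction hf using Submodule.span_induction with
  | mem f hf =>
    obtain ⟨l, rfl⟩ := hf
    induction l with
    | nil =>
      refine ⟨0, 0, fun t => ?_⟩
      simpa [unitaryMonomial] using hasDerivAt_const (0 : ℝ) (1 : ℂ)
    | cons e l ih =>
      obtain ⟨x, y, hxy⟩ := ih
      have he : ∃ x y : ℂ, ∀ t : Fin n → Circle,
          HasDerivAt (fun s => entryOrConj e (diagU n t * rotU h s * diagU n t⁻¹))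
            (torusChar (rootVec i j) t * x + torusChar (-rootVec i j) t * y) 0 := by
        obtain ⟨b, k, l⟩ := e
        -- The infinitesimal rotation is `E_ij - E_ji`, and conjugation by the torus scales its two
        -- terms by the root character and its inverse.
        have hu : ∀ t : Fin n → Circle,
            HasDerivAt (fun s => (diagU n t * rotU h s * diagU n t⁻¹) k l)
              (torusChar (rootVec i j) t * (if k = i ∧ l = j then 1 else 0) +
                torusChar (-rootVec i j) t * (if k = j ∧ l = i then -1 else 0)) 0 := fun t => by
          simp only [conj_rotU_apply, torusChar_neg, torusChar_rootVec]
          refine ((hasDerivAt_rotMatrix_zero k l).const_mul _).mul_const _ |>.congr_deriv ?_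
          simp only [planeGen, Matrix.sub_apply, Matrix.single_apply]
          by_cases h1 : k = i
          · have h2 : k ≠ j := fun h' => h (h1.symm.trans h')
            by_cases h3 : l = j
            · subst h1 h3; simp [h2, h2.symm]
            · simp [h1, h3, h, h.symm, Ne.symm h3]
          · by_cases h2 : k = j
            · by_cases h3 : l = i
              · subst h2 h3; simp [h, h.symm, mul_comm]
              · simp [h2, h3, h, h.symm, Ne.symm h3]
            · simp [h1, h2, Ne.symm h1, Ne.symm h2]
        cases b
        · refine ⟨if k = j ∧ l = i then -1 else 0, if k = i ∧ l = j then 1 else 0, fun t => ?_⟩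
          have hc : ∀ ω : Fin n → ℤ, star (torusChar ω t) = torusChar (-ω) t := fun ω => by
            rw [torusChar_neg, RCLike.star_def, ← Complex.inv_eq_conj (norm_torusChar ω t)]
          refine ((hu t).star).congr_deriv ?_
          simp only [star_add, star_mul', hc, neg_neg]
          rw [add_comm]
          congr 2 <;> split_ifs <;> simp
        · exact ⟨_, _, hu⟩
      obtain ⟨x', y', hxy'⟩ := he
      refine ⟨x' * unitaryMonomial l 1 + entryOrConj e 1 * x,
        y' * unitaryMonomial l 1 + entryOrConj e 1 * y, fun t => ?_⟩
      have hc : ∀ u, unitaryMonomial (e :: l) u = entryOrConj e u * unitaryMonomial l u := fun u => by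
        simp [unitaryMonomial]
      simp only [hc]
      refine ((hxy' t).fun_mul (hxy t)).congr_deriv ?_
      rw [hone]
      ring
  | zero => exact ⟨0, 0, fun t => by simpa using hasDerivAt_const (0 : ℝ) (0 : ℂ)⟩
  | add f g _ _ h1 h2 =>
    obtain ⟨x, y, hxy⟩ := h1
    obtain ⟨x', y', hxy'⟩ := h2
    refine ⟨x + x', y + y', fun t => ((hxy t).fun_add (hxy' t)).congr_deriv ?_⟩
    ring
  | smul c f _ hf =>
    obtain ⟨x, y, hxy⟩ := hf
    refine ⟨c * x, c * y, fun t => ((hxy t).const_mul c).congr_deriv ?_⟩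
    ring

theorem linear_ode_eq_zero {B : Matrix (Fin d) (Fin d) ℂ} {y : ℝ → Fin d → ℂ}
    (hy : ∀ s, HasDerivAt y (B.mulVec (y s)) s) (h0 : y 0 = 0) {s : ℝ} (hs : 0 ≤ s) : y s = 0 := by
  let T : (Fin d → ℂ) →L[ℂ] (Fin d → ℂ) := LinearMap.toContinuousLinearMap (Matrix.toLin' B)
  have h := ODE_solution_unique (v := fun _ => T) (K := ‖T‖₊) (f := y) (g := fun _ => 0) (a := 0)
    (b := s) (fun _ => T.lipschitz) (fun x _ => (hy x).continuousAt.continuousWithinAt)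
    (fun x _ => (hy x).hasDerivWithinAt) continuousOn_const
    (fun x _ => by simpa using (hasDerivAt_const x (0 : Fin d → ℂ)).hasDerivWithinAt) h0
  exact h ⟨hs, le_refl s⟩

/-- The quarter turn represents the transposition of `i` and `j` up to a sign. Rotations thus form a
one-parameter group running from the identity to a reflection of the weights. -/
theorem diagU_mul_rotU_quarter {i j : Fin n} (h : i ≠ j) (t : Fin n → Circle) :
    diagU n t * rotU h (Real.pi / 2) =
      rotU h (Real.pi / 2) * diagU n (t ∘ (Equiv.swap i j).symm) := by
  refine Matrix.UnitaryGroup.ext _ _ fun k l => ?_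
  rw [diagU_mul_apply, mul_diagU_apply]
  have hr : rotU h (Real.pi / 2) k l = (1 : Matrix (Fin n) (Fin n) ℂ) k l -
      planeProj i j k l + planeGen i j k l := by
    change rotMatrix i j (Real.pi / 2) k l = _
    simp [rotMatrix]
    ring
  rw [hr]
  simp only [planeProj, planeGen, Matrix.add_apply, Matrix.sub_apply, Matrix.single_apply,
    Matrix.one_apply, Function.comp_apply, Equiv.symm_swap]
  by_cases h1 : l = i
  · subst h1
    by_cases h2 : k = j
    · subst h2; simp [h, h.symm, mul_comm]
    · by_cases h3 : k = l
      · subst h3; simp [h.symm]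
      · simp [h3, Ne.symm h3, Ne.symm h2, h.symm]
  · by_cases h2 : l = j
    · subst h2
      by_cases h3 : k = i
      · subst h3; simp [h, h.symm, mul_comm]
      · by_cases h4 : k = l
        · subst h4; simp [h]
        · simp [Ne.symm h3, h, h4, Ne.symm h4]
    · rw [Equiv.swap_apply_of_ne_of_ne h1 h2]
      by_cases h3 : k = l
      · subst h3; simp [Ne.symm h1, Ne.symm h2]
      · simp [h3, Ne.symm h1, Ne.symm h2]

/-- If `ω` is a weight with `ω j < ω i`, so is `ω - (e_i - e_j)`. -/
theorem weightProj_string (hM : ∀ a b, Continuous fun u => M u a b) {ω : Fin n → ℤ} {i j : Fin n}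
    (hω : weightProj M ω ≠ 0) (hij : ω j < ω i) : weightProj M (ω - rootVec i j) ≠ 0 := by
  classical
  have h : i ≠ j := by rintro rfl; exact lt_irrefl _ hij
  -- If `ω - α` is not a weight, the weights `ω + k • α` with `k ≥ 0` are cut off from the rest of
  -- the string below. The infinitesimal rotation `D` shifts weights by `±α` only, so rotations
  -- respect this cut; but the quarter turn reflects the string and would have to carry the weight
  -- space of `ω` across it.
  intro hzero
  apply hω
  set α := rootVec i j with hα
  choose x y hxy using fun a b => hasDerivAt_polyFun_rotU h (coeff_mem_polyFun M hM a b)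
  let Dp : Matrix (Fin d) (Fin d) ℂ := Matrix.of x
  let Dm : Matrix (Fin d) (Fin d) ℂ := Matrix.of y
  let D := Dp + Dm
  have hder0 : ∀ a b, HasDerivAt (fun s => M (rotU h s) a b) (D a b) 0 := fun a b => by
    have := hxy a b 1
    simp only [map_one, one_mul, inv_one, mul_one] at this
    exact this
  have hconj : ∀ t, M (diagU n t) * D = (torusChar α t • Dp + torusChar (-α) t • Dm) *
      M (diagU n t) := fun t => by
    have hinv : M (diagU n t⁻¹) * M (diagU n t) = 1 := by
      rw [← map_mul, ← map_mul, inv_mul_cancel, map_one, map_one]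
    have : M (diagU n t) * D * M (diagU n t⁻¹) = torusChar α t • Dp + torusChar (-α) t • Dm := by
      ext a b
      refine HasDerivAt.unique ?_ (hxy a b t)
      simp only [map_mul, Matrix.mul_apply, Finset.sum_mul]
      refine HasDerivAt.fun_sum fun c _ => HasDerivAt.fun_sum fun e _ => ?_
      exact ((hder0 e c).const_mul _).mul_const _
    rw [← this, mul_assoc, hinv, mul_one]
  have hQD : ∀ ω', weightProj M ω' * D =
      Dp * weightProj M (ω' - α) + Dm * weightProj M (ω' + α) := fun ω' => by
    ext a c
    have e1 : (weightProj M ω' * D) a c =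
        torusCoeff ω' (∑ b, D b c • fun t => M (diagU n t) a b) := by
      simp only [Matrix.mul_apply, weightProj, Matrix.of_apply, map_sum, map_smul, smul_eq_mul]
      exact Finset.sum_congr rfl fun b _ => mul_comm _ _
    have e2 : (∑ b, D b c • fun t => M (diagU n t) a b) =
        ∑ b, (Dp a b • (fun t => torusChar α t * M (diagU n t) b c) +
          Dm a b • fun t => torusChar (-α) t * M (diagU n t) b c) := by
      funext t
      have := congrFun (congrFun (hconj t) a) c
      rw [Matrix.mul_apply, Matrix.mul_apply] at this
      simp only [Finset.sum_apply, Pi.smul_apply, Pi.add_apply, smul_eq_mul]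
      calc _ = ∑ b, M (diagU n t) a b * D b c := Finset.sum_congr rfl fun b _ => mul_comm _ _
        _ = _ := this
        _ = _ := Finset.sum_congr rfl fun b _ => by
            simp only [Matrix.add_apply, Matrix.smul_apply, smul_eq_mul]; ring
    rw [e1, e2, map_sum]
    simp only [map_add, map_smul, torusCoeff_char_mul (coeff_mem_trigPoly hM _ _), sub_neg_eq_add,
      Matrix.add_apply, Matrix.mul_apply, smul_eq_mul, ← Finset.sum_add_distrib]
    rfl
  obtain ⟨P, hP, -⟩ := exists_weights hM
  set X := P.filter fun ω' => ∃ k : ℕ, ω' = ω + (k : ℤ) • α with hX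
  set QX := ∑ ω' ∈ X, weightProj M ω' with hQX
  have hin : ∀ k : ℕ, weightProj M (ω + (k : ℤ) • α) * QX = weightProj M (ω + (k : ℤ) • α) := by
    intro k
    simp only [hQX, Finset.mul_sum, weightProj_mul hM]
    rw [Finset.sum_ite_eq]
    split_ifs with hmem
    · rfl
    · by_contra hne
      exact hmem (Finset.mem_filter.mpr ⟨(hP _).mpr (Ne.symm hne), k, rfl⟩)
  have hQXQX : QX * QX = QX := by
    conv_lhs => rw [hQX, Finset.sum_mul]
    refine Finset.sum_congr rfl fun ω' hω' => ?_
    obtain ⟨k, rfl⟩ := (Finset.mem_filter.mp hω').2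
    exact hin k
  -- The only shift leaving the upper part of the string goes from `ω` to `ω - α`, whose projection
  -- vanishes by `hzero`.
  have hQXD : QX * D * QX = QX * D := by
    simp only [hQX, Finset.sum_mul, hQD]
    rw [← hQX]
    refine Finset.sum_congr rfl fun ω' hω' => ?_
    obtain ⟨k, rfl⟩ := (Finset.mem_filter.mp hω').2
    have e1 : ω + (k : ℤ) • α + α = ω + ((k + 1 : ℕ) : ℤ) • α := by
      push_cast; rw [add_smul, one_smul, add_assoc]
    rw [add_mul, mul_assoc, mul_assoc, e1, hin]
    congr 2
    cases k with
    | zero => simp [hzero]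
    | succ k =>
      have e2 : ω + ((k + 1 : ℕ) : ℤ) • α - α = ω + (k : ℤ) • α := by
        push_cast; rw [add_smul, one_smul]; abel
      rw [e2, hin]
  have hderiv : ∀ s a b, HasDerivAt (fun s => M (rotU h s) a b) ((D * M (rotU h s)) a b) s := by
    intro s a b
    have h1 : ∀ s', M (rotU h s') a b = (M (rotU h (s' - s)) * M (rotU h s)) a b := fun s' => by
      rw [← map_mul, ← rotU_add, sub_add_cancel]
    simp only [h1, Matrix.mul_apply]
    refine HasDerivAt.fun_sum fun c _ => HasDerivAt.mul_const ?_ _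
    have h2 : HasDerivAt (fun s => M (rotU h s) a c) (D a c) (s - s) := by
      rw [sub_self]; exact hder0 a c
    exact h2.comp_sub_const s s
  -- By `hQXD` each column of this block solves a linear equation with matrix `QX * D`, starting
  -- from zero at angle `0`.
  have hY : QX * M (rotU h (Real.pi / 2)) * (1 - QX) = 0 := by
    ext a b
    let Y : ℝ → Fin d → ℂ := fun s a => (QX * M (rotU h s) * (1 - QX)) a b
    have hYd : ∀ s, HasDerivAt Y ((QX * D).mulVec (Y s)) s := fun s => by
      rw [hasDerivAt_pi]
      intro a
      have e1 : (QX * D).mulVec (Y s) a = (QX * (D * M (rotU h s)) * (1 - QX)) a b := by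
        have : QX * (D * M (rotU h s)) * (1 - QX) =
            (QX * D) * (QX * M (rotU h s) * (1 - QX)) := by
          simp only [← mul_assoc]; rw [hQXD]
        rw [this, Matrix.mul_apply]
        rfl
      rw [e1]
      simp only [Y, Matrix.mul_apply (M := QX * _), Matrix.mul_apply (M := QX)]
      refine HasDerivAt.fun_sum fun c _ => HasDerivAt.mul_const ?_ _
      refine HasDerivAt.fun_sum fun e _ => HasDerivAt.const_mul _ ?_
      exact hderiv s e c
    have hY0 : Y 0 = 0 := by
      funext a
      simp only [Y, rotU_zero, map_one, mul_one, mul_sub, hQXQX, sub_self]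
      rfl
    exact congrFun (linear_ode_eq_zero hYd hY0 (by positivity : (0 : ℝ) ≤ Real.pi / 2)) a
  set g := rotU h (Real.pi / 2) with hg
  have h1 : weightProj M ω * M g = weightProj M ω * (M g * QX) := by
    have hω0 : weightProj M ω * QX = weightProj M ω := by simpa using hin 0
    have := congrArg (fun A => weightProj M ω * A) hY
    simp only [mul_zero, mul_sub, mul_one] at this
    rw [← mul_assoc, ← mul_assoc, ← mul_assoc, hω0, mul_assoc (weightProj M ω) (M g) QX] at this
    exact sub_eq_zero.mp this
  have h2 : weightProj M ω * (M g * QX) = 0 := by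
    rw [hQX, Finset.mul_sum, Finset.mul_sum]
    refine Finset.sum_eq_zero fun ω' hω' => ?_
    rw [weightProj_mul_rep_mul hM (fun t => diagU_mul_rotU_quarter h t), if_neg]
    intro heq
    obtain ⟨k, rfl⟩ := (Finset.mem_filter.mp hω').2
    -- At `j` the equation would read `ω j = ω i + k` with `k ≥ 0`, against `ω j < ω i`: the mirror
    -- image of `ω` lies strictly below it.
    have := congrFun heq j
    simp [hα, rootVec, h] at this
    omega
  rw [h2] at h1
  exact (isUnit_rep g).mul_left_eq_zero.mp h1

end Strings

/-! ### Weight sets of small size -/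

section WeightSets

variable {n : ℕ}

/-- Remove pairs of coordinates with unequal values until the rest is constant, with value `b`. If
`q` pairs were removed, at most `2 * q` coordinates differ from `b`, and swapping inside each pair
or not gives `2 ^ q` distinct rearrangements. -/
theorem exists_mode_of_orbit (ω : Fin n → ℤ) (A : Finset (Fin n)) :
    ∃ (q : ℕ) (b : ℤ) (F : Finset (Fin n → ℤ)), (A.filter fun i => ω i ≠ b).card ≤ 2 * q ∧
      2 ^ q ≤ F.card ∧ ∀ f ∈ F, ∃ σ : Equiv.Perm (Fin n), (∀ x ∉ A, σ x = x) ∧ f = ω ∘ σ := by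
  classical
  induction A using Finset.strongInduction with
  | H A ih =>
    by_cases hconst : ∃ b, ∀ i ∈ A, ω i = b
    · obtain ⟨b, hb⟩ := hconst
      refine ⟨0, b, {ω}, ?_, by simp, fun f hf => ⟨1, fun _ _ => rfl, ?_⟩⟩
      · rw [Finset.filter_false_of_mem (by simpa using hb)]; simp
      · rw [Finset.mem_singleton.mp hf]; rfl
    · push Not at hconst
      have hne : A.Nonempty := by
        obtain ⟨i, hi, -⟩ := hconst 0
        exact ⟨i, hi⟩
      obtain ⟨i, hi⟩ := hne
      obtain ⟨j, hj, hji⟩ := hconst (ω i)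
      have hij : j ≠ i := by rintro rfl; exact hji rfl
      set A' := (A.erase i).erase j with hA'
      have hsub : A' ⊂ A := (Finset.erase_subset _ _).trans_ssubset (Finset.erase_ssubset hi)
      obtain ⟨q, b, F, hq, hF, hFσ⟩ := ih A' hsub
      have hFi : ∀ f ∈ F, f i = ω i ∧ f j = ω j := fun f hf => by
        obtain ⟨σ, hσ, rfl⟩ := hFσ f hf
        exact ⟨congrArg ω (hσ i (by simp [hA'])), congrArg ω (hσ j (by simp [hA']))⟩
      let s : (Fin n → ℤ) → (Fin n → ℤ) := fun f => f ∘ Equiv.swap i j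
      have hs : Function.Injective s := fun f g h => by
        funext x
        have := congrFun h (Equiv.swap i j x)
        simpa [s] using this
      refine ⟨q + 1, b, F ∪ F.image s, ?_, ?_, ?_⟩
      · have : A.filter (fun i => ω i ≠ b) ⊆ insert i (insert j (A'.filter fun i => ω i ≠ b)) := by
          intro x hx
          rw [Finset.mem_filter] at hx
          simp only [Finset.mem_insert, Finset.mem_filter, hA', Finset.mem_erase]
          by_cases h1 : x = i
          · exact Or.inl h1
          · by_cases h2 : x = j
            · exact Or.inr (Or.inl h2)
            · exact Or.inr (Or.inr ⟨⟨h2, h1, hx.1⟩, hx.2⟩)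
        have h3 := Finset.card_le_card this
        have h4 := Finset.card_insert_le i (insert j (A'.filter fun i => ω i ≠ b))
        have h5 := Finset.card_insert_le j (A'.filter fun i => ω i ≠ b)
        omega
      · rw [Finset.card_union_of_disjoint, Finset.card_image_of_injective _ hs, pow_succ]
        · omega
        · rw [Finset.disjoint_left]
          intro f hf hf'
          obtain ⟨g, hg, rfl⟩ := Finset.mem_image.mp hf'
          have h1 := (hFi _ hf).1
          simp only [s, Function.comp_apply, Equiv.swap_apply_left, (hFi g hg).2] at h1
          exact hji h1
      · intro f hf
        rcases Finset.mem_union.mp hf with hf | hf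
        · obtain ⟨σ, hσ, rfl⟩ := hFσ f hf
          exact ⟨σ, fun x hx => hσ x fun h => hx (hsub.1 h), rfl⟩
        · obtain ⟨g, hg, rfl⟩ := Finset.mem_image.mp hf
          obtain ⟨σ, hσ, rfl⟩ := hFσ g hg
          refine ⟨σ * Equiv.swap i j, fun x hx => ?_, rfl⟩
          have hxi : x ≠ i := by rintro rfl; exact hx hi
          have hxj : x ≠ j := by rintro rfl; exact hx hj
          rw [Equiv.Perm.mul_apply, Equiv.swap_apply_of_ne_of_ne hxi hxj]
          exact hσ x fun h => hx (hsub.1 h)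

variable {P : Finset (Fin n → ℤ)} (hperm : ∀ ω ∈ P, ∀ σ : Equiv.Perm (Fin n), ω ∘ σ ∈ P)
include hperm

theorem exists_mode {q : ℕ} (hq : P.card < 2 ^ (q + 1)) {ω : Fin n → ℤ} (hω : ω ∈ P) :
    ∃ b : ℤ, (Finset.univ.filter fun i => ω i ≠ b).card ≤ 2 * q := by
  obtain ⟨q', b, F, h1, h2, h3⟩ := exists_mode_of_orbit ω Finset.univ
  refine ⟨b, h1.trans ?_⟩
  have hF : F ⊆ P := fun f hf => by
    obtain ⟨σ, -, rfl⟩ := h3 f hf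
    exact hperm ω hω σ
  have h4 : 2 ^ q' < 2 ^ (q + 1) := (h2.trans (Finset.card_le_card hF)).trans_lt hq
  have := (Nat.pow_lt_pow_iff_right (by norm_num : 1 < 2)).mp h4
  omega

variable (hstring : ∀ ω ∈ P, ∀ i j, ω j < ω i → ω - rootVec i j ∈ P)
include hstring

/-- As long as some coordinate is off `b` by at least two, a root step passes one unit of its
deviation to a coordinate equal to `b`. The total deviation stays the same while one more coordinate
differs from `b`, and at most `2 * q` may differ, so the process stops. -/
theorem exists_spread_weight {q : ℕ} (hq : P.card < 2 ^ (q + 1)) (hn : 4 * q + 1 < n) (b : ℤ)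
    {ω : Fin n → ℤ} (hω : ω ∈ P) (hb : (Finset.univ.filter fun i => ω i ≠ b).card ≤ 2 * q) :
    ∃ ω' ∈ P, (Finset.univ.filter fun i => ω' i ≠ b).card ≤ 2 * q ∧
      ∑ i, |ω' i - b| = ∑ i, |ω i - b| ∧ ∀ i, |ω' i - b| ≤ 1 := by
  classical
  induction hm : 2 * q - (Finset.univ.filter fun i => ω i ≠ b).card using
    Nat.strong_induction_on generalizing ω with
  | _ m ih =>
    by_cases hall : ∀ i, |ω i - b| ≤ 1
    · exact ⟨ω, hω, hb, rfl, hall⟩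
    push Not at hall
    obtain ⟨i, hi⟩ := hall
    have hj : ∃ j, ω j = b := by
      by_contra hcon
      push Not at hcon
      rw [Finset.filter_true_of_mem (fun j _ => hcon j), Finset.card_univ, Fintype.card_fin] at hb
      omega
    obtain ⟨j, hj⟩ := hj
    have hij : i ≠ j := by rintro rfl; simp [hj] at hi
    have step : ∃ ω' ∈ P, (∀ k, k ≠ i → k ≠ j → ω' k = ω k) ∧ ω' j ≠ b ∧ ω' i ≠ b ∧
        |ω' j - b| = |ω j - b| + 1 ∧ |ω' i - b| = |ω i - b| - 1 := by
      rcases lt_or_ge b (ω i) with hlt | hge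
      · refine ⟨_, hstring ω hω i j (by omega), ?_, ?_, ?_, ?_, ?_⟩
        · intro k hk1 hk2; simp [rootVec, hk1, hk2]
        all_goals simp [rootVec, hij, hij.symm, hj]
        · rw [abs_of_pos (by omega)] at hi; omega
        · rw [abs_of_pos (by omega)] at hi
          rw [abs_of_pos (by omega), abs_of_pos (by omega)]; omega
      · have hne : ω i ≠ b := by intro h; simp [h] at hi
        refine ⟨_, hstring ω hω j i (by omega), ?_, ?_, ?_, ?_, ?_⟩
        · intro k hk1 hk2; simp [rootVec, hk1, hk2]
        all_goals simp [rootVec, hij, hij.symm, hj]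
        · rw [abs_of_neg (by omega)] at hi; omega
        · rw [abs_of_neg (by omega)] at hi
          rw [abs_of_neg (by omega), abs_of_neg (by omega)]; omega
    obtain ⟨ω', hω'P, hother, hj', hi', hja, hia⟩ := step
    have hωi : ω i ≠ b := by intro h; simp [h] at hi
    have hset : (Finset.univ.filter fun k => ω' k ≠ b) =
        insert j (Finset.univ.filter fun k => ω k ≠ b) := by
      ext k
      simp only [Finset.mem_filter, Finset.mem_univ, true_and, Finset.mem_insert]
      by_cases h1 : k = j
      · subst h1; simp [hj']
      · by_cases h2 : k = i
        · subst h2; simp [hi', hωi]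
        · simp [h1, hother k h2 h1]
    have hcard : (Finset.univ.filter fun k => ω' k ≠ b).card =
        (Finset.univ.filter fun k => ω k ≠ b).card + 1 := by
      rw [hset, Finset.card_insert_of_notMem (by simp [hj])]
    -- The new weight also has a dominant value. Were it different from `b`, the at least `n - 2 * q
    -- - 1` coordinates equal to `b` would be among at most `2 * q` exceptions, against `4 * q + 1 <
    -- n`.
    have hle : (Finset.univ.filter fun k => ω' k ≠ b).card ≤ 2 * q := by
      obtain ⟨b', hb'⟩ := exists_mode hperm hq hω'P
      by_cases hbb : b' = b
      · rwa [hbb] at hb'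
      · exfalso
        have h1 : (Finset.univ.filter fun k => ω' k = b) ⊆
            Finset.univ.filter fun k => ω' k ≠ b' := by
          intro k hk
          simp only [Finset.mem_filter, Finset.mem_univ, true_and] at hk ⊢
          rw [hk]; exact Ne.symm hbb
        have h2 := Finset.card_le_card h1
        have h3 := Finset.card_filter_add_card_filter_not (s := Finset.univ) (fun k => ω' k = b)
        rw [Finset.card_univ, Fintype.card_fin] at h3
        simp only [ne_eq] at hcard hb h2 h3 hb'
        omega
    have hsum : ∑ k, |ω' k - b| = ∑ k, |ω k - b| := by
      have : ∀ k, |ω' k - b| = |ω k - b| + ((if k = j then 1 else 0) - if k = i then 1 else 0) := by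
        intro k
        by_cases h1 : k = j
        · subst h1; simp [hja, hij.symm]
        · by_cases h2 : k = i
          · subst h2; rw [hia, if_neg hij, if_pos rfl]; ring
          · simp [h1, h2, hother k h2 h1]
      simp only [this, Finset.sum_add_distrib, Finset.sum_sub_distrib, Finset.sum_ite_eq',
        Finset.mem_univ, if_true]
      ring
    obtain ⟨ω'', h1, h2, h3, h4⟩ := ih _ (by omega) hω'P hle rfl
    exact ⟨ω'', h1, h2, h3.trans hsum, h4⟩

/-- The weights of a small weight set are close to a constant, and the set is large if some weight
is not. -/
theorem exists_const_near_weight {q : ℕ} (hq : P.card < 2 ^ (q + 1)) (hn : 4 * q + 1 < n)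
    {ω : Fin n → ℤ} (hω : ω ∈ P) : ∃ b : ℤ, ∑ i, (ω i - b).natAbs ≤ 2 * q ∧
      n.choose (∑ i, (ω i - b).natAbs) ≤ P.card := by
  classical
  obtain ⟨b, hb⟩ := exists_mode hperm hq hω
  obtain ⟨ω', hω', hcard, hsum, hone⟩ := exists_spread_weight hperm hstring hq hn b hω hb
  set s := Finset.univ.filter fun i => ω' i ≠ b with hs
  have hK : ∑ i, (ω i - b).natAbs = s.card := by
    have h1 : ∑ i, |ω' i - b| = s.card := by
      rw [hs, Finset.card_filter]
      push_cast
      refine Finset.sum_congr rfl fun i _ => ?_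
      have := hone i
      split_ifs with h
      · have : 0 < |ω' i - b| := abs_pos.mpr (sub_ne_zero.mpr h)
        omega
      · push Not at h; simp [h]
    have h2 : ((∑ i, (ω i - b).natAbs : ℕ) : ℤ) = ∑ i, |ω i - b| := by
      push_cast
      rfl
    rw [hsum.symm, h1] at h2
    exact_mod_cast h2
  refine ⟨b, hK ▸ hcard, ?_⟩
  rw [hK]
  -- Deviations of `ω'` have size at most one, so `s.card` is the total deviation; permuting `ω'`
  -- moves its exceptional set `s` to every set of that size.
  have hsub : Finset.powersetCard s.card Finset.univ ⊆
      P.image fun f => Finset.univ.filter fun i => f i ≠ b := by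
    intro t ht
    have htc := (Finset.mem_powersetCard.mp ht).2
    let e : {x // x ∈ t} ≃ {x // x ∈ s} := Fintype.equivOfCardEq (by simp [htc])
    refine Finset.mem_image.mpr ⟨ω' ∘ e.extendSubtype, hperm _ hω' _, ?_⟩
    ext x
    simp only [Finset.mem_filter, Finset.mem_univ, true_and, Function.comp_apply]
    have key : ∀ y, y ∈ s ↔ ω' y ≠ b := fun y => by simp [hs]
    rw [← key]
    constructor
    · intro h
      by_contra hx
      exact e.extendSubtype_not_mem x hx h
    · exact fun h => e.extendSubtype_mem x h
  have := (Finset.card_le_card hsub).trans Finset.card_image_le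
  rwa [Finset.card_powersetCard, Finset.card_univ, Fintype.card_fin] at this

end WeightSets

/-! ### Diagonalization of unitary matrices -/

section Diagonalization

variable {n : ℕ}

theorem exists_circle_not_root (p : Polynomial ℂ) (hp : p ≠ 0) :
    ∃ z : Circle, p.eval (z : ℂ) ≠ 0 := by
  obtain ⟨x, ⟨m, rfl⟩, hx⟩ := (Set.infinite_range_of_injective
    circle_exp_one_zpow_injective).exists_notMem_finset p.roots.toFinset
  refine ⟨Circle.exp 1 ^ m, fun h => hx ?_⟩
  rw [Multiset.mem_toFinset, Polynomial.mem_roots hp, Polynomial.IsRoot.def]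
  simpa using h

/-- The Cayley transform `H` of `w` is Hermitian, and an eigenbasis of `H` diagonalizes `w`: the
relation `(D + i) W = D - i` with `D` real and diagonal makes `W` diagonal. -/
theorem unitary_diagonalizable_of_isUnit {w : UnitaryGrp n} (hw : IsUnit (1 - w.1)) :
    ∃ (v : UnitaryGrp n) (t : Fin n → Circle), w = v * diagU n t * v⁻¹ := by
  set B := 1 - w.1 with hB
  have hww : star w.1 * w.1 = 1 := Matrix.UnitaryGroup.star_mul_self w
  have hww' : w.1.conjTranspose * w.1 = 1 := hww
  have hBdet : IsUnit B.det := (Matrix.isUnit_iff_isUnit_det B).mp hw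
  set H := Complex.I • ((1 + w.1) * B⁻¹) with hH
  have hHB : H * B = Complex.I • (1 + w.1) := by
    rw [hH, smul_mul_assoc, mul_assoc, Matrix.nonsing_inv_mul _ hBdet, mul_one]
  have hherm : H.IsHermitian := by
    have hBs : IsUnit B.conjTranspose := by
      rw [← Matrix.star_eq_conjTranspose]; exact hw.star
    have e : B.conjTranspose * H.conjTranspose * B = B.conjTranspose * H * B := by
      rw [← Matrix.conjTranspose_mul, mul_assoc, hHB, hB]
      simp only [Matrix.conjTranspose_smul, Matrix.conjTranspose_add, Matrix.conjTranspose_sub,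
        Matrix.conjTranspose_one, RCLike.star_def, Complex.conj_I, smul_mul_assoc, mul_smul_comm,
        add_mul, mul_sub, mul_add, sub_mul, one_mul, mul_one, hww']
      module
    exact hBs.mul_left_cancel (hw.mul_right_cancel e)
  have hHw : (H + Complex.I • 1) * w.1 = H - Complex.I • 1 := by
    have : H - H * w.1 = Complex.I • (1 + w.1) := by rw [← hHB, hB, mul_sub, mul_one]
    have h2 : H * w.1 = H - Complex.I • (1 + w.1) := by rw [← this]; abel
    rw [add_mul, h2, smul_mul_assoc Complex.I (1 : Matrix (Fin n) (Fin n) ℂ), one_mul]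
    module
  set v := hherm.eigenvectorUnitary with hv
  have hspec := hherm.spectral_theorem
  rw [Unitary.conjStarAlgAut_apply] at hspec
  set D : Matrix (Fin n) (Fin n) ℂ := Matrix.diagonal (RCLike.ofReal ∘ hherm.eigenvalues) with hD
  have hvv : star v.1 * v.1 = 1 := Matrix.UnitaryGroup.star_mul_self v
  have hvv' : v.1 * star v.1 = 1 := mul_eq_one_comm.mp hvv
  set W : UnitaryGrp n := v⁻¹ * w * v with hW
  have hWval : W.1 = star v.1 * w.1 * v.1 := rfl
  have hDW : (D + Complex.I • 1) * W.1 = D - Complex.I • 1 := by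
    have hvH : star v.1 * H = D * star v.1 := by
      rw [hspec, ← mul_assoc, ← mul_assoc, hvv, one_mul]
    have hvH2 : star v.1 * H * v.1 = D := by rw [hvH, mul_assoc, hvv, mul_one]
    have h1 : (D + Complex.I • 1) * star v.1 = star v.1 * (H + Complex.I • 1) := by
      rw [add_mul, mul_add, hvH]; simp
    rw [hWval, ← mul_assoc, ← mul_assoc, h1, mul_assoc (star v.1), hHw, mul_sub, sub_mul, hvH2]
    simp [hvv]
  have hoff : ∀ i j, i ≠ j → W i j = 0 := fun i j hij => by
    have := congrFun (congrFun hDW i) j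
    rw [hD, add_mul, Matrix.add_apply, Matrix.diagonal_mul] at this
    simp [hij, Matrix.diagonal_apply_ne] at this
    rw [← add_mul] at this
    rcases mul_eq_zero.mp this with h | h
    · have := congrArg Complex.im h
      simp at this
    · exact h
  have hnorm : ∀ i, ‖W i i‖ = 1 := fun i => by
    have := sum_norm_sq_col W i
    rw [Finset.sum_eq_single i] at this
    · nlinarith [norm_nonneg (W i i)]
    · intro j _ hj; simp [hoff j i hj]
    · simp
  obtain ⟨t, ht⟩ : ∃ t : Fin n → Circle, ∀ i, (t i : ℂ) = W i i :=
    ⟨fun i => ⟨W i i, by simp [Submonoid.unitSphere, hnorm]⟩, fun _ => rfl⟩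
  refine ⟨v, t, ?_⟩
  have : diagU n t = W := by
    refine Matrix.UnitaryGroup.ext _ _ fun i j => ?_
    rw [diagU_apply]
    split_ifs with h
    · subst h; exact ht i
    · exact (hoff i j h).symm
  rw [this, hW]
  group

theorem diagU_const_comm (z : Circle) (u : UnitaryGrp n) :
    diagU n (fun _ => z) * u = u * diagU n (fun _ => z) := by
  refine Matrix.UnitaryGroup.ext _ _ fun i j => ?_
  rw [diagU_mul_apply, mul_diagU_apply, mul_comm]

/-- Dividing by a scalar of modulus one that is not an eigenvalue makes the Cayley transform
available; scalars are central and diagonal, so this is undone at the end. -/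
theorem unitary_diagonalizable (u : UnitaryGrp n) :
    ∃ (v : UnitaryGrp n) (t : Fin n → Circle), u = v * diagU n t * v⁻¹ := by
  obtain ⟨z, hz⟩ := exists_circle_not_root u.1.charpoly (Matrix.charpoly_monic _).ne_zero
  rw [Matrix.eval_charpoly] at hz
  set c : UnitaryGrp n := diagU n fun _ => z⁻¹ with hc
  have hcv : c.1 = (z : ℂ)⁻¹ • (1 : Matrix (Fin n) (Fin n) ℂ) := by
    ext i j
    rw [hc, diagU_apply, Matrix.smul_apply, Matrix.one_apply]
    simp
  have hunit : IsUnit (1 - (c * u).1) := by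
    rw [Matrix.isUnit_iff_isUnit_det, isUnit_iff_ne_zero]
    intro h0
    apply hz
    have : Matrix.scalar (Fin n) (z : ℂ) - u.1 = (z : ℂ) • (1 - (c * u).1) := by
      change _ = (z : ℂ) • (1 - c.1 * u.1)
      rw [hcv, smul_mul_assoc, one_mul, smul_sub, smul_smul,
        mul_inv_cancel₀ (Circle.coe_ne_zero z), one_smul, Matrix.smul_one_eq_diagonal]
      rfl
    rw [this, Matrix.det_smul, h0, mul_zero]
  obtain ⟨v, t, h⟩ := unitary_diagonalizable_of_isUnit hunit
  refine ⟨v, (fun _ => z) * t, ?_⟩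
  have h1 : (diagU n fun _ => z) * c = 1 := by
    rw [hc, ← map_mul]
    convert map_one (diagU n) using 2
    funext i; simp
  rw [map_mul, ← mul_assoc v, ← diagU_const_comm z v, mul_assoc, mul_assoc, ← mul_assoc v, ← h,
    ← mul_assoc, h1, one_mul]

end Diagonalization

/-! ### Class functions as polynomial functions -/

section ClassFunctions

variable {n : ℕ}

/-- The power sums of the eigenvalues. -/
noncomputable def powTrace (j : ℤ) (u : UnitaryGrp n) : ℂ := (u ^ j).1.trace

theorem powTrace_conj (j : ℤ) (u v : UnitaryGrp n) : powTrace j (v * u * v⁻¹) = powTrace j u := by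
  rw [powTrace, conj_zpow]
  change (v.1 * (u ^ j).1 * star v.1).trace = _
  rw [Matrix.trace_mul_cycle, Matrix.UnitaryGroup.star_mul_self, one_mul]
  rfl

theorem powTrace_diagU (j : ℤ) (t : Fin n → Circle) :
    powTrace j (diagU n t) = ∑ i, (t i : ℂ) ^ j := by
  rw [powTrace, ← map_zpow, Matrix.trace]
  refine Finset.sum_congr rfl fun i _ => ?_
  rw [Matrix.diag_apply]
  change diagU n (t ^ j) i i = _
  rw [diagU_apply, if_pos rfl]
  simp

theorem pow_entry_mem_polyDeg (m : ℕ) (i j : Fin n) : (fun u => (u ^ m) i j) ∈ polyDeg n m := by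
  induction m generalizing j with
  | zero => simpa using polyDeg_const_mem 0 _
  | succ m ih =>
    have : (fun u : UnitaryGrp n => (u ^ (m + 1)) i j) =
        ∑ c, (fun u : UnitaryGrp n => (u ^ m) i c) * entryOrConj (true, c, j) := by
      funext u
      rw [pow_succ]
      change ((u ^ m).1 * u.1) i j = _
      rw [Matrix.mul_apply, Finset.sum_apply]
      rfl
    rw [this]
    exact Submodule.sum_mem _ fun c _ => polyDeg_mul_mem (ih c) (entryOrConj_mem_polyDeg _)

theorem inv_pow_entry_mem_polyDeg (m : ℕ) (i j : Fin n) :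
    (fun u => ((u⁻¹) ^ m) i j) ∈ polyDeg n m := by
  induction m generalizing j with
  | zero => simpa using polyDeg_const_mem 0 _
  | succ m ih =>
    have : (fun u : UnitaryGrp n => ((u⁻¹) ^ (m + 1)) i j) =
        ∑ c, (fun u : UnitaryGrp n => ((u⁻¹) ^ m) i c) * entryOrConj (false, j, c) := by
      funext u
      rw [pow_succ]
      change (((u⁻¹) ^ m).1 * (u⁻¹).1) i j = _
      rw [Matrix.mul_apply, Finset.sum_apply]
      rfl
    rw [this]
    exact Submodule.sum_mem _ fun c _ => polyDeg_mul_mem (ih c) (entryOrConj_mem_polyDeg _)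

theorem powTrace_mem_polyDeg (j : ℤ) : powTrace (n := n) j ∈ polyDeg n j.natAbs := by
  have key : powTrace (n := n) j = ∑ i, fun u : UnitaryGrp n => (u ^ j) i i := by
    funext u
    rw [Finset.sum_apply]
    rfl
  rw [key]
  refine Submodule.sum_mem _ fun i _ => ?_
  rcases Int.natAbs_eq j with h | h
  · rw [h]
    simpa only [zpow_natCast, Int.natAbs_natCast] using pow_entry_mem_polyDeg j.natAbs i i
  · rw [h]
    simpa only [zpow_neg, zpow_natCast, Int.natAbs_neg, Int.natAbs_natCast, inv_pow] using
      inv_pow_entry_mem_polyDeg j.natAbs i i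

/-- The sum of the monomials with exponents `ω` over injective choices of eigenvalues, as a class
function. -/
noncomputable def injSum : (s : ℕ) → (Fin s → ℤ) → UnitaryGrp n → ℂ
  | 0, _ => fun _ => 1
  -- The product with a power sum lets the new index range freely; the subtracted terms are its
  -- coincidences with an earlier index, where two exponents merge.
  | s + 1, ω => powTrace (ω 0) * injSum s (Fin.tail ω) -
      ∑ q, injSum s (Function.update (Fin.tail ω) q (Fin.tail ω q + ω 0))

theorem injSum_conj (s : ℕ) (ω : Fin s → ℤ) (u v : UnitaryGrp n) :
    injSum s ω (v * u * v⁻¹) = injSum s ω u := by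
  induction s with
  | zero => rfl
  | succ s ih => simp [injSum, ih, powTrace_conj]

/-- Merging exponents does not increase the sum of their absolute values, so the degree bound
survives the recursion. -/
theorem injSum_mem_polyDeg (s : ℕ) (ω : Fin s → ℤ) :
    injSum (n := n) s ω ∈ polyDeg n (∑ i, (ω i).natAbs) := by
  induction s with
  | zero => exact polyDeg_const_mem _ _
  | succ s ih =>
    rw [injSum, Fin.sum_univ_succ]
    refine Submodule.sub_mem _ (polyDeg_mul_mem (powTrace_mem_polyDeg _) (ih _))
      (Submodule.sum_mem _ fun q _ => polyDeg_mono ?_ (ih _))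
    have h1 : ∑ i, (Function.update (Fin.tail ω) q (Fin.tail ω q + ω 0) i).natAbs ≤
        ∑ i, ((Fin.tail ω i).natAbs + if i = q then (ω 0).natAbs else 0) := by
      refine Finset.sum_le_sum fun i _ => ?_
      by_cases h : i = q
      · subst h; simp [Int.natAbs_add_le]
      · simp [h]
    refine h1.trans ?_
    rw [Finset.sum_add_distrib, Finset.sum_ite_eq' Finset.univ q]
    simp only [Finset.mem_univ, if_true]
    rw [add_comm]
    rfl

theorem injSum_diagU (s : ℕ) (ω : Fin s → ℤ) (t : Fin n → Circle) :
    injSum s ω (diagU n t) = ∑ f : Fin s → Fin n,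
      if Function.Injective f then ∏ q, (t (f q) : ℂ) ^ ω q else 0 := by
  classical
  induction s with
  | zero => simp [injSum, Function.injective_of_subsingleton]
  | succ s ih =>
    rw [← (Fin.consEquiv fun _ => Fin n).sum_comp, Fintype.sum_prod_type, Finset.sum_comm]
    simp only [injSum, Pi.sub_apply, Pi.mul_apply, Finset.sum_apply, ih, powTrace_diagU]
    rw [Finset.mul_sum, Finset.sum_comm, ← Finset.sum_sub_distrib]
    refine Finset.sum_congr rfl fun f _ => ?_
    have hc : ∀ x, (Fin.consEquiv fun _ => Fin n) (x, f) = Fin.cons x f := fun _ => rfl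
    have hinj : ∀ x, Function.Injective ((Fin.consEquiv fun _ => Fin n) (x, f)) ↔
        x ∉ Set.range f ∧ Function.Injective f := fun x => by
      rw [hc]; exact Fin.cons_injective_iff
    simp only [hinj]
    simp only [Fin.consEquiv_apply, Fin.prod_univ_succ, Fin.cons_zero, Fin.cons_succ]
    by_cases hf : Function.Injective f
    · simp only [hf, if_true, and_true]
      have h1 : ∀ q, ∏ x, (t (f x) : ℂ) ^ Function.update (Fin.tail ω) q (Fin.tail ω q + ω 0) x =
          (t (f q) : ℂ) ^ ω 0 * ∏ x, (t (f x) : ℂ) ^ Fin.tail ω x := fun q => by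
        rw [← Finset.mul_prod_erase Finset.univ _ (Finset.mem_univ q),
          ← Finset.mul_prod_erase Finset.univ (fun x => (t (f x) : ℂ) ^ Fin.tail ω x)
            (Finset.mem_univ q), Function.update_self, zpow_add₀ (Circle.coe_ne_zero _),
          ← mul_assoc, mul_comm ((t (f q) : ℂ) ^ ω 0)]
        congr 1
        refine Finset.prod_congr rfl fun x hx => ?_
        rw [Function.update_of_ne (Finset.ne_of_mem_erase hx)]
      have h2 : ∑ x, (if x ∉ Set.range f then (t x : ℂ) ^ ω 0 * ∏ x, (t (f x) : ℂ) ^ ω x.succ else 0) =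
          (∑ x, (t x : ℂ) ^ ω 0 - ∑ q, (t (f q) : ℂ) ^ ω 0) *
            ∏ x, (t (f x) : ℂ) ^ Fin.tail ω x := by
        have h3 : ∑ q, (t (f q) : ℂ) ^ ω 0 = ∑ x, if x ∈ Set.range f then (t x : ℂ) ^ ω 0 else 0 := by
          rw [← Finset.sum_filter, ← Finset.sum_image (f := fun x => (t x : ℂ) ^ ω 0) (g := f)
            (s := Finset.univ) hf.injOn]
          congr 1
          ext x; simp
        rw [h3, ← Finset.sum_sub_distrib, Finset.sum_mul]
        refine Finset.sum_congr rfl fun x _ => ?_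
        by_cases hx : x ∈ Set.range f
        · simp [hx]
        · simp only [hx, not_false_iff, if_true, if_false, sub_zero]; rfl
      rw [h2, sub_mul, Finset.sum_mul]
      simp only [h1, Finset.sum_mul]
    · simp [hf]

theorem injSum_self_diagU (ω : Fin n → ℤ) (t : Fin n → Circle) :
    injSum n ω (diagU n t) = ∑ σ : Equiv.Perm (Fin n), torusChar ω (t ∘ σ) := by
  classical
  rw [injSum_diagU, ← Finset.sum_filter]
  symm
  refine Finset.sum_bij (fun σ _ => (σ : Fin n → Fin n)) (fun σ _ => ?_) (fun σ _ τ _ h => ?_)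
    (fun f hf => ?_) fun σ _ => rfl
  · simp [σ.injective]
  · exact DFunLike.coe_injective h
  · have hinj : Function.Injective f := (Finset.mem_filter.mp hf).2
    exact ⟨Equiv.ofBijective f (Finite.injective_iff_bijective.mp hinj), Finset.mem_univ _, rfl⟩

/-- A class function with weights of size at most `K` is a polynomial function of degree at most
`K`. -/
theorem classFun_mem_polyDeg {χ : UnitaryGrp n → ℂ} (hχ : ∀ u v, χ (v * u * v⁻¹) = χ u)
    (P : Finset (Fin n → ℤ)) (m : (Fin n → ℤ) → ℂ)
    (hexp : ∀ t, χ (diagU n t) = ∑ ω ∈ P, m ω * torusChar ω t) {K : ℕ}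
    (hK : ∀ ω ∈ P, ∑ i, (ω i).natAbs ≤ K) : χ ∈ polyDeg n K := by
  have hfac : ((n.factorial : ℕ) : ℂ) ≠ 0 := by exact_mod_cast n.factorial_ne_zero
  -- Both sides are class functions, so they need only agree on the torus. There `χ` is symmetric
  -- and equals its average over permutations, which turns each character into an `injSum`.
  have key : χ = ((n.factorial : ℂ)⁻¹) • ∑ ω ∈ P, m ω • injSum n ω := by
    funext u
    obtain ⟨v, t, rfl⟩ := unitary_diagonalizable u
    simp only [hχ, Pi.smul_apply, Finset.sum_apply, injSum_conj, injSum_self_diagU, smul_eq_mul]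
    have hσ : ∀ σ : Equiv.Perm (Fin n), χ (diagU n (t ∘ σ)) = χ (diagU n t) := fun σ => by
      have h := diagU_mul_permU t σ.symm
      rw [Equiv.symm_symm] at h
      have h2 : diagU n (t ∘ σ) = (permU σ.symm)⁻¹ * diagU n t * ((permU σ.symm)⁻¹)⁻¹ := by
        rw [inv_inv, mul_assoc, h, inv_mul_cancel_left]
      rw [h2, hχ]
    rw [eq_inv_mul_iff_mul_eq₀ hfac]
    calc (n.factorial : ℂ) * χ (diagU n t) = ∑ σ : Equiv.Perm (Fin n), χ (diagU n (t ∘ σ)) := by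
          simp [hσ, Fintype.card_perm]
      _ = _ := by
          simp only [hexp, Finset.mul_sum]
          rw [Finset.sum_comm]
  rw [key]
  exact Submodule.smul_mem _ _ (Submodule.sum_mem _ fun ω hω => Submodule.smul_mem _ _
    (polyDeg_mono (hK ω hω) (injSum_mem_polyDeg n ω)))

end ClassFunctions

/-! ### Mixed tensor powers of the standard representation -/

section TensorPower

variable {n k : ℕ}

/-- The tensor product of copies of the standard representation and of its conjugate. -/
noncomputable def tensorRep (e : Fin k → Bool) (u : UnitaryGrp n) :
    Matrix (Fin k → Fin n) (Fin k → Fin n) ℂ :=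
  Matrix.of fun X Y => ∏ q, entryOrConj (e q, X q, Y q) u

theorem tensorRep_mul (e : Fin k → Bool) (u v : UnitaryGrp n) :
    tensorRep e (u * v) = tensorRep e u * tensorRep e v := by
  ext X Y
  simp only [tensorRep, Matrix.of_apply, Matrix.mul_apply, entryOrConj_mul,
    Finset.prod_univ_sum, Fintype.piFinset_univ, Finset.prod_mul_distrib]

theorem tensorRep_conjTranspose (e : Fin k → Bool) (u : UnitaryGrp n) :
    (tensorRep e u).conjTranspose = tensorRep e u⁻¹ := by
  ext X Y
  simp only [tensorRep, Matrix.conjTranspose_apply, Matrix.of_apply, star_prod]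
  refine Finset.prod_congr rfl fun q _ => ?_
  cases h : e q <;> simp [entryOrConj, unitary_inv_apply]

theorem norm_tensorRep_apply (e : Fin k → Bool) (u : UnitaryGrp n) (X Y : Fin k → Fin n) :
    ‖tensorRep e u X Y‖ = ∏ q, ‖u (X q) (Y q)‖ := by
  simp only [tensorRep, Matrix.of_apply, norm_prod]
  refine Finset.prod_congr rfl fun q _ => ?_
  cases h : e q <;> simp [entryOrConj]

theorem continuous_tensorRep_apply (e : Fin k → Bool) (X Y : Fin k → Fin n) :
    Continuous fun u => tensorRep e u X Y := by
  simp only [tensorRep, Matrix.of_apply]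
  exact continuous_finsetProd _ fun _ _ => continuous_entryOrConj _

theorem tensorRep_signU (e : Fin k → Bool) (v : Fin n) :
    tensorRep e (signU v) = Matrix.diagonal fun X => ∏ q, if X q = v then (-1 : ℂ) else 1 := by
  ext X Y
  have h1 : ∀ q, entryOrConj (e q, X q, Y q) (signU v) =
      if X q = Y q then (if X q = v then (-1 : ℂ) else 1) else 0 := fun q => by
    simp only [entryOrConj, signU, diagU_apply, mulSingle_neg_one_coe]
    split_ifs <;> simp
  rw [Matrix.diagonal_apply, tensorRep, Matrix.of_apply]
  simp only [h1]
  split_ifs with h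
  · subst h; simp
  · obtain ⟨q, hq⟩ := Function.ne_iff.mp h
    exact Finset.prod_eq_zero (Finset.mem_univ q) (if_neg hq)

theorem unitaryMonomial_eq_tensorRep (l : List (Bool × Fin n × Fin n)) (u : UnitaryGrp n) :
    unitaryMonomial l u = tensorRep (fun q => (l.get q).1) u (fun q => (l.get q).2.1)
      (fun q => (l.get q).2.2) := by
  simp only [tensorRep, Matrix.of_apply, unitaryMonomial]
  rw [← Fin.prod_univ_fun_getElem]
  rfl

end TensorPower

/-! ### Irreducible matrix representations -/

section Irreducible

variable {n d : ℕ} {M : UnitaryGrp n →* Matrix (Fin d) (Fin d) ℂ}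

/-- Irreducibility of a matrix representation. -/
def MatrixIrreducible (M : UnitaryGrp n →* Matrix (Fin d) (Fin d) ℂ) : Prop :=
  ∀ W : Submodule ℂ (Fin d → ℂ), (∀ g, ∀ v ∈ W, (M g).mulVec v ∈ W) → W = ⊥ ∨ W = ⊤

theorem exists_mulVec_ne_zero {m : Type*} {A : Matrix m (Fin d) ℂ} (hA : A ≠ 0) :
    ∃ v, A.mulVec v ≠ 0 := by
  by_contra! h
  refine hA (Matrix.ext_of_mulVec_single fun i => ?_)
  rw [h, Matrix.zero_mulVec]

theorem prod_zpow_eq_zpow_sum {ι : Type*} [Fintype ι] {z : ℂ} (hz : z ≠ 0) (f : ι → ℤ) :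
    ∏ i, z ^ f i = z ^ ∑ i, f i := by
  classical
  refine Finset.induction_on Finset.univ (by simp) fun i s hi ih => ?_
  rw [Finset.prod_insert hi, Finset.sum_insert hi, ih, zpow_add₀ hz]

/-- Scalar matrices are central, so the subspace on which they act with a given exponent is
invariant, hence everything once nonzero; on a weight space that exponent is the sum of the weight.
-/
theorem weight_sum_eq (hM : ∀ a b, Continuous fun u => M u a b) (hirr : MatrixIrreducible M)
    {ω ω' : Fin n → ℤ} (hω : weightProj M ω ≠ 0) (hω' : weightProj M ω' ≠ 0) :
    ∑ i, ω' i = ∑ i, ω i := by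
  have hchar : ∀ (η : Fin n → ℤ) (z : Circle) (v : Fin d → ℂ),
      (M (diagU n fun _ => z)).mulVec ((weightProj M η).mulVec v) =
        ((z : ℂ) ^ ∑ i, η i) • (weightProj M η).mulVec v := fun η z v => by
    rw [Matrix.mulVec_mulVec, diagU_mul_weightProj hM, Matrix.smul_mulVec, torusChar_apply]
    congr 1
    exact prod_zpow_eq_zpow_sum (Circle.coe_ne_zero z) _
  let W : Submodule ℂ (Fin d → ℂ) :=
    { carrier := {v | ∀ z : Circle, (M (diagU n fun _ => z)).mulVec v = ((z : ℂ) ^ ∑ i, ω i) • v}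
      zero_mem' := fun z => by simp
      add_mem' := fun {v w} hv hw z => by rw [Matrix.mulVec_add, hv z, hw z, smul_add]
      smul_mem' := fun c v hv z => by rw [Matrix.mulVec_smul, hv z, smul_comm] }
  have hW : W = ⊥ ∨ W = ⊤ := hirr W fun g v hv z => by
    rw [Matrix.mulVec_mulVec, ← map_mul, diagU_const_comm, map_mul, ← Matrix.mulVec_mulVec, hv z,
      Matrix.mulVec_smul]
  rcases hW with h | h
  · obtain ⟨v, hv⟩ := exists_mulVec_ne_zero hω
    have hmem : (weightProj M ω).mulVec v ∈ W := fun z => hchar ω z v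
    rw [h, Submodule.mem_bot] at hmem
    exact absurd hmem hv
  · obtain ⟨v, hv⟩ := exists_mulVec_ne_zero hω'
    have hmem : (weightProj M ω').mulVec v ∈ W := h ▸ Submodule.mem_top
    have h1 := (hchar ω' (Circle.exp 1) v).symm.trans (hmem (Circle.exp 1))
    exact circle_exp_one_zpow_injective (smul_left_injective ℂ hv h1)

theorem trace_rep_conj (u v : UnitaryGrp n) : (M (v * u * v⁻¹)).trace = (M u).trace := by
  rw [map_mul, map_mul, Matrix.trace_mul_cycle, ← map_mul, ← map_mul, inv_mul_cancel, one_mul]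

theorem trace_rep_diagU (hM : ∀ a b, Continuous fun u => M u a b) {P : Finset (Fin n → ℤ)}
    (hexp : ∀ t, M (diagU n t) = ∑ ω ∈ P, torusChar ω t • weightProj M ω) :
    ∃ m : (Fin n → ℤ) → ℕ, d = ∑ ω ∈ P, m ω ∧
      ∀ t, (M (diagU n t)).trace = ∑ ω ∈ P, (m ω : ℂ) * torusChar ω t := by
  choose m hm _ using weightProj_trace hM
  have h1 : ∀ t, (M (diagU n t)).trace = ∑ ω ∈ P, (m ω : ℂ) * torusChar ω t := fun t => by
    rw [hexp, Matrix.trace_sum]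
    refine Finset.sum_congr rfl fun ω _ => ?_
    rw [Matrix.trace_smul, hm, smul_eq_mul, mul_comm]
  refine ⟨m, ?_, h1⟩
  have h2 := h1 1
  simp only [map_one, Matrix.trace_one, Fintype.card_fin, mul_one] at h2
  exact_mod_cast h2

/-- `M` need not consist of unitary matrices, but on the torus, and so up to conjugation everywhere,
the trace is a sum of `d` numbers of modulus one. -/
theorem norm_trace_rep_le (hM : ∀ a b, Continuous fun u => M u a b) (u : UnitaryGrp n) :
    ‖(M u).trace‖ ≤ d := by
  obtain ⟨P, _, hexp⟩ := exists_weights hM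
  obtain ⟨m, hd, hm⟩ := trace_rep_diagU hM hexp
  obtain ⟨v, t, rfl⟩ := unitary_diagonalizable u
  rw [trace_rep_conj, hm, hd, Nat.cast_sum]
  refine (norm_sum_le _ _).trans (Finset.sum_le_sum fun ω _ => ?_)
  rw [norm_mul, norm_torusChar, mul_one, Complex.norm_natCast]

theorem trace_rep_inv (hM : ∀ a b, Continuous fun u => M u a b) (u : UnitaryGrp n) :
    (M u⁻¹).trace = star (M u).trace := by
  obtain ⟨P, _, hexp⟩ := exists_weights hM
  obtain ⟨m, hd, hm⟩ := trace_rep_diagU hM hexp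
  obtain ⟨v, t, rfl⟩ := unitary_diagonalizable u
  rw [conj_inv, ← map_inv, trace_rep_conj, trace_rep_conj, hm, hm, star_sum]
  refine Finset.sum_congr rfl fun ω _ => ?_
  rw [star_mul', star_natCast]
  congr 1
  rw [torusChar_apply, torusChar_apply, star_prod]
  refine Finset.prod_congr rfl fun i _ => ?_
  rw [Pi.inv_apply, Circle.coe_inv_eq_conj, RCLike.star_def, map_zpow₀]

/-- If the character is polynomial of degree at most `K`, then the representation maps to a mixed
tensor power of order at most `K`. -/
theorem exists_intertwiner (hd : 0 < d) (hM : ∀ a b, Continuous fun u => M u a b) {K : ℕ}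
    (hχ : (fun u => (M u).trace) ∈ polyDeg n K) :
    ∃ k ≤ K, ∃ (e : Fin k → Bool) (Φ : Matrix (Fin k → Fin n) (Fin d) ℂ), Φ ≠ 0 ∧
      ∀ g, tensorRep e g * Φ = Φ * M g := by
  by_contra! hcon
  have hMi : ∀ a b, Continuous fun u => M u⁻¹ a b := fun a b => (hM a b).comp continuous_inv
  -- For fixed `Y` and `a` these averages form an intertwiner, hence vanish. Then the conjugate
  -- character integrates to zero against every polynomial of degree at most `K`, in particular
  -- against the character itself, contradicting its value `d` at `1`.
  have hten : ∀ k ≤ K, ∀ (e : Fin k → Bool) (X Y : Fin k → Fin n) (a b : Fin d),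
      ∫ u, tensorRep e u X Y * M u⁻¹ a b ∂unitaryHaar n = 0 := fun k hk e X Y a b => by
    set Φ : Matrix (Fin k → Fin n) (Fin d) ℂ :=
      Matrix.of fun X b => ∫ u, tensorRep e u X Y * M u⁻¹ a b ∂unitaryHaar n with hΦ
    have hcont : ∀ X b, Continuous fun u => tensorRep e u X Y * M u⁻¹ a b := fun X b =>
      (continuous_tensorRep_apply e X Y).fun_mul (hMi a b)
    by_cases h0 : Φ = 0
    · exact congrFun (congrFun h0 X) b
    · obtain ⟨g, hg⟩ := hcon k hk e Φ h0
      refine absurd ?_ hg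
      ext X b
      have e1 : (tensorRep e g * Φ) X b =
          ∫ u, tensorRep e (g * u) X Y * M u⁻¹ a b ∂unitaryHaar n := by
        simp only [tensorRep_mul, Matrix.mul_apply, Finset.sum_mul, hΦ, Matrix.of_apply]
        simp only [← integral_const_mul, mul_assoc]
        rw [integral_finsetSum _ fun Z _ => unitary_integrable ((hcont Z b).const_mul _)]
      have e2 : (Φ * M g) X b =
          ∫ u, tensorRep e u X Y * M (u⁻¹ * g) a b ∂unitaryHaar n := by
        simp only [map_mul, Matrix.mul_apply, Finset.mul_sum, hΦ, Matrix.of_apply]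
        simp only [← integral_mul_const, mul_assoc]
        rw [integral_finsetSum _ fun c _ => unitary_integrable
          (by simpa only [mul_assoc] using (hcont X c).mul_const _)]
      rw [e1, e2, ← integral_mul_left_eq_self (μ := unitaryHaar n)
        (fun u => tensorRep e u X Y * M (u⁻¹ * g) a b) g]
      simp only [mul_inv_rev, inv_mul_cancel_right]
  have hpoly : ∀ p ∈ polyDeg n K, ∫ u, p u * (M u⁻¹).trace ∂unitaryHaar n = 0 := fun p hp => by
    have hTr : Continuous fun u => (M u⁻¹).trace := continuous_finsetSum _ fun a _ => hMi a a
    have hc : ∀ q ∈ polyDeg n K, Continuous fun u => q u * (M u⁻¹).trace := fun q hq =>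
      (continuous_of_mem_polyFun (polyDeg_le_polyFun K hq)).fun_mul hTr
    induction hp using Submodule.span_induction with
    | mem f hf =>
      obtain ⟨l, hl, rfl⟩ := hf
      simp only [unitaryMonomial_eq_tensorRep, Matrix.trace, Matrix.diag_apply, Finset.mul_sum]
      rw [integral_finsetSum _ fun a _ => unitary_integrable
        ((continuous_tensorRep_apply _ _ _).fun_mul (hMi a a))]
      exact Finset.sum_eq_zero fun a _ => hten _ hl _ _ _ a a
    | zero => simp
    | add f g hf hg h1 h2 =>
      simp only [Pi.add_apply, add_mul]
      rw [integral_add (unitary_integrable (hc f hf)) (unitary_integrable (hc g hg)), h1, h2,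
        add_zero]
    | smul c f _ h => simp only [Pi.smul_apply, smul_eq_mul, mul_assoc, integral_const_mul, h, mul_zero]
  have h1 := hpoly _ hχ
  have hsq : ∀ z : ℂ, z * star z = ((‖z‖ ^ 2 : ℝ) : ℂ) := fun z => by
    rw [RCLike.star_def, Complex.mul_conj, Complex.normSq_eq_norm_sq]
  simp only [trace_rep_inv hM, hsq] at h1
  rw [integral_complex_ofReal, Complex.ofReal_eq_zero] at h1
  have h2 : (M 1).trace = 0 :=
    eq_zero_of_integral_norm_sq (continuous_finsetSum _ fun a _ => hM a a) h1 1
  rw [map_one, Matrix.trace_one, Fintype.card_fin, Nat.cast_eq_zero] at h2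
  omega

/-- An irreducible representation with a nonzero map to a mixed tensor power is cut out by a
projection. -/
theorem exists_tensor_projection (hirr : MatrixIrreducible M) {k : ℕ} {e : Fin k → Bool}
    {Φ : Matrix (Fin k → Fin n) (Fin d) ℂ} (hΦ0 : Φ ≠ 0)
    (hΦ : ∀ g, tensorRep e g * Φ = Φ * M g) :
    Function.Injective Φ.mulVec ∧ ∃ R : Matrix (Fin k → Fin n) (Fin k → Fin n) ℂ,
      (∀ X Y, ‖R X Y‖ ≤ 1) ∧ (∀ g, R * tensorRep e g = tensorRep e g * R) ∧
        ∀ g, (M g).trace = (R * tensorRep e g).trace := by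
  have hinj : Function.Injective Φ.mulVec := by
    let W : Submodule ℂ (Fin d → ℂ) := LinearMap.ker Φ.mulVecLin
    have hmem : ∀ v, v ∈ W ↔ Φ.mulVec v = 0 := fun v => Iff.rfl
    have hW : W = ⊥ ∨ W = ⊤ := hirr W fun g v hv => by
      rw [hmem] at hv ⊢
      rw [Matrix.mulVec_mulVec, ← hΦ, ← Matrix.mulVec_mulVec, hv, Matrix.mulVec_zero]
    rcases hW with h | h
    · exact LinearMap.ker_eq_bot.mp h
    · obtain ⟨v, hv⟩ := exists_mulVec_ne_zero hΦ0
      exact absurd ((hmem v).mp (h ▸ Submodule.mem_top)) hv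
  refine ⟨hinj, ?_⟩
  -- The Gram matrix corrects for `Φ` not being isometric, so that `R` is the orthogonal projection
  -- on the image of `Φ`.
  set G := Φ.conjTranspose * Φ with hG
  have hGdet : IsUnit G.det := by
    rw [← Matrix.isUnit_iff_isUnit_det]
    open scoped ComplexOrder in
    exact (Matrix.PosDef.conjTranspose_mul_self Φ hinj).isUnit
  have hGh : G⁻¹.conjTranspose = G⁻¹ := by
    rw [Matrix.conjTranspose_nonsing_inv, hG, Matrix.conjTranspose_mul,
      Matrix.conjTranspose_conjTranspose]
  set R := Φ * G⁻¹ * Φ.conjTranspose with hR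
  have hRh : R.conjTranspose = R := by
    rw [hR, Matrix.conjTranspose_mul, Matrix.conjTranspose_mul, Matrix.conjTranspose_conjTranspose,
      hGh, Matrix.mul_assoc]
  have hRR : R * R = R := by
    calc R * R = Φ * G⁻¹ * (G * G⁻¹) * Φ.conjTranspose := by rw [hR, hG]; simp only [Matrix.mul_assoc]
      _ = R := by rw [Matrix.mul_nonsing_inv _ hGdet, Matrix.mul_one]
  have hΦs : ∀ g, Φ.conjTranspose * tensorRep e g = (M g⁻¹).conjTranspose * Φ.conjTranspose :=
    fun g => by
      rw [← Matrix.conjTranspose_mul, ← hΦ, Matrix.conjTranspose_mul, tensorRep_conjTranspose,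
        inv_inv]
  have hMG : ∀ g, M g * G⁻¹ = G⁻¹ * (M g⁻¹).conjTranspose := fun g => by
    have h1 : G * M g = (M g⁻¹).conjTranspose * G := by
      rw [hG, Matrix.mul_assoc, ← hΦ, ← Matrix.mul_assoc, hΦs, Matrix.mul_assoc]
    calc M g * G⁻¹ = G⁻¹ * (G * M g) * G⁻¹ := by
          rw [← Matrix.mul_assoc, Matrix.nonsing_inv_mul _ hGdet, Matrix.one_mul]
      _ = _ := by
          rw [h1, Matrix.mul_assoc, Matrix.mul_assoc, Matrix.mul_nonsing_inv _ hGdet, Matrix.mul_one]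
  have hcomm : ∀ g, R * tensorRep e g = tensorRep e g * R := fun g => by
    rw [hR, Matrix.mul_assoc, hΦs, ← Matrix.mul_assoc, Matrix.mul_assoc Φ, ← hMG]
    simp only [← Matrix.mul_assoc, hΦ]
  refine ⟨R, fun X Y => ?_, hcomm, fun g => ?_⟩
  -- For a Hermitian idempotent, a diagonal entry is the squared length of its row; this bounds it
  -- by one, and then the whole row.
  · have h1 : ∑ Z, ‖R X Z‖ ^ 2 = (R X X).re := by
      have : R X X = ∑ Z, ((‖R X Z‖ ^ 2 : ℝ) : ℂ) := by
        conv_lhs => rw [← hRR, Matrix.mul_apply]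
        refine Finset.sum_congr rfl fun Z _ => ?_
        have : R Z X = star (R X Z) := by conv_lhs => rw [← hRh, Matrix.conjTranspose_apply]
        rw [this, RCLike.star_def, Complex.mul_conj, Complex.normSq_eq_norm_sq]
      rw [this, ← Complex.ofReal_sum, Complex.ofReal_re]
    have h2 : ∀ Z, ‖R X Z‖ ^ 2 ≤ ‖R X X‖ := fun Z =>
      (Finset.single_le_sum (fun Z _ => sq_nonneg ‖R X Z‖) (Finset.mem_univ Z)).trans
        (h1.le.trans (Complex.re_le_norm _))
    have h3 : ‖R X X‖ ≤ 1 := by nlinarith [h2 X, norm_nonneg (R X X)]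
    nlinarith [h2 Y, norm_nonneg (R X Y)]
  · rw [hcomm, hR, ← Matrix.mul_assoc, ← Matrix.mul_assoc, hΦ, Matrix.trace_mul_comm,
      ← Matrix.mul_assoc, ← Matrix.mul_assoc, ← hG, Matrix.trace_mul_comm, ← Matrix.mul_assoc,
      Matrix.nonsing_inv_mul _ hGdet, Matrix.one_mul]

end Irreducible

/-! ### Bounding a character by few products of entries -/

section CharacterBound

variable {n d : ℕ} {M : UnitaryGrp n →* Matrix (Fin d) (Fin d) ℂ}

theorem sign_prod_eq_neg_one_of_lonely {k : ℕ} {f : Fin k ⊕ Fin k → Fin n} {p : Fin k ⊕ Fin k}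
    (hp : ∀ q, q ≠ p → f q ≠ f p) :
    (∏ q, if f (Sum.inl q) = f p then (-1 : ℂ) else 1) *
      (∏ q, if f (Sum.inr q) = f p then (-1 : ℂ) else 1) = -1 := by
  rw [← Fintype.prod_sum_type fun q => if f q = f p then (-1 : ℂ) else 1,
    Finset.prod_eq_single p (fun q _ hq => if_neg (hp q hq)) (by simp), if_pos rfl]

/-- A matrix commuting with a mixed tensor power vanishes at pairs of multi-indices with a value
that is taken once. -/
theorem apply_eq_zero_of_lonely {k : ℕ} {e : Fin k → Bool}
    {R : Matrix (Fin k → Fin n) (Fin k → Fin n) ℂ}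
    (hR : ∀ g, R * tensorRep e g = tensorRep e g * R) {f : Fin k ⊕ Fin k → Fin n}
    {p : Fin k ⊕ Fin k} (hp : ∀ q, q ≠ p → f q ≠ f p) :
    R (fun q => f (Sum.inl q)) (fun q => f (Sum.inr q)) = 0 := by
  have h1 := sign_prod_eq_neg_one_of_lonely hp
  have h2 := congrFun (congrFun (hR (signU (f p))) fun q => f (Sum.inl q)) fun q => f (Sum.inr q)
  rw [tensorRep_signU, Matrix.mul_diagonal, Matrix.diagonal_mul] at h2
  set x := ∏ q, if f (Sum.inl q) = f p then (-1 : ℂ) else 1 with hx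
  set y := ∏ q, if f (Sum.inr q) = f p then (-1 : ℂ) else 1 with hy
  have hxx : x * x = 1 := by
    rw [hx, ← Finset.prod_mul_distrib]
    exact Finset.prod_eq_one fun q _ => by split_ifs <;> norm_num
  have hyx : y = -x := by linear_combination x * h1 - y * hxx
  rw [hyx] at h2
  have hx0 : x ≠ 0 := fun h => by simp [h] at hxx
  have h3 : (2 * x) * R (fun q => f (Sum.inl q)) (fun q => f (Sum.inr q)) = 0 := by
    linear_combination -h2
  exact (mul_eq_zero.mp h3).resolve_left (mul_ne_zero two_ne_zero hx0)

/-- In the trace of `R * tensorRep e g`, only pairs of multi-indices in which every value is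
repeated survive, and the entries of `R` are at most one. Order `k = 0` is excluded because its
tensor space is a line and `d ≥ 2`. -/
theorem exists_entry_bound (hn : 0 < n) (hd : 2 ≤ d) (hM : ∀ a b, Continuous fun u => M u a b)
    (hirr : MatrixIrreducible M) {K : ℕ} (hχ : (fun u => (M u).trace) ∈ polyDeg n K) :
    ∃ k, 0 < k ∧ k ≤ K ∧ ∃ S : Finset (Fin k ⊕ Fin k → Fin n),
      S.card ≤ n ^ k * (k + 2) ^ (2 * k) ∧
        ∀ g, ‖(M g).trace‖ ≤ ∑ f ∈ S, ∏ q, ‖g (f (Sum.inr q)) (f (Sum.inl q))‖ := by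
  classical
  obtain ⟨k, hk, e, Φ, hΦ0, hΦ⟩ := exists_intertwiner (by omega) hM hχ
  obtain ⟨hinj, R, hR1, hcomm, htr⟩ := exists_tensor_projection hirr hΦ0 hΦ
  have hk0 : 0 < k := by
    by_contra h0
    obtain rfl : k = 0 := by omega
    have h1 := LinearMap.finrank_le_finrank_of_injective (f := Φ.mulVecLin) hinj
    simp only [Module.finrank_fintype_fun_eq_card, Fintype.card_fin, Fintype.card_pi,
      Finset.univ_eq_empty, Finset.prod_empty] at h1
    omega
  let S : Finset (Fin k ⊕ Fin k → Fin n) := Finset.univ.filter fun f => ∀ p, ∃ q, q ≠ p ∧ f q = f p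
  refine ⟨k, hk0, hk, S, ?_, fun g => ?_⟩
  · have := card_labelling_le (⟨0, hn⟩ : Fin n) ⟨0, hn⟩ k S
      (fun f _ => (Finset.card_le_univ _).trans (by simp [Fintype.card_sum]; omega))
      (fun f hf p _ _ => (Finset.mem_filter.mp hf).2 p)
    simpa [Fintype.card_sum, two_mul] using this
  · have h1 : (M g).trace = ∑ f : Fin k ⊕ Fin k → Fin n,
        R (fun q => f (Sum.inl q)) (fun q => f (Sum.inr q)) *
          tensorRep e g (fun q => f (Sum.inr q)) (fun q => f (Sum.inl q)) := by
      rw [htr, Matrix.trace]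
      simp only [Matrix.diag_apply, Matrix.mul_apply]
      rw [← Fintype.sum_prod_type' fun X Y => R X Y * tensorRep e g Y X]
      exact (Fintype.sum_equiv (Equiv.sumArrowEquivProdArrow (Fin k) (Fin k) (Fin n)) _ _
        fun f => rfl).symm
    have h2 : (M g).trace = ∑ f ∈ S, R (fun q => f (Sum.inl q)) (fun q => f (Sum.inr q)) *
          tensorRep e g (fun q => f (Sum.inr q)) (fun q => f (Sum.inl q)) := by
      rw [h1]
      refine (Finset.sum_subset (Finset.subset_univ S) fun f _ hf => ?_).symm
      have hf' : ∃ p, ∀ q, q ≠ p → f q ≠ f p := by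
        by_contra! hcon
        exact hf (Finset.mem_filter.mpr ⟨Finset.mem_univ _, hcon⟩)
      obtain ⟨p, hp⟩ := hf'
      rw [apply_eq_zero_of_lonely hcomm hp, zero_mul]
    rw [h2]
    refine (norm_sum_le _ _).trans (Finset.sum_le_sum fun f _ => ?_)
    rw [norm_mul, norm_tensorRep_apply]
    exact mul_le_of_le_one_left (Finset.prod_nonneg fun _ _ => norm_nonneg _) (hR1 _ _)

/-- The twist of a representation by a power of the determinant. -/
noncomputable def detTwist (b : ℤ) (M : UnitaryGrp n →* Matrix (Fin d) (Fin d) ℂ) :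
    UnitaryGrp n →* Matrix (Fin d) (Fin d) ℂ where
  toFun u := (u.1.det ^ b) • M u
  map_one' := by simp
  map_mul' u v := by
    have : (u * v).1.det = u.1.det * v.1.det := Matrix.det_mul _ _
    rw [this, map_mul, mul_zpow, smul_mul_smul_comm]

theorem detTwist_apply (b : ℤ) (u : UnitaryGrp n) : detTwist b M u = (u.1.det ^ b) • M u := rfl

theorem norm_unitary_det (u : UnitaryGrp n) : ‖u.1.det‖ = 1 :=
  CStarRing.norm_of_mem_unitary (Matrix.det_of_mem_unitary u.2)

theorem unitary_det_ne_zero (u : UnitaryGrp n) : u.1.det ≠ 0 :=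
  norm_ne_zero_iff.mp (by rw [norm_unitary_det]; exact one_ne_zero)

theorem continuous_detTwist (hM : ∀ a b, Continuous fun u => M u a b) (b : ℤ) (i j : Fin d) :
    Continuous fun u => detTwist b M u i j := by
  simp only [detTwist_apply, Matrix.smul_apply, smul_eq_mul]
  have hdet : Continuous fun u : UnitaryGrp n => u.1.det := continuous_subtype_val.matrix_det
  exact (hdet.zpow₀ b fun u => Or.inl (unitary_det_ne_zero u)).fun_mul (hM i j)

theorem MatrixIrreducible.detTwist (hirr : MatrixIrreducible M) (b : ℤ) :
    MatrixIrreducible (detTwist b M) := fun W hW => hirr W fun g v hv => by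
  have h := hW g v hv
  rw [detTwist_apply, Matrix.smul_mulVec] at h
  exact (Submodule.smul_mem_iff W (zpow_ne_zero b (unitary_det_ne_zero g))).mp h

theorem norm_trace_detTwist (b : ℤ) (u : UnitaryGrp n) :
    ‖(detTwist b M u).trace‖ = ‖(M u).trace‖ := by
  rw [detTwist_apply, Matrix.trace_smul, smul_eq_mul, norm_mul, norm_zpow, norm_unitary_det,
    one_zpow, one_mul]

theorem det_diagU (t : Fin n → Circle) (b : ℤ) :
    (diagU n t).1.det ^ b = torusChar (fun _ => b) t := by
  have : (diagU n t).1 = Matrix.diagonal fun i => (t i : ℂ) := rfl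
  rw [this, Matrix.det_diagonal, torusChar_apply, Finset.prod_zpow]

/-- Up to a twist, the character of an irreducible representation of small dimension is a
polynomial of small degree. -/
theorem exists_detTwist_mem_polyDeg (hd : 0 < d) (hM : ∀ a b, Continuous fun u => M u a b)
    (hirr : MatrixIrreducible M) {q : ℕ} (hq : d < 2 ^ (q + 1)) (hn : 4 * q + 1 < n) :
    ∃ (K : ℕ) (b : ℤ), K ≤ 2 * q ∧ n.choose K ≤ d ∧
      (fun u => (detTwist b M u).trace) ∈ polyDeg n K := by
  classical
  obtain ⟨P, hP, hexp⟩ := exists_weights hM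
  obtain ⟨m, hm, htr⟩ := trace_rep_diagU hM hexp
  have hcard := card_weights_le hM hP hexp
  have hperm : ∀ ω ∈ P, ∀ σ : Equiv.Perm (Fin n), ω ∘ σ ∈ P := fun ω hω σ =>
    (hP _).mpr (weightProj_perm_ne_zero hM ((hP _).mp hω) σ)
  have hstring : ∀ ω ∈ P, ∀ i j, ω j < ω i → ω - rootVec i j ∈ P := fun ω hω i j hij =>
    (hP _).mpr (weightProj_string hM ((hP _).mp hω) hij)
  have hPne : P.Nonempty := Finset.nonempty_iff_ne_empty.mpr fun h => by simp [h] at hm; omega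
  choose! b hb1 hb2 using fun ω (hω : ω ∈ P) =>
    exists_const_near_weight hperm hstring (hcard.trans_lt hq) hn hω
  obtain ⟨ω₀, hω₀⟩ := hPne
  -- All weights have the same coordinate sum, within `2 * q` of `n * b ω`; as `n > 4 * q`, the
  -- constants coincide.
  have hbeq : ∀ ω ∈ P, b ω = b ω₀ := fun ω hω => by
    have hsum := weight_sum_eq hM hirr ((hP _).mp hω₀) ((hP _).mp hω)
    have habs : ∀ η ∈ P, |∑ i, η i - n * b η| ≤ 2 * q := fun η hη => by
      have h1 : ∑ i, η i - n * b η = ∑ i, (η i - b η) := by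
        simp [Finset.sum_sub_distrib]
      rw [h1]
      refine (Finset.abs_sum_le_sum_abs _ _).trans ?_
      have h2 : ∑ i, |η i - b η| = ((∑ i, (η i - b η).natAbs : ℕ) : ℤ) := by
        push_cast; simp
      rw [h2]
      exact_mod_cast hb1 η hη
    have h1 := abs_le.mp (habs ω hω)
    have h2 := abs_le.mp (habs ω₀ hω₀)
    rw [hsum] at h1
    have hn' : (4 * q + 1 : ℤ) < n := by exact_mod_cast hn
    by_contra hne
    rcases lt_or_gt_of_ne hne with h | h
    · nlinarith [h1.1, h1.2, h2.1, h2.2]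
    · nlinarith [h1.1, h1.2, h2.1, h2.2]
  set c := b ω₀ with hc
  -- `K` is the largest deviation, so one weight both bounds the degree of the twisted character and
  -- supplies `n.choose K ≤ d`.
  obtain ⟨ω₁, hω₁, hmax⟩ := P.exists_max_image (fun ω => ∑ i, (ω i - c).natAbs) ⟨ω₀, hω₀⟩
  refine ⟨∑ i, (ω₁ i - c).natAbs, -c, ?_, ?_, ?_⟩
  · have := hb1 ω₁ hω₁; rwa [hbeq ω₁ hω₁] at this
  · have := hb2 ω₁ hω₁; rw [hbeq ω₁ hω₁] at this; exact this.trans hcard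
  · refine classFun_mem_polyDeg (fun u v => trace_rep_conj u v)
      (P.image fun ω => ω + fun _ => -c) (fun ω => (m (ω - fun _ => -c) : ℂ)) (fun t => ?_)
      fun ω hω => ?_
    · rw [Finset.sum_image fun ω _ ω' _ h => add_right_cancel h]
      simp only [add_sub_cancel_right]
      rw [detTwist_apply, Matrix.trace_smul, htr, det_diagU, smul_eq_mul, Finset.mul_sum]
      refine Finset.sum_congr rfl fun ω _ => ?_
      rw [torusChar_add]; ring
    · obtain ⟨η, hη, rfl⟩ := Finset.mem_image.mp hω
      simpa [sub_eq_add_neg] using hmax η hη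

end CharacterBound

/-! ### Word expectations -/

section WordBound

variable {n d r : ℕ}

theorem integral_entry_pow_le {L k : ℕ} (hn : 0 < n) (hk : 0 < k) (l : Fin (L + 1) → Fin r × Bool)
    (hl : ∀ k : Fin L, (l k.castSucc).1 = (l k.succ).1 → (l k.castSucc).2 = (l k.succ).2)
    (a b : Fin n) :
    ∫ g, ‖(List.ofFn fun k => letterVal g (l k)).prod a b‖ ^ k ∂haarPi r n ≤
      ((k * (L + 1) + 2 : ℕ) : ℝ) ^ (k * (3 * L + 5)) / √n ^ k := by
  set N : ℝ := ((k * (L + 1) + 2 : ℕ) : ℝ) with hN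
  have hn' : (0 : ℝ) < n := by exact_mod_cast hn
  have hs : 0 < √(n : ℝ) := Real.sqrt_pos.mpr hn'
  have hsn : √(n : ℝ) ^ k * √(n : ℝ) ^ k = (n : ℝ) ^ k := by
    rw [← mul_pow, Real.mul_self_sqrt hn'.le]
  have hs0 : 0 < √(n : ℝ) ^ k := pow_pos hs k
  have hN1 : (1 : ℝ) ≤ N := by rw [hN]; exact_mod_cast (by omega)
  have hwc : Continuous fun g : Fin r → UnitaryGrp n =>
      ‖(List.ofFn fun k => letterVal g (l k)).prod a b‖ := by
    have h1 : Continuous fun g : Fin r → UnitaryGrp n =>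
        (List.ofFn fun k => letterVal g (l k)).prod := by
      simp only [List.ofFn_eq_map]
      exact continuous_list_prod _ fun k _ => continuous_letterVal (l k)
    exact ((continuous_unitary_entry a b).comp h1).norm
  have hA : ∫ g, ‖(List.ofFn fun k => letterVal g (l k)).prod a b‖ ^ (2 * k) ∂haarPi r n ≤
      N ^ (k * (3 * L + 5)) / (n : ℝ) ^ k := by
    refine (word_moment_le hk l hl a b).trans ?_
    have e1 : (n : ℝ) ^ (k * L) * ((k * L + 2 : ℕ) : ℝ) ^ (2 * k * (L + 2)) *
        ((k * (L + 1)).factorial / (n : ℝ) ^ (k * (L + 1))) =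
          ((k * L + 2 : ℕ) : ℝ) ^ (2 * k * (L + 2)) * (k * (L + 1)).factorial / (n : ℝ) ^ k := by
      rw [mul_add k L 1, mul_one, pow_add]
      field_simp
    rw [e1]
    refine div_le_div_of_nonneg_right ?_ (by positivity)
    have h1 : ((k * L + 2 : ℕ) : ℝ) ≤ N := by
      rw [hN]; exact_mod_cast (by nlinarith)
    have h2 : ((k * (L + 1)).factorial : ℝ) ≤ N ^ (k * (L + 1)) := by
      rw [hN]
      exact_mod_cast (Nat.factorial_le_pow _).trans (Nat.pow_le_pow_left (by omega) _)
    calc ((k * L + 2 : ℕ) : ℝ) ^ (2 * k * (L + 2)) * (k * (L + 1)).factorial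
        ≤ N ^ (2 * k * (L + 2)) * N ^ (k * (L + 1)) := by gcongr
      _ = N ^ (k * (3 * L + 5)) := by rw [← pow_add]; congr 1; ring
  -- This replaces Cauchy–Schwarz in passing from the `2k`-th moment to the `k`-th. The weight `√n ^
  -- k` balances the two terms, the `2k`-th moment being of order `n ^ (-k)`.
  have hpt : ∀ x : ℝ, x ^ k ≤ (√n ^ k * x ^ (2 * k) + 1 / √n ^ k) / 2 := fun x => by
    have h1 : x ^ (2 * k) = x ^ k * x ^ k := by rw [two_mul, pow_add]
    have h2 : 0 ≤ (√n ^ k * x ^ k - 1) ^ 2 / √n ^ k := by positivity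
    have h3 : (√n ^ k * x ^ k - 1) ^ 2 / √n ^ k =
        √n ^ k * (x ^ k * x ^ k) - 2 * x ^ k + 1 / √n ^ k := by field_simp; ring
    rw [h1]; linarith
  calc _ ≤ ∫ g, (√n ^ k * ‖(List.ofFn fun k => letterVal g (l k)).prod a b‖ ^ (2 * k) +
        1 / √n ^ k) / 2 ∂haarPi r n :=
        integral_mono (haarPi_integrable (hwc.fun_pow k)) (haarPi_integrable
          (((continuous_const.fun_mul (hwc.fun_pow _)).fun_add continuous_const).div_const _))
          fun g => hpt _
    _ = (√n ^ k * ∫ g, ‖(List.ofFn fun k => letterVal g (l k)).prod a b‖ ^ (2 * k) ∂haarPi r n +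
        1 / √n ^ k) / 2 := by
        rw [integral_div, integral_add (haarPi_integrable (continuous_const.fun_mul (hwc.fun_pow _)))
          (integrable_const _), integral_const_mul, integral_const, probReal_univ, one_smul]
    _ ≤ (√n ^ k * (N ^ (k * (3 * L + 5)) / (n : ℝ) ^ k) + N ^ (k * (3 * L + 5)) / √n ^ k) / 2 := by
        gcongr
        exact one_le_pow₀ hN1
    _ = N ^ (k * (3 * L + 5)) / √n ^ k := by
        rw [← hsn]; field_simp; norm_num

/-- At most `n ^ k * N ^ (2 * k)` products of `k` entries, each of mean at most `N ^ (k * (3 * L +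
5)) / √n ^ k`. The base of the resulting power is at least one, so `k` may be raised to `K`. -/
theorem norm_integral_trace_word_le {L : ℕ} {M : UnitaryGrp n →* Matrix (Fin d) (Fin d) ℂ}
    (hn : 0 < n) (hd : 2 ≤ d)
    (hM : ∀ a b, Continuous fun u => M u a b) (hirr : MatrixIrreducible M) {K : ℕ}
    (hχ : (fun u => (M u).trace) ∈ polyDeg n K) (l : Fin (L + 1) → Fin r × Bool)
    (hl : ∀ k : Fin L, (l k.castSucc).1 = (l k.succ).1 → (l k.castSucc).2 = (l k.succ).2) :
    0 < K ∧ ∫ g, ‖(M (List.ofFn fun k => letterVal g (l k)).prod).trace‖ ∂haarPi r n ≤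
      (√n * ((K * (L + 1) + 2 : ℕ) : ℝ) ^ (3 * L + 7)) ^ K := by
  obtain ⟨k, hk0, hkK, S, hS, hbound⟩ := exists_entry_bound hn hd hM hirr hχ
  refine ⟨by omega, ?_⟩
  set N : ℝ := ((k * (L + 1) + 2 : ℕ) : ℝ) with hN
  have hn1 : (1 : ℝ) ≤ n := by exact_mod_cast hn
  have hn' : (0 : ℝ) < n := by linarith
  have hs : 0 < √(n : ℝ) := Real.sqrt_pos.mpr hn'
  have hs1 : 1 ≤ √(n : ℝ) := Real.one_le_sqrt.mpr hn1
  have hsn : √(n : ℝ) ^ k * √(n : ℝ) ^ k = (n : ℝ) ^ k := by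
    rw [← mul_pow, Real.mul_self_sqrt hn'.le]
  have hN1 : (1 : ℝ) ≤ N := by rw [hN]; exact_mod_cast (by omega)
  have hwc : Continuous fun g : Fin r → UnitaryGrp n =>
      (List.ofFn fun k => letterVal g (l k)).prod := by
    simp only [List.ofFn_eq_map]
    exact continuous_list_prod _ fun k _ => continuous_letterVal (l k)
  have hec : ∀ a b, Continuous fun g : Fin r → UnitaryGrp n =>
      ‖(List.ofFn fun k => letterVal g (l k)).prod a b‖ := fun a b =>
    ((continuous_unitary_entry a b).comp hwc).norm
  have htc : Continuous fun g : Fin r → UnitaryGrp n =>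
      ‖(M (List.ofFn fun k => letterVal g (l k)).prod).trace‖ :=
    ((continuous_finsetSum _ fun a _ => hM a a).comp hwc).norm
  have hterm : ∀ f : Fin k ⊕ Fin k → Fin n,
      ∫ g, ∏ q, ‖(List.ofFn fun k => letterVal g (l k)).prod (f (Sum.inr q)) (f (Sum.inl q))‖
        ∂haarPi r n ≤ N ^ (k * (3 * L + 5)) / √n ^ k := fun f => by
    have : Nonempty (Fin k) := ⟨⟨0, hk0⟩⟩
    have hk' : (0 : ℝ) < k := by exact_mod_cast hk0
    calc _ ≤ ∫ g, (∑ q, ‖(List.ofFn fun k => letterVal g (l k)).prod (f (Sum.inr q))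
            (f (Sum.inl q))‖ ^ k) / k ∂haarPi r n := by
          refine integral_mono (haarPi_integrable (continuous_finsetProd _ fun q _ => hec _ _))
            (haarPi_integrable ((continuous_finsetSum _ fun q _ =>
              (hec _ _).fun_pow k).div_const _)) fun g => ?_
          have := prod_le_avg_pow Finset.univ Finset.univ_nonempty (fun q =>
            ‖(List.ofFn fun k => letterVal g (l k)).prod (f (Sum.inr q)) (f (Sum.inl q))‖)
            fun q _ => norm_nonneg _
          simpa only [Finset.card_univ, Fintype.card_fin] using this
      _ = (∑ q, ∫ g, ‖(List.ofFn fun k => letterVal g (l k)).prod (f (Sum.inr q))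
            (f (Sum.inl q))‖ ^ k ∂haarPi r n) / k := by
          rw [integral_div, integral_finsetSum _ fun q _ => haarPi_integrable ((hec _ _).fun_pow k)]
      _ ≤ (∑ _q : Fin k, N ^ (k * (3 * L + 5)) / √n ^ k) / k := by
          gcongr with q
          exact integral_entry_pow_le hn hk0 l hl _ _
      _ = _ := by
          rw [Finset.sum_const, Finset.card_univ, Fintype.card_fin, nsmul_eq_mul]
          field_simp
  have hkN : ((k + 2 : ℕ) : ℝ) ≤ N := by
    rw [hN]; exact_mod_cast (by nlinarith)
  calc _ ≤ ∫ g, ∑ f ∈ S, ∏ q, ‖(List.ofFn fun k => letterVal g (l k)).prod (f (Sum.inr q))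
          (f (Sum.inl q))‖ ∂haarPi r n :=
        integral_mono (haarPi_integrable htc) (haarPi_integrable (continuous_finsetSum _ fun f _ =>
          continuous_finsetProd _ fun q _ => hec _ _)) fun g => hbound _
    _ = ∑ f ∈ S, ∫ g, ∏ q, ‖(List.ofFn fun k => letterVal g (l k)).prod (f (Sum.inr q))
          (f (Sum.inl q))‖ ∂haarPi r n :=
        integral_finsetSum _ fun f _ => haarPi_integrable (continuous_finsetProd _ fun q _ => hec _ _)
    _ ≤ ∑ _f ∈ S, N ^ (k * (3 * L + 5)) / √n ^ k := Finset.sum_le_sum fun f _ => hterm f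
    _ = S.card * (N ^ (k * (3 * L + 5)) / √n ^ k) := by rw [Finset.sum_const, nsmul_eq_mul]
    _ ≤ ((n : ℝ) ^ k * N ^ (2 * k)) * (N ^ (k * (3 * L + 5)) / √n ^ k) := by
        refine mul_le_mul_of_nonneg_right ?_ (by positivity)
        calc (S.card : ℝ) ≤ ((n ^ k * (k + 2) ^ (2 * k) : ℕ) : ℝ) := by exact_mod_cast hS
          _ = (n : ℝ) ^ k * ((k + 2 : ℕ) : ℝ) ^ (2 * k) := by push_cast; rfl
          _ ≤ _ := by gcongr
    _ = (√n * N ^ (3 * L + 7)) ^ k := by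
        rw [← hsn, mul_pow, ← pow_mul]
        have : N ^ ((3 * L + 7) * k) = N ^ (2 * k) * N ^ (k * (3 * L + 5)) := by
          rw [← pow_add]; congr 1; ring
        rw [this]
        field_simp
    _ ≤ (√n * ((K * (L + 1) + 2 : ℕ) : ℝ) ^ (3 * L + 7)) ^ k := by
        have : N ≤ ((K * (L + 1) + 2 : ℕ) : ℝ) := by
          rw [hN]; exact_mod_cast (by nlinarith)
        gcongr
    _ ≤ _ := by
        refine pow_le_pow_right₀ ?_ hkK
        have : (1 : ℝ) ≤ ((K * (L + 1) + 2 : ℕ) : ℝ) := by exact_mod_cast (by omega)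
        exact one_le_mul_of_one_le_of_one_le hs1 (one_le_pow₀ this)

end WordBound

/-! ### The main theorem -/

theorem div_pow_le_choose {n K : ℕ} (hK : 0 < K) (h : 2 * K ≤ n) :
    ((n : ℝ) / (2 * K)) ^ K ≤ n.choose K := by
  refine le_trans ?_ (Nat.pow_le_choose K n)
  have hK' : (0 : ℝ) < K := by exact_mod_cast hK
  have h1 : (n : ℝ) / 2 ≤ ((n + 1 - K : ℕ) : ℝ) := by
    rw [Nat.cast_sub (by omega)]
    have : (2 * K : ℝ) ≤ n := by exact_mod_cast h
    push_cast; linarith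
  have h2 : (K.factorial : ℝ) ≤ (K : ℝ) ^ K := by exact_mod_cast Nat.factorial_le_pow K
  have h3 : (n : ℝ) / (2 * K) = (n / 2) / K := by field_simp
  rw [h3, div_pow]
  have : (0 : ℝ) < K.factorial := by exact_mod_cast K.factorial_pos
  gcongr

theorem moment_bound_le_rpow {n K L d : ℕ} (hK : 0 < K)
    (hN : (K * (L + 1) + 2) ^ (12 * L + 34) ≤ n) (hd : n.choose K ≤ d) :
    (√n * ((K * (L + 1) + 2 : ℕ) : ℝ) ^ (3 * L + 7)) ^ K ≤ (d : ℝ) ^ (1 - 1 / 4 : ℝ) := by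
  set N := K * (L + 1) + 2 with hNdef
  have hKN : K + 2 ≤ N := by rw [hNdef]; nlinarith
  have h2K : 2 * K ≤ N ^ 2 := by nlinarith
  have hn2 : N ^ 2 ≤ n := (Nat.pow_le_pow_right (by omega) (by omega)).trans hN
  have hn0 : 0 < n := by nlinarith
  have hK' : (0 : ℝ) < K := by exact_mod_cast hK
  have hn' : (0 : ℝ) < n := by exact_mod_cast hn0
  have hch := (div_pow_le_choose hK (h2K.trans hn2)).trans (Nat.cast_le.mpr hd)
  set B : ℝ := √n * (N : ℝ) ^ (3 * L + 7) with hB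
  have hB0 : 0 ≤ B := by positivity
  -- The origin of `12 * L + 34`: the fourth power of `N ^ (3 * L + 7)` and the bound `N ^ 6` for
  -- `(2 * K) ^ 3` must together fit into one factor `n`.
  have hB4 : B ^ 4 ≤ ((n : ℝ) / (2 * K)) ^ 3 := by
    have h1 : √(n : ℝ) ^ 4 = (n : ℝ) ^ 2 := by
      rw [show 4 = 2 * 2 from rfl, pow_mul, Real.sq_sqrt hn'.le]
    rw [hB, mul_pow, h1, ← pow_mul, div_pow, le_div_iff₀ (by positivity)]
    have h3 : (2 * K : ℝ) ≤ (N : ℝ) ^ 2 := by exact_mod_cast h2K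
    have h4 : (N : ℝ) ^ (12 * L + 34) ≤ n := by exact_mod_cast hN
    calc (n : ℝ) ^ 2 * (N : ℝ) ^ ((3 * L + 7) * 4) * (2 * K) ^ 3
        ≤ (n : ℝ) ^ 2 * (N : ℝ) ^ ((3 * L + 7) * 4) * ((N : ℝ) ^ 2) ^ 3 := by gcongr
      _ = (n : ℝ) ^ 2 * (N : ℝ) ^ (12 * L + 34) := by
          rw [← pow_mul, mul_assoc, ← pow_add]; congr 2; ring
      _ ≤ (n : ℝ) ^ 2 * n := by gcongr
      _ = (n : ℝ) ^ 3 := by ring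
  have h4 : (B ^ K) ^ 4 ≤ (d : ℝ) ^ 3 := by
    calc (B ^ K) ^ 4 = (B ^ 4) ^ K := by rw [← pow_mul, ← pow_mul, mul_comm]
      _ ≤ (((n : ℝ) / (2 * K)) ^ 3) ^ K := by gcongr
      _ = (((n : ℝ) / (2 * K)) ^ K) ^ 3 := by rw [← pow_mul, ← pow_mul, mul_comm 3]
      _ ≤ (d : ℝ) ^ 3 := by gcongr
  calc B ^ K = ((B ^ K) ^ 4) ^ (1 / 4 : ℝ) := by
        rw [← Real.rpow_natCast (B ^ K) 4, ← Real.rpow_mul (by positivity)]; norm_num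
    _ ≤ ((d : ℝ) ^ 3) ^ (1 / 4 : ℝ) := by gcongr
    _ = (d : ℝ) ^ (1 - 1 / 4 : ℝ) := by
        rw [← Real.rpow_natCast (d : ℝ) 3, ← Real.rpow_mul (by positivity)]; norm_num

/-- Reduced words, as tuples of letters. -/
theorem exists_reduced_letters {r : ℕ} {w : FreeGroup (Fin r)} (hw : w ≠ 1) :
    ∃ (L : ℕ) (l : Fin (L + 1) → Fin r × Bool),
      (∀ k : Fin L, (l k.castSucc).1 = (l k.succ).1 → (l k.castSucc).2 = (l k.succ).2) ∧
        ∀ {n : ℕ} (g : Fin r → UnitaryGrp n),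
          wordMap w g = (List.ofFn fun k => letterVal g (l k)).prod := by
  obtain ⟨m, l, hl⟩ : ∃ m, ∃ l : Fin m → Fin r × Bool, w.toWord = List.ofFn l :=
    ⟨_, _, (List.ofFn_get _).symm⟩
  cases m with
  | zero => exact absurd (FreeGroup.toWord_eq_nil_iff.mp (by simpa using hl)) hw
  | succ L =>
    refine ⟨L, l, fun k => ?_, fun {n} g => ?_⟩
    · have h := FreeGroup.isReduced_toWord (x := w)
      rw [hl, FreeGroup.IsReduced, List.isChain_ofFn] at h
      exact h k (by omega)
    · rw [wordMap, ← FreeGroup.mk_toWord (x := w), FreeGroup.lift_mk, hl, List.map_ofFn]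
      rfl

/-- The matrix form of a continuous irreducible representation. -/
theorem exists_matrix_of_mem_Irr {n : ℕ} {ρ : UnitaryGrp n → ℂ} (hρ : ρ ∈ Irr (UnitaryGrp n)) :
    ∃ (d : ℕ) (M : UnitaryGrp n →* Matrix (Fin d) (Fin d) ℂ), 0 < d ∧
      (∀ a b, Continuous fun u => M u a b) ∧ MatrixIrreducible M ∧ ∀ u, ρ u = (M u).trace := by
  obtain ⟨d, π, hc, hirr, rfl⟩ := hρ
  let M : UnitaryGrp n →* Matrix (Fin d) (Fin d) ℂ :=
    { toFun := fun u => LinearMap.toMatrix' (π u)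
      map_one' := by rw [map_one]; exact LinearMap.toMatrix'_one
      map_mul' := fun u v => by rw [map_mul]; exact LinearMap.toMatrix'_mul _ _ }
  have hMv : ∀ u v, (M u).mulVec v = π u v := fun u v => LinearMap.toMatrix'_mulVec _ _
  refine ⟨d, M, ?_, fun a b => ?_, fun W hW => ?_, fun u => ?_⟩
  · by_contra h0
    obtain rfl : d = 0 := by omega
    obtain ⟨A, B, hAB⟩ := hirr.exists_pair_ne
    exact hAB (Subrepresentation.toSubmodule_injective (Subsingleton.elim _ _))
  · have h1 : ∀ u, M u a b = π u (Pi.single b 1) a := fun u => by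
      rw [← hMv, Matrix.mulVec_single_one]; rfl
    simp only [h1]
    exact (continuous_apply a).comp (hc _)
  · have h := hirr.eq_bot_or_eq_top ⟨W, fun g v hv => by rw [← hMv]; exact hW g v hv⟩
    exact h.imp (fun h => congrArg Subrepresentation.toSubmodule h)
      fun h => congrArg Subrepresentation.toSubmodule h
  · rw [← Matrix.trace_toLin'_eq]
    change LinearMap.trace ℂ _ (π u) = LinearMap.trace ℂ _ (Matrix.toLin' (LinearMap.toMatrix' (π u)))
    rw [Matrix.toLin'_toMatrix']

theorem mainTheorem8 (r : ℕ) (w : FreeGroup (Fin r)) (hw : w ≠ 1) :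
    ∃ C α ε : ℝ, 0 < C ∧ 0 < α ∧ 0 < ε ∧
      ∀ (n : ℕ), ∀ ρ ∈ Irr (UnitaryGrp n),
        (ρ 1).re ≤ (2 : ℝ) ^ (C * (n : ℝ) ^ α) →
          ‖wordExpectation w n ρ‖ ≤ (ρ 1).re ^ (1 - ε) := by
  obtain ⟨L, l, hl, hword⟩ := exists_reduced_letters hw
  -- With `q = Nat.log 2 d`, these constants turn the bound on the degree into `(4 * q * (L + 1)) ^
  -- (12 * L + 34) ≤ n`. As `K ≤ 2 * q` and `1 ≤ q`, this dominates the power of `K * (L + 1) + 2`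
  -- that `moment_bound_le_rpow` needs.
  refine ⟨1 / (4 * (L + 1)), 1 / ((12 * L + 34 : ℕ) : ℝ), 1 / 4, by positivity, by positivity,
    by norm_num, fun n ρ hρ hdim => ?_⟩
  obtain ⟨d, M, hd0, hM, hirr, htr⟩ := exists_matrix_of_mem_Irr hρ
  have hρ1 : (ρ 1).re = d := by
    rw [htr, map_one, Matrix.trace_one, Fintype.card_fin, Complex.natCast_re]
  rw [hρ1] at hdim ⊢
  have hnorm : ‖wordExpectation w n ρ‖ ≤
      ∫ g, ‖(M (List.ofFn fun k => letterVal g (l k)).prod).trace‖ ∂haarPi r n := by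
    refine (norm_integral_le_integral_norm _).trans (le_of_eq ?_)
    simp only [htr, hword]
  rcases Nat.lt_or_ge d 2 with hd | hd
  -- In degree one there is nothing to gain: both sides are bounded by, respectively equal to, one.
  · obtain rfl : d = 1 := by omega
    refine hnorm.trans ?_
    rw [Nat.cast_one, Real.one_rpow]
    have h1 : ∀ g, ‖(M (List.ofFn fun k => letterVal g (l k)).prod).trace‖ ≤ (1 : ℝ) := fun g =>
      (norm_trace_rep_le hM _).trans_eq Nat.cast_one
    have := integral_mono_of_nonneg (μ := haarPi r n)
      (Filter.Eventually.of_forall fun g => norm_nonneg _) (integrable_const 1)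
      (Filter.Eventually.of_forall h1)
    simpa using this
  · set q := Nat.log 2 d with hq
    have hq1 : 1 ≤ q := Nat.log_pos one_lt_two hd
    have hqd : d < 2 ^ (q + 1) := Nat.lt_pow_succ_log_self one_lt_two d
    have hqle : ((4 * q * (L + 1) : ℕ) : ℝ) ≤ (n : ℝ) ^ (1 / ((12 * L + 34 : ℕ) : ℝ)) := by
      have h1 : (2 : ℝ) ^ (q : ℝ) ≤ 2 ^ (1 / (4 * ((L : ℝ) + 1)) *
          (n : ℝ) ^ (1 / ((12 * L + 34 : ℕ) : ℝ))) := by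
        refine le_trans ?_ hdim
        rw [Real.rpow_natCast]
        exact_mod_cast Nat.pow_log_le_self 2 (by omega)
      have h2 := (Real.rpow_le_rpow_left_iff one_lt_two).mp h1
      rw [div_mul_eq_mul_div, one_mul, le_div_iff₀ (by positivity)] at h2
      push_cast at h2 ⊢
      linarith
    have hpow : (4 * q * (L + 1)) ^ (12 * L + 34) ≤ n := by
      have h1 := pow_le_pow_left₀ (by positivity) hqle (12 * L + 34)
      rw [← Real.rpow_natCast ((n : ℝ) ^ _), ← Real.rpow_mul (by positivity),
        one_div_mul_cancel (by positivity), Real.rpow_one] at h1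
      exact_mod_cast h1
    have hn : 4 * q + 1 < n := by
      have h1 : (4 * q * (L + 1)) ^ 2 ≤ n :=
        (Nat.pow_le_pow_right (by positivity) (by omega)).trans hpow
      have h2 : 4 * q ≤ 4 * q * (L + 1) := Nat.le_mul_of_pos_right _ (by omega)
      nlinarith
    obtain ⟨K, b, hKq, hch, hχ⟩ := exists_detTwist_mem_polyDeg hd0 hM hirr hqd hn
    obtain ⟨hK, hbound⟩ := norm_integral_trace_word_le (by omega) hd (continuous_detTwist hM b)
      (hirr.detTwist b) hχ l hl
    simp only [norm_trace_detTwist] at hbound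
    refine (hnorm.trans hbound).trans (moment_bound_le_rpow hK ?_ hch)
    refine (Nat.pow_le_pow_left ?_ _).trans hpow
    nlinarith
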